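/- Let $d\ge 1$ and let $K\subset\mathbb R^d$ be a centrally symmetric convex body (compact, convex, $-K=K$, nonempty interior). For a locally integrable $f:\mathbb R^d\to\mathbb R$ put $$Mf(x)=\sup_{\lambda>0}\frac1{|x+\lambda K|}\int_{x+\lambda K}f\,dy\in(-\infty,\infty],$$ and call $f$ a fixed point of $M$ if $Mf=f$ almost everywhere. Functions are identified when they agree almost everywhere. 1. If $d=1$ or $d=2$, then the fixed points of $M$ in $L^\infty(\mathbb R^d)$ are exactly the constant functions. 2. Let $d\ge 3$. (a) For $1\le p\le \frac d{d-2}$, $M$ has no nonzero fixed point in $L^p(\mathbb R^d)$. (b) Let $G(x)=\frac{|x|^{2-d}}{d(d-2)|B(0,1)|}$ be the Green's function of Laplace's equation on $\mathbb R^d$, fix any point $x_0\ne0$, and let $a_{ijk\ell}=\partial_i\partial_j\partial_k\partial_\ell G(x_0)$. If $K$ is normalized by $\int_K x_ix_j\,dx=\delta_{ij}$ for all $i,j$, and $$\int_K\sum_{1\le i,j,k,\ell\le d}a_{ijk\ell}\,x_ix_jx_kx_\ell\,dx\ne0,$$ then there is $q>\frac d{d-2}$ (depending on $K$) such that for $1\le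 p\le q$, $M$ has no nonzero fixed point in $L^p(\mathbb R^d)$. (c) For every $x_0\neq 0$, the condition in (b) is generic: the normalized centrally symmetric convex bodies that satisfy it form an open and dense subset of the space of all normalized centrally symmetric convex bodies, with the Hausdorff metric. -/

import Mathlib

open MeasureTheory
open scoped Pointwise

noncomputable section

/-- `ℝ^d` with its Euclidean norm and Lebesgue measure. -/
abbrev Rd (d : ℕ) : Type := EuclideanSpace ℝ (Fin d)

/-- `K` is a centrally symmetric convex body: on top of being nonempty, convex and compact
(`ConvexBody`), it satisfies `-K = K` and has nonempty interior. -/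
def IsSymmetricBody {d : ℕ} (K : ConvexBody (Rd d)) : Prop :=
  (∀ x ∈ K, -x ∈ K) ∧ (interior (K : Set (Rd d))).Nonempty

/-- The normalization `∫_K x_i x_j dx = δ_{ij}`. -/
def IsNormalized {d : ℕ} (K : ConvexBody (Rd d)) : Prop :=
  ∀ i j : Fin d, ∫ x in (K : Set (Rd d)), x i * x j = if i = j then 1 else 0

/-- The centered maximal function `Mf(x) = sup_{r > 0} |x + rK|⁻¹ ∫_{x + rK} f`, with values in
the extended reals, so that the supremum is always the true one. -/
def maximalFn {d : ℕ} (K : ConvexBody (Rd d)) (f : Rd d → ℝ) (x : Rd d) : EReal :=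
  ⨆ (r : ℝ) (_ : 0 < r), ((⨍ y in x +ᵥ r • (K : Set (Rd d)), f y : ℝ) : EReal)

/-- `f` is a fixed point of the maximal operator: `Mf = f` almost everywhere. -/
def IsMaximalFixedPoint {d : ℕ} (K : ConvexBody (Rd d)) (f : Rd d → ℝ) : Prop :=
  ∀ᵐ x : Rd d, maximalFn K f x = (f x : EReal)

/-- The Green's function of the Laplace equation on `ℝ^d`, `d ≥ 3`, with pole at the origin:
`|x|^{2-d} / (d (d-2) |B(0,1)|)`. -/
def greenFn (d : ℕ) (x : Rd d) : ℝ :=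
  ‖x‖ ^ (2 - (d : ℤ)) / ((d : ℝ) * ((d : ℝ) - 2) * volume.real (Metric.ball (0 : Rd d) 1))

/-- The fourth partial derivatives `a_{ijkl} = ∂_i ∂_j ∂_k ∂_l G (x₀)` of the Green's function. -/
def greenCoeff {d : ℕ} (x₀ : Rd d) (i j k l : Fin d) : ℝ :=
  iteratedFDeriv ℝ 4 (greenFn d) x₀
    ![EuclideanSpace.single i 1, EuclideanSpace.single j 1,
      EuclideanSpace.single k 1, EuclideanSpace.single l 1]

/-- The fourth-moment condition `∫_K ∑ a_{ijkl} x_i x_j x_k x_l dx ≠ 0`, with the coefficients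
taken at the point `x₀`. -/
def FourthMomentCondition {d : ℕ} (x₀ : Rd d) (K : ConvexBody (Rd d)) : Prop :=
  ∫ x in (K : Set (Rd d)),
    ∑ i, ∑ j, ∑ k, ∑ l, greenCoeff x₀ i j k l * (x i * x j * x k * x l) ≠ 0

/-- The space of normalized centrally symmetric convex bodies in `ℝ^d`; as a subtype of
`ConvexBody` it carries the Hausdorff metric. -/
abbrev NormalizedBody (d : ℕ) : Type :=
  {K : ConvexBody (Rd d) // IsSymmetricBody K ∧ IsNormalized K}

end

noncomputable section

open Filter Topology
open scoped ContDiff RealInnerProductSpace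

/-! A fixed point dominates all its averages over `x + rK`, and apart from the converse for
constants nothing else about it is used. Mollification preserves this property
(`superAverage_mollify`), so one may argue with continuous functions. A comparison principle
(`SuperAverage.ge_of_strict_sub`) bounds them from below by barriers `w` that are strictly below one
of their own averages at each point outside a bounded set.

To second order in `r`, averaging over a symmetric body acts as an elliptic operator given by the
second moments of `K`. A linear change of coordinates turns it into the Laplacian, so strictly
subharmonic radial functions serve as barriers. In dimension at most two, `-√(log |x|²)` is strictly
subharmonic and tends to minus infinity. A super-average bounded below therefore attains its
minimum, and then it is constant. For `d ≥ 3` an `L^p` fixed point is nonnegative; if it is nonzero,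
it has a positive lower bound on every ball. The barriers `|x|^(-α)`, `α > d - 2`, give `f ≥ c
|x|^(-α)` away from the origin with `c` independent of `α`, hence also at `α = d - 2`. This excludes
`p ≤ d/(d-2)`, endpoint included.

To pass the endpoint, a barrier must decay more slowly than the Green's function, and its radial
part is then superharmonic. The fourth moment of a normalized `K` against the zonal harmonic
`zonalQuartic` is the next term in the averages of the Green's function. Its mean over directions is
zero, so if it is nonzero somewhere, it is positive in some direction `e`. Averages of the Green's
function then exceed its value by a definite amount at one fixed scale near `e`, and this survives a
small perturbation. Away from `e`, a small multiple of `|x|^(2-d+ε) exp(N cos angle)` supplies a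
positive Laplacian. The sum is `coneBarrier`, and homogeneity extends the estimate from the unit
sphere outward (`exists_coneBarrier`).

Openness holds because integrals over `K` are continuous in the Hausdorff metric. For density,
suppose the zonal moment vanishes identically for all bodies near `K`. Then the ratio of fourth to
second moments is a quadratic form for each of them. Cutting small symmetric caps at a point `p`
farthest from some center and differentiating forces the ratio of `K` to be `κ|x|² + ⟪x,p⟫²`
(`eq_of_parallelogramLaw_variation`). Two suitable farthest points are incompatible with this. Hence
some nearby body has a moment that is nonzero somewhere, and a small rotation makes it nonzero at
`x₀`. -/

/-- `u` dominates each of its averages over the sets `x + r K`. -/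
def SuperAverage {d : ℕ} (K : ConvexBody (Rd d)) (u : Rd d → ℝ) : Prop :=
  ∀ x, ∀ r : ℝ, 0 < r →
    ∫ y in (K : Set (Rd d)), u (x + r • y) ≤ volume.real (K : Set (Rd d)) * u x

/-- The almost everywhere version of `SuperAverage`. -/
def AESuperAverage {d : ℕ} (K : ConvexBody (Rd d)) (f : Rd d → ℝ) : Prop :=
  ∀ᵐ x, ∀ r : ℝ, 0 < r →
    ∫ y in (K : Set (Rd d)), f (x + r • y) ≤ volume.real (K : Set (Rd d)) * f x

/-! ### Averages over scaled bodies and the maximal fixed-point equation. -/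

lemma IsSymmetricBody.exists_ball_subset {d : ℕ} {K : ConvexBody (Rd d)}
    (hK : IsSymmetricBody K) : ∃ δ > 0, Metric.ball (0 : Rd d) δ ⊆ K := by
  obtain ⟨hs, x, hx⟩ := hK
  obtain ⟨δ, hδ, hball⟩ := Metric.isOpen_iff.1 isOpen_interior x hx
  refine ⟨δ, hδ, fun y hy => ?_⟩
  have h1 : x + y ∈ (K : Set (Rd d)) := interior_subset (hball (by simpa using hy))
  have h2 : -x ∈ (K : Set (Rd d)) := hs _ (interior_subset hx)
  have h3 : -(x - y) ∈ (K : Set (Rd d)) := hs _ (interior_subset (hball (by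
    simpa [dist_eq_norm] using hy)))
  have := K.convex h1 h3 (a := 1/2) (b := 1/2) (by norm_num) (by norm_num) (by norm_num)
  convert this using 1
  module

lemma ConvexBody.measurableSet {d : ℕ} (K : ConvexBody (Rd d)) :
    MeasurableSet (K : Set (Rd d)) :=
  K.isCompact.measurableSet

lemma IsSymmetricBody.volume_pos {d : ℕ} {K : ConvexBody (Rd d)}
    (hK : IsSymmetricBody K) : 0 < volume.real (K : Set (Rd d)) := by
  refine ENNReal.toReal_pos ?_ K.isCompact.measure_lt_top.ne
  exact (lt_of_lt_of_le (isOpen_interior.measure_pos volume hK.2)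
    (measure_mono interior_subset)).ne'

lemma setIntegral_comp_add_smul {d : ℕ} (K : ConvexBody (Rd d)) (f : Rd d → ℝ) (x : Rd d) {r : ℝ}
    (hr : 0 < r) :
    ∫ y in (K : Set (Rd d)), f (x + r • y) =
      (r ^ d)⁻¹ * ∫ y in x +ᵥ r • (K : Set (Rd d)), f y := by
  have h1 : ∫ y in x +ᵥ r • (K : Set (Rd d)), f y = ∫ y in r • (K : Set (Rd d)), f (x + y) := by
    have := (measurePreserving_add_left (volume : Measure (Rd d)) x).setIntegral_image_emb
      (MeasurableEquiv.addLeft x).measurableEmbedding f (r • (K : Set (Rd d)))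
    rw [← this]
    rfl
  rw [Measure.setIntegral_comp_smul_of_pos volume (fun y => f (x + y)) (K : Set (Rd d)) hr, h1]
  simp

lemma setAverage_vadd_smul {d : ℕ} (K : ConvexBody (Rd d)) (f : Rd d → ℝ) (x : Rd d) {r : ℝ}
    (hr : 0 < r) :
    ⨍ y in x +ᵥ r • (K : Set (Rd d)), f y =
      (volume.real (K : Set (Rd d)))⁻¹ * ∫ y in (K : Set (Rd d)), f (x + r • y) := by
  have h2 : volume.real (x +ᵥ r • (K : Set (Rd d))) = r ^ d * volume.real (K : Set (Rd d)) := by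
    rw [measureReal_def, measure_vadd, Measure.addHaar_smul]
    simp [measureReal_def, abs_of_pos (pow_pos hr d), hr.le]
  rw [setAverage_eq, h2, setIntegral_comp_add_smul K f x hr, mul_inv, smul_eq_mul]
  ring

/-- Each average is at most the supremum. The nonexistence and constancy results use only this half
of the equation. -/
lemma IsMaximalFixedPoint.aeSuperAverage {d : ℕ} {K : ConvexBody (Rd d)}
    (hK : IsSymmetricBody K) {f : Rd d → ℝ} (hf : IsMaximalFixedPoint K f) :
    AESuperAverage K f := by
  filter_upwards [hf] with x hx r hr
  have h1 : ((⨍ y in x +ᵥ r • (K : Set (Rd d)), f y : ℝ) : EReal) ≤ f x := by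
    rw [← hx, maximalFn]
    exact le_iSup₂ (f := fun (r : ℝ) (_ : 0 < r) =>
      ((⨍ y in x +ᵥ r • (K : Set (Rd d)), f y : ℝ) : EReal)) r hr
  rw [EReal.coe_le_coe_iff, setAverage_vadd_smul K f x hr, inv_mul_le_iff₀ hK.volume_pos] at h1
  exact h1

lemma quasiMeasurePreserving_add_smul {d : ℕ} (x : Rd d) {r : ℝ} (hr : 0 < r) :
    Measure.QuasiMeasurePreserving (fun y : Rd d => x + r • y) volume volume :=
  (measurePreserving_add_left volume x).quasiMeasurePreserving.comp
    (Measure.quasiMeasurePreserving_smul volume hr.ne')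

lemma integral_add_smul_congr {d : ℕ} (K : ConvexBody (Rd d)) {f g : Rd d → ℝ} (h : f =ᵐ[volume] g)
    (x : Rd d) {r : ℝ} (hr : 0 < r) :
    ∫ y in (K : Set (Rd d)), f (x + r • y) = ∫ y in (K : Set (Rd d)), g (x + r • y) :=
  integral_congr_ae (ae_restrict_of_ae ((quasiMeasurePreserving_add_smul x hr).ae h))

lemma AESuperAverage.congr {d : ℕ} {K : ConvexBody (Rd d)} {f g : Rd d → ℝ}
    (hf : AESuperAverage K f) (h : f =ᵐ[volume] g) : AESuperAverage K g := by
  filter_upwards [hf, h] with x hx hfg r hr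
  rw [← hfg, ← integral_add_smul_congr K h x hr]
  exact hx r hr

lemma isMaximalFixedPoint_of_ae_const {d : ℕ} {K : ConvexBody (Rd d)}
    (hK : IsSymmetricBody K) {f : Rd d → ℝ} {c : ℝ} (hf : f =ᵐ[volume] fun _ => c) :
    IsMaximalFixedPoint K f := by
  filter_upwards [hf] with x hx
  have h : ∀ r : ℝ, 0 < r → (⨍ y in x +ᵥ r • (K : Set (Rd d)), f y : ℝ) = c := by
    intro r hr
    rw [setAverage_vadd_smul K f x hr, integral_add_smul_congr K hf x hr, setIntegral_const,
      smul_eq_mul, inv_mul_cancel_left₀ hK.volume_pos.ne']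
  rw [maximalFn, hx]
  apply le_antisymm
  · exact iSup₂_le fun r hr => by rw [h r hr]
  · have := le_iSup₂ (f := fun (r : ℝ) (_ : 0 < r) =>
      ((⨍ y in x +ᵥ r • (K : Set (Rd d)), f y : ℝ) : EReal)) 1 one_pos
    rwa [h 1 one_pos] at this

lemma Continuous.integrableOn_comp_add_smul {d : ℕ} (K : ConvexBody (Rd d)) {u : Rd d → ℝ}
    (hu : Continuous u) (x : Rd d) (r : ℝ) :
    IntegrableOn (fun y => u (x + r • y)) K volume :=
  (Continuous.continuousOn (by fun_prop)).integrableOn_compact K.isCompact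

/-! ### Comparison and minimum principles. -/

/-- Comparison of a super-average with a strict sub-average on the complement of a set. -/
lemma SuperAverage.ge_of_strict_sub {d : ℕ} {K : ConvexBody (Rd d)}
    {u w : Rd d → ℝ} (hu : SuperAverage K u) (huc : Continuous u) (hwc : Continuous w)
    {s : Set (Rd d)}
    (hw : ∀ x ∉ s, ∃ r : ℝ, 0 < r ∧
      volume.real (K : Set (Rd d)) * w x < ∫ y in (K : Set (Rd d)), w (x + r • y))
    (hs : ∀ x ∈ s, w x ≤ u x)
    (hinf : ∀ ε > 0, ∀ᶠ x in cocompact (Rd d), w x - ε ≤ u x) (x : Rd d) : w x ≤ u x := by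
  by_contra! hx
  obtain ⟨z, hz⟩ : ∃ z, ∀ y, u z - w z ≤ u y - w y := by
    -- Near infinity `u - w` is at least its negative value at `x`, so its minimum is attained.
    refine (huc.sub hwc).exists_forall_le' x ?_
    filter_upwards [hinf (w x - u x) (by linarith)] with y hy
    simp only [Pi.sub_apply]
    linarith
  have hzneg : u z - w z < 0 := lt_of_le_of_lt (hz x) (by linarith)
  have hzs : z ∉ s := fun h => by linarith [hs z h]
  obtain ⟨r, hr, hlt⟩ := hw z hzs
  have hle := hu z r hr
  -- Averaging about a minimum cannot decrease `u - w`, whereas the properties of `u` and `w` at `z`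
  -- say that it does.
  have h1 : ∫ y in (K : Set (Rd d)), (u z - w z) ≤
      ∫ y in (K : Set (Rd d)), (u (z + r • y) - w (z + r • y)) := by
    refine setIntegral_mono ?_ ?_ fun y => hz _
    · exact integrableOn_const K.isCompact.measure_lt_top.ne
    · exact (huc.integrableOn_comp_add_smul K z r).sub (hwc.integrableOn_comp_add_smul K z r)
  rw [integral_sub (huc.integrableOn_comp_add_smul K z r) (hwc.integrableOn_comp_add_smul K z r),
    setIntegral_const, smul_eq_mul, mul_sub] at h1
  linarith

/-- Every scale is available, so a single set `x₁ + rK` already contains a neighbourhood of any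
prescribed `x`. On it a nonnegative continuous function has integral zero, so no chaining argument
is needed. -/
lemma SuperAverage.eq_const_of_min {d : ℕ} {K : ConvexBody (Rd d)} (hK : IsSymmetricBody K)
    {u : Rd d → ℝ} (hu : SuperAverage K u) (huc : Continuous u) {x₁ : Rd d}
    (hmin : ∀ x, u x₁ ≤ u x) (x : Rd d) : u x = u x₁ := by
  obtain ⟨δ, hδ, hball⟩ := hK.exists_ball_subset
  obtain ⟨r, hr, hrx⟩ : ∃ r : ℝ, 0 < r ∧ ‖x - x₁‖ < r * δ := by
    refine ⟨(‖x - x₁‖ + 1) / δ, by positivity, ?_⟩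
    rw [div_mul_cancel₀ _ hδ.ne']
    linarith
  have hle := hu x₁ r hr
  have hint := (huc.integrableOn_comp_add_smul K x₁ r)
  have hc : IntegrableOn (fun _ : Rd d => u x₁) K volume :=
    integrableOn_const K.isCompact.measure_lt_top.ne
  have h0 : ∫ y in (K : Set (Rd d)), (u (x₁ + r • y) - u x₁) = 0 := by
    apply le_antisymm
    · rw [integral_sub hint hc, setIntegral_const, smul_eq_mul]
      linarith
    · exact integral_nonneg fun y => sub_nonneg.2 (hmin _)
  rw [setIntegral_eq_zero_iff_of_nonneg_ae
    (Eventually.of_forall fun y => sub_nonneg.2 (hmin _)) (hint.sub hc)] at h0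
  have h1 : Set.EqOn (fun y => u (x₁ + r • y) - u x₁) 0 (Metric.ball 0 δ) := by
    refine Measure.eqOn_open_of_ae_eq (μ := volume) ?_ Metric.isOpen_ball ?_ continuousOn_const
    · exact ae_mono (Measure.restrict_mono hball le_rfl) h0
    · exact Continuous.continuousOn (by fun_prop)
  have h2 := h1 (x := r⁻¹ • (x - x₁)) (by
    rw [mem_ball_zero_iff, norm_smul, Real.norm_of_nonneg (by positivity), inv_mul_lt_iff₀ hr]
    exact hrx)
  simp only [smul_inv_smul₀ hr.ne', add_sub_cancel, Pi.zero_apply] at h2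
  linarith

/-! ### Mollification. -/

/-- A sequence of bump functions at the origin of `ℝ^d` whose supports shrink to a point. -/
def bumpSeq (d n : ℕ) : ContDiffBump (0 : Rd d) where
  rIn := 1 / (n + 1) / 2
  rOut := 1 / (n + 1)
  rIn_pos := by positivity
  rIn_lt_rOut := half_lt_self (by positivity)

/-- The mollifications of a function on `ℝ^d`. -/
def mollify {d : ℕ} (n : ℕ) (f : Rd d → ℝ) : Rd d → ℝ :=
  convolution ((bumpSeq d n).normed volume) f (ContinuousLinearMap.lsmul ℝ ℝ) volume

lemma mollify_apply {d : ℕ} (n : ℕ) (f : Rd d → ℝ) (x : Rd d) :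
    mollify n f x = ∫ t, (bumpSeq d n).normed volume t * f (x - t) := rfl

lemma continuous_mollify {d : ℕ} (n : ℕ) {f : Rd d → ℝ} (hf : LocallyIntegrable f volume) :
    Continuous (mollify n f) :=
  (bumpSeq d n).hasCompactSupport_normed.continuous_convolution_left _
    (bumpSeq d n).continuous_normed hf

lemma integrable_mollify {d : ℕ} (n : ℕ) {f : Rd d → ℝ} (hf : LocallyIntegrable f volume)
    (x : Rd d) : Integrable (fun t => (bumpSeq d n).normed volume t * f (x - t)) volume :=
  (bumpSeq d n).hasCompactSupport_normed.convolutionExists_left (ContinuousLinearMap.lsmul ℝ ℝ)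
    (bumpSeq d n).continuous_normed hf x

lemma ae_tendsto_mollify {d : ℕ} {f : Rd d → ℝ} (hf : LocallyIntegrable f volume) :
    ∀ᵐ x, Tendsto (fun n => mollify n f x) atTop (𝓝 (f x)) := by
  refine ContDiffBump.ae_convolution_tendsto_right_of_locallyIntegrable (K := 2)
    (φ := fun n => bumpSeq d n) ?_ ?_ hf
  · exact tendsto_one_div_add_atTop_nhds_zero_nat
  · exact Eventually.of_forall fun n => by simp only [bumpSeq]; linarith

/-- The radius 1 serves all `n` at once, since every bump is supported within distance 1 of the
origin. -/
lemma le_mollify {d : ℕ} (n : ℕ) {f : Rd d → ℝ} (hf : LocallyIntegrable f volume) {c : ℝ}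
    {x : Rd d} (h : ∀ᵐ y, y ∈ Metric.ball x 1 → c ≤ f y) : c ≤ mollify n f x := by
  have h1 : ∫ t, (bumpSeq d n).normed volume t * c = c := by
    rw [integral_mul_const, ContDiffBump.integral_normed, one_mul]
  rw [← h1, mollify_apply]
  refine integral_mono_ae ((bumpSeq d n).integrable_normed.mul_const c)
    (integrable_mollify n hf x) ?_
  have hq : Measure.QuasiMeasurePreserving (fun t : Rd d => x - t) volume volume :=
    (Measure.measurePreserving_sub_left volume x).quasiMeasurePreserving
  filter_upwards [hq.ae h] with t ht
  by_cases hts : (bumpSeq d n).normed volume t = 0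
  · simp [hts]
  · have h2 : t ∈ Metric.ball (0 : Rd d) (bumpSeq d n).rOut := by
      rw [← ContDiffBump.support_normed_eq (bumpSeq d n) (μ := volume)]
      exact hts
    refine mul_le_mul_of_nonneg_left (ht ?_) (ContDiffBump.nonneg_normed _ _)
    rw [mem_ball_zero_iff] at h2
    have h3 : (bumpSeq d n).rOut ≤ 1 := by
      simp only [bumpSeq]
      rw [div_le_one (by positivity)]
      linarith [Nat.cast_nonneg (α := ℝ) n]
    rw [Metric.mem_ball, dist_eq_norm, sub_sub_cancel_left, norm_neg]
    linarith

/-- The inequality is translation invariant and is preserved by nonnegative weights; Fubini moves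
the average inside the convolution. An almost everywhere property thus becomes one valid at every
point. -/
lemma superAverage_mollify {d : ℕ} (n : ℕ) {K : ConvexBody (Rd d)} {f : Rd d → ℝ}
    (hfm : Measurable f) (hf : LocallyIntegrable f volume)
    (hsup : AESuperAverage K f) :
    SuperAverage K (mollify n f) := by
  intro x r hr
  have hfn : LocallyIntegrable (fun z => ‖f z‖) volume := fun z => (hf z).norm
  set φ := (bumpSeq d n).normed volume with hφ
  have hφm : Measurable φ := (ContDiffBump.continuous_normed _).measurable
  have hint : Integrable (Function.uncurry fun (y t : Rd d) => φ t * f (x + r • y - t))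
      ((volume.restrict (K : Set (Rd d))).prod volume) := by
    have hmeas : Measurable (Function.uncurry fun (y t : Rd d) => φ t * f (x + r • y - t)) := by
      unfold Function.uncurry
      fun_prop
    rw [integrable_prod_iff hmeas.aestronglyMeasurable]
    refine ⟨Eventually.of_forall fun y => ?_, ?_⟩
    · exact integrable_mollify n hf (x + r • y)
    have h1 : ∀ y : Rd d, ∫ t, ‖φ t * f (x + r • y - t)‖ =
        mollify n (fun z => ‖f z‖) (x + r • y) := by
      intro y
      rw [mollify_apply]
      refine integral_congr_ae (Eventually.of_forall fun t => ?_)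
      simp only [norm_mul]
      rw [Real.norm_of_nonneg (ContDiffBump.nonneg_normed _ _)]
    simp only [Function.uncurry_apply_pair, h1]
    exact (continuous_mollify n hfn).integrableOn_comp_add_smul K x r
  have hq : Measure.QuasiMeasurePreserving (fun t : Rd d => x - t) volume volume :=
    (Measure.measurePreserving_sub_left volume x).quasiMeasurePreserving
  calc ∫ y in (K : Set (Rd d)), mollify n f (x + r • y)
      = ∫ y in (K : Set (Rd d)), ∫ t, φ t * f (x + r • y - t) := rfl
    _ = ∫ t, ∫ y in (K : Set (Rd d)), φ t * f (x + r • y - t) := integral_integral_swap hint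
    _ ≤ ∫ t, volume.real (K : Set (Rd d)) * (φ t * f (x - t)) := by
        refine integral_mono_ae hint.integral_prod_right ((integrable_mollify n hf x).const_mul _) ?_
        filter_upwards [hq.ae (show ∀ᵐ x, _ from hsup)] with t ht
        rw [integral_const_mul]
        have h2 := ht r hr
        have h3 : ∀ y : Rd d, x + r • y - t = x - t + r • y := fun y => by abel
        simp only [h3]
        have := mul_le_mul_of_nonneg_left h2 (ContDiffBump.nonneg_normed (bumpSeq d n) t
          (μ := volume))
        linarith
    _ = volume.real (K : Set (Rd d)) * mollify n f x := by
        rw [integral_const_mul, mollify_apply]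

/-! ### Sign, local positivity and decay of integrable super-averages. -/

lemma LocallyIntegrable.integrableOn_comp_add_smul {d : ℕ} (K : ConvexBody (Rd d)) {f : Rd d → ℝ}
    (hf : LocallyIntegrable f volume) (x : Rd d) {r : ℝ} (hr : 0 < r) :
    IntegrableOn (fun y => f (x + r • y)) K volume := by
  have h1 : IntegrableOn f ((fun y => x + r • y) '' (K : Set (Rd d))) volume :=
    hf.integrableOn_isCompact (K.isCompact.image (by fun_prop))
  let e : Rd d ≃ᵐ Rd d := (MeasurableEquiv.smul₀ r hr.ne').trans (MeasurableEquiv.addLeft x)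
  have h2 : Measure.map e volume = ENNReal.ofReal |(r ^ d)⁻¹| • volume := by
    have h3 := Measure.map_addHaar_smul (volume : Measure (Rd d)) hr.ne'
    have h4 := (measurePreserving_add_left (volume : Measure (Rd d)) x).map_eq
    have h5 : (e : Rd d → Rd d) = (fun y => x + y) ∘ (r • ·) := rfl
    rw [h5, ← Measure.map_map (by fun_prop) (by fun_prop), h3, Measure.map_smul, h4]
    simp
  have h6 := e.measurableEmbedding.integrableOn_map_iff (f := f) (μ := volume)
    (s := (fun y => x + r • y) '' (K : Set (Rd d)))
  rw [h2] at h6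
  have h7 : (e : Rd d → Rd d) ⁻¹' ((fun y => x + r • y) '' (K : Set (Rd d))) = K :=
    Set.preimage_image_eq _ e.injective
  rw [h7] at h6
  refine h6.1 ?_
  rw [IntegrableOn, Measure.restrict_smul]
  exact Integrable.smul_measure h1 ENNReal.ofReal_ne_top

/-- The part of `f` above level `δ` in absolute value has averages of order `r^(-d)`, so large
averages are asymptotically at least `-δ` for every `δ`, and `f` dominates them. -/
lemma AESuperAverage.nonneg_of_memLp {d : ℕ} (hd : 1 ≤ d) {K : ConvexBody (Rd d)}
    (hK : IsSymmetricBody K) {f : Rd d → ℝ} {p : ℝ} (hp : 1 ≤ p)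
    (hf : MemLp f (ENNReal.ofReal p) volume) (hsup : AESuperAverage K f) :
    ∀ᵐ x, 0 ≤ f x := by
  have hp0 : 0 < p := by linarith
  have hloc : LocallyIntegrable f volume := hf.locallyIntegrable (by simpa using hp)
  have hg : Integrable (fun x => |f x| ^ p) volume := by
    have := hf.integrable_norm_rpow (by simpa using hp0) ENNReal.ofReal_ne_top
    simpa [ENNReal.toReal_ofReal hp0.le] using this
  set I := ∫ x, |f x| ^ p
  -- Split at `|s| = δ`; above it, `|s| = |s|^(1-p) |s|^p` and the exponent `1 - p` is nonpositive.
  have hpt : ∀ δ > 0, ∀ s : ℝ, -δ - δ ^ (1 - p) * |s| ^ p ≤ s := by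
    intro δ hδ s
    rcases le_or_gt |s| δ with h | h
    · have : 0 ≤ δ ^ (1 - p) * |s| ^ p := by positivity
      linarith [neg_abs_le s]
    · have hs : 0 < |s| := hδ.trans h
      have h1 : |s| ^ (1 - p) ≤ δ ^ (1 - p) :=
        Real.rpow_le_rpow_of_nonpos hδ h.le (by linarith)
      have h2 : |s| = |s| ^ (1 - p) * |s| ^ p := by
        rw [← Real.rpow_add hs]; simp
      have h3 : |s| ^ (1 - p) * |s| ^ p ≤ δ ^ (1 - p) * |s| ^ p := by gcongr
      linarith [neg_abs_le s]
  filter_upwards [hsup] with x hx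
  have hV := hK.volume_pos
  have key : ∀ δ > 0, ∀ r : ℝ, 0 < r →
      -δ * volume.real (K : Set (Rd d)) - δ ^ (1 - p) * ((r ^ d)⁻¹ * I) ≤
        volume.real (K : Set (Rd d)) * f x := by
    intro δ hδ r hr
    refine le_trans ?_ (hx r hr)
    have hgi : Integrable (fun y => |f (x + r • y)| ^ p) volume := by
      have h1 : Integrable (fun y => |f (x + y)| ^ p) volume := hg.comp_add_left x
      exact h1.comp_smul hr.ne'
    have h2 : ∫ y in (K : Set (Rd d)), |f (x + r • y)| ^ p ≤ (r ^ d)⁻¹ * I := by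
      refine (setIntegral_le_integral hgi (Eventually.of_forall fun y => by positivity)).trans ?_
      rw [Measure.integral_comp_smul volume (fun y => |f (x + y)| ^ p) r,
        integral_add_left_eq_self (fun y => |f y| ^ p) x]
      simp [I, abs_of_pos hr]
    have h3 : ∫ y in (K : Set (Rd d)), (-δ - δ ^ (1 - p) * |f (x + r • y)| ^ p) ≤
        ∫ y in (K : Set (Rd d)), f (x + r • y) := by
      refine setIntegral_mono ?_ (LocallyIntegrable.integrableOn_comp_add_smul K hloc x hr)
        fun y => hpt δ hδ _
      exact (integrableOn_const K.isCompact.measure_lt_top.ne).sub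
        (hgi.integrableOn.const_mul _)
    have hδi : IntegrableOn (fun _ : Rd d => -δ) K volume :=
      integrableOn_const K.isCompact.measure_lt_top.ne
    rw [integral_sub hδi
      (hgi.integrableOn.const_mul _), integral_const_mul, setIntegral_const, smul_eq_mul] at h3
    have h4 := mul_le_mul_of_nonneg_left h2 (Real.rpow_nonneg hδ.le (1 - p))
    linarith
  have key2 : ∀ δ > 0, -δ * volume.real (K : Set (Rd d)) ≤
      volume.real (K : Set (Rd d)) * f x := by
    intro δ hδ
    have ht : Tendsto (fun r : ℝ => -δ * volume.real (K : Set (Rd d)) -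
        δ ^ (1 - p) * ((r ^ d)⁻¹ * I)) atTop
        (𝓝 (-δ * volume.real (K : Set (Rd d)) - δ ^ (1 - p) * (0 * I))) :=
      ((((tendsto_pow_atTop (by omega)).inv_tendsto_atTop).mul_const I).const_mul _).const_sub _
    rw [zero_mul, mul_zero, sub_zero] at ht
    exact le_of_tendsto ht ((eventually_gt_atTop 0).mono fun r hr => key δ hδ r hr)
  by_contra! hneg
  have := key2 (-f x / 2) (by linarith)
  nlinarith

lemma AESuperAverage.exists_pos_le_ball {d : ℕ} {K : ConvexBody (Rd d)}
    (hK : IsSymmetricBody K) {f : Rd d → ℝ} (hloc : LocallyIntegrable f volume)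
    (hsup : AESuperAverage K f) (hnn : ∀ᵐ x, 0 ≤ f x) (hne : ¬ f =ᵐ[volume] 0) (R : ℝ) :
    ∃ c > 0, ∀ᵐ x, x ∈ Metric.ball (0 : Rd d) R → c ≤ f x := by
  obtain ⟨n, hn⟩ : ∃ n : ℕ, 0 < ∫ x in Metric.ball (0 : Rd d) n, f x := by
    by_contra! h
    apply hne
    have h1 : ∀ n : ℕ, ∀ᵐ x, x ∈ Metric.ball (0 : Rd d) n → f x = 0 := by
      intro n
      rw [← ae_restrict_iff' Metric.isOpen_ball.measurableSet]
      have hi : IntegrableOn f (Metric.ball (0 : Rd d) n) volume :=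
        (hloc.integrableOn_isCompact (isCompact_closedBall 0 n)).mono_set
          Metric.ball_subset_closedBall
      exact (setIntegral_eq_zero_iff_of_nonneg_ae (ae_restrict_of_ae hnn) hi).1
        (le_antisymm (h n) (integral_nonneg_of_ae (ae_restrict_of_ae hnn)))
    filter_upwards [ae_all_iff.2 h1] with x hx
    obtain ⟨n, hn⟩ := exists_nat_gt ‖x‖
    exact hx n (by simpa using hn)
  obtain ⟨δ, hδ, hball⟩ := hK.exists_ball_subset
  have hV := hK.volume_pos
  -- At this scale `x + rK` contains the ball of radius `n`, where `f` has positive mass, for every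
  -- `x` in the ball of radius `R`.
  set r : ℝ := (n + |R| + 1) / δ with hrdef
  have hr : 0 < r := by positivity
  refine ⟨(volume.real (K : Set (Rd d)))⁻¹ * ((r ^ d)⁻¹ * ∫ x in Metric.ball (0 : Rd d) n, f x),
    by positivity, ?_⟩
  filter_upwards [hsup] with x hx hxR
  rw [inv_mul_le_iff₀ hV]
  refine le_trans ?_ (hx r hr)
  rw [setIntegral_comp_add_smul K f x hr]
  refine mul_le_mul_of_nonneg_left ?_ (by positivity)
  have hcomp : IsCompact (x +ᵥ r • (K : Set (Rd d))) := (K.isCompact.smul r).vadd x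
  refine setIntegral_mono_set (hloc.integrableOn_isCompact hcomp) (ae_restrict_of_ae hnn)
    (LE.le.eventuallyLE ?_)
  intro z hz
  refine Set.mem_vadd_set.2 ⟨z - x, ?_, by simp⟩
  refine Set.mem_smul_set.2 ⟨r⁻¹ • (z - x), hball ?_, smul_inv_smul₀ hr.ne' _⟩
  rw [mem_ball_zero_iff] at hz hxR ⊢
  rw [norm_smul, Real.norm_of_nonneg (by positivity), inv_mul_lt_iff₀ hr, hrdef,
    div_mul_cancel₀ _ hδ.ne']
  calc ‖z - x‖ ≤ ‖z‖ + ‖x‖ := norm_sub_le _ _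
    _ < n + |R| + 1 := by linarith [le_abs_self R]

/-- Comparison is applied to each mollification and then passed to the limit. The bound `c` is
assumed on radius `R + 1` so that mollifications inherit it on radius `R`; beyond `R`, nonnegativity
of `f` and decay of `w` control infinity. -/
lemma AESuperAverage.ae_ge_of_strict_sub {d : ℕ} {K : ConvexBody (Rd d)}
    {f w : Rd d → ℝ} (hfm : Measurable f) (hloc : LocallyIntegrable f volume)
    (hsup : AESuperAverage K f) (hnn : ∀ᵐ x, 0 ≤ f x) {c R : ℝ} (hc : 0 < c)
    (hcf : ∀ᵐ x, x ∈ Metric.ball (0 : Rd d) (R + 1) → c ≤ f x)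
    (hwc : Continuous w) (hw1 : ∀ x, w x ≤ 1) (hw0 : Tendsto w (cocompact (Rd d)) (𝓝 0))
    (hw : ∀ x, R < ‖x‖ → ∃ r : ℝ, 0 < r ∧
      volume.real (K : Set (Rd d)) * w x < ∫ y in (K : Set (Rd d)), w (x + r • y)) :
    ∀ᵐ x, c * w x ≤ f x := by
  have key : ∀ n x, c * w x ≤ mollify n f x := by
    intro n
    refine (superAverage_mollify n hfm hloc hsup).ge_of_strict_sub (w := fun x => c * w x)
      (s := {x | ‖x‖ ≤ R})
      (continuous_mollify n hloc) (by fun_prop) ?_ ?_ ?_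
    · intro x hx
      obtain ⟨r, hr, h⟩ := hw x (by simpa using hx)
      refine ⟨r, hr, ?_⟩
      rw [integral_const_mul]
      nlinarith
    · intro x hx
      refine (mul_le_of_le_one_right hc.le (hw1 x)).trans (le_mollify n hloc ?_)
      filter_upwards [hcf] with y hy hyx
      refine hy ?_
      rw [mem_ball_zero_iff]
      rw [Metric.mem_ball, dist_eq_norm] at hyx
      have : ‖x‖ ≤ R := hx
      linarith [norm_sub_norm_le y x]
    · intro ε hε
      filter_upwards [hw0.eventually (gt_mem_nhds (show (0 : ℝ) < ε / c by positivity))] with x hx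
      have h1 : 0 ≤ mollify n f x := le_mollify n hloc (hnn.mono fun y hy _ => hy)
      rw [lt_div_iff₀ hc] at hx
      linarith
  filter_upwards [ae_tendsto_mollify hloc] with x hx
  exact ge_of_tendsto hx (Eventually.of_forall fun n => key n x)

/-- In polar coordinates the lower bound leads to `t^(d-1-αp)`, whose exponent is at least `-1`, so
its integral diverges at infinity. -/
lemma not_memLp_of_ge_rpow_neg {d : ℕ} (hd : 1 ≤ d) {f : Rd d → ℝ} {p α b c : ℝ} (hp : 1 ≤ p)
    (hb : 0 < b) (hc : 0 < c) (hαp : α * p ≤ d)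
    (hf : ∀ᵐ x, c * (max (b * ‖x‖) 1) ^ (-α) ≤ f x) :
    ¬ MemLp f (ENNReal.ofReal p) volume := by
  intro hmem
  have hp0 : 0 < p := by linarith
  have : Nonempty (Fin d) := ⟨⟨0, hd⟩⟩
  have hg : Integrable (fun x => ‖f x‖ ^ p) volume := by
    have := hmem.integrable_norm_rpow (by simpa using hp0) ENNReal.ofReal_ne_top
    simpa [ENNReal.toReal_ofReal hp0.le] using this
  let F : ℝ → ℝ := fun t => (c * (max (b * t) 1) ^ (-α)) ^ p
  have hF : Integrable (fun x : Rd d => F ‖x‖) volume := by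
    refine hg.mono' ?_ ?_
    · have : Continuous (fun x : Rd d => F ‖x‖) := by
        refine Continuous.rpow_const (continuous_const.mul
          (Continuous.rpow_const (by fun_prop) fun x => Or.inl ?_)) fun x => Or.inr hp0.le
        positivity
      exact this.aestronglyMeasurable
    · filter_upwards [hf] with x hx
      have h0 : 0 ≤ c * (max (b * ‖x‖) 1) ^ (-α) := by positivity
      rw [Real.norm_of_nonneg (by positivity)]
      exact Real.rpow_le_rpow h0 (hx.trans (le_abs_self _)) hp0.le
  rw [integrable_fun_norm_addHaar] at hF
  simp only [finrank_euclideanSpace, Fintype.card_fin, smul_eq_mul] at hF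
  set t₀ := max 1 b⁻¹
  have ht₀ : 0 < t₀ := by positivity
  have h2 : IntegrableOn (fun t : ℝ => t ^ (d - 1 - α * p : ℝ)) (Set.Ioi t₀) volume := by
    have h3 := (hF.mono_set (Set.Ioi_subset_Ioi ht₀.le)).const_mul ((c * b ^ (-α)) ^ p)⁻¹
    refine IntegrableOn.congr_fun h3 (fun t ht => ?_) measurableSet_Ioi
    have ht1 : t₀ < t := ht
    have htp : 0 < t := ht₀.trans ht1
    have hbt : 1 ≤ b * t := by
      have : b⁻¹ ≤ t := (le_max_right _ _).trans ht1.le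
      calc 1 = b * b⁻¹ := (mul_inv_cancel₀ hb.ne').symm
        _ ≤ b * t := by gcongr
    have hFt : F t = (c * b ^ (-α)) ^ p * t ^ (-α * p) := by
      simp only [F]
      rw [max_eq_left hbt, Real.mul_rpow hb.le htp.le, ← mul_assoc,
        Real.mul_rpow (by positivity) (by positivity), ← Real.rpow_mul htp.le]
    simp only [hFt]
    have hpos : 0 < (c * b ^ (-α)) ^ p := by positivity
    rw [show (d - 1 - α * p : ℝ) = ((d - 1 : ℕ) : ℝ) + (-α * p) by push_cast [hd]; ring,
      Real.rpow_add htp, Real.rpow_natCast]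
    field_simp
  rw [integrableOn_Ioi_rpow_iff ht₀] at h2
  linarith

/-! ### Taylor expansion of averages at small scales. -/

/-- Both sides are `n!` times the degree `n` term of the same power series, the right one restricted
to a line. -/
lemma iteratedFDeriv_diag_eq_iteratedDeriv {E : Type*} [NormedAddCommGroup E] [NormedSpace ℝ E]
    {f : E → ℝ} {x : E} (hf : ContDiffAt ℝ ω f x) (n : ℕ) (y : E) :
    iteratedFDeriv ℝ n f x (fun _ => y) = iteratedDeriv n (fun t : ℝ => f (x + t • y)) 0 := by
  obtain ⟨p, r, hp⟩ := hf.analyticAt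
  obtain ⟨r', hq⟩ : HasFPowerSeriesAt (fun t : ℝ => f (x + t • y))
      (p.compContinuousLinearMap (ContinuousLinearMap.toSpanSingleton ℝ y)) 0 := by
    have h1 : HasFPowerSeriesAt (fun z => f (z - -x)) p
        ((ContinuousLinearMap.toSpanSingleton ℝ y) 0) := by
      have := (HasFPowerSeriesOnBall.hasFPowerSeriesAt hp).comp_sub (-x)
      simpa using this
    have h2 := h1.compContinuousLinearMap
    convert h2 using 2 with t
    simp [ContinuousLinearMap.toSpanSingleton_apply, add_comm]
  rw [iteratedDeriv_eq_iteratedFDeriv, ← hp.factorial_smul, ← hq.factorial_smul]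
  rw [FormalMultilinearSeries.compContinuousLinearMap_apply]
  simp [Function.comp_def, ContinuousLinearMap.toSpanSingleton_apply]

lemma setIntegral_eq_zero_of_odd {d : ℕ} {K : ConvexBody (Rd d)} (hK : IsSymmetricBody K)
    {g : Rd d → ℝ} (hg : ∀ y, g (-y) = -g y) : ∫ y in (K : Set (Rd d)), g y = 0 := by
  have h1 : ∫ y in (K : Set (Rd d)), g (-y) = ∫ y in (K : Set (Rd d)), g y := by
    have := (Measure.measurePreserving_neg (volume : Measure (Rd d))).setIntegral_preimage_emb
      (MeasurableEquiv.neg (Rd d)).measurableEmbedding g (K : Set (Rd d))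
    rw [← this]
    congr 2
    ext y
    exact ⟨fun h => hK.1 y h, fun h => by simpa using hK.1 _ h⟩
  simp only [hg, integral_neg] at h1
  linarith

/-- The first surviving averaged Taylor term has order `r^k` and dominates the remainder, which is
`O(r^(k+1))` uniformly on the bounded set `K`. -/
lemma ContDiffAt.eventually_lt_setIntegral {d : ℕ} (K : ConvexBody (Rd d)) {f : Rd d → ℝ}
    {x : Rd d} (hf : ContDiffAt ℝ ω f x) {k : ℕ} (hk : 0 < k)
    (h0 : ∀ n, 0 < n → n < k → ∫ y in (K : Set (Rd d)), iteratedFDeriv ℝ n f x (fun _ => y) = 0)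
    (hpos : 0 < ∫ y in (K : Set (Rd d)), iteratedFDeriv ℝ k f x (fun _ => y)) :
    ∀ᶠ r : ℝ in 𝓝[>] 0, volume.real (K : Set (Rd d)) * f x <
      ∫ y in (K : Set (Rd d)), f (x + r • y) := by
  have han := hf.analyticAt
  obtain ⟨p, ρ, hp⟩ := hf.analyticAt
  have hpn : ∀ n (y : Rd d), p n (fun _ => y) =
      (n.factorial : ℝ)⁻¹ * iteratedFDeriv ℝ n f x (fun _ => y) := by
    intro n y
    rw [← hp.factorial_smul, nsmul_eq_mul, inv_mul_cancel_left₀]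
    exact_mod_cast n.factorial_ne_zero
  have hpc : ∀ n, Continuous fun y : Rd d => p n (fun _ => y) := fun n =>
    (p n).cont.comp (by fun_prop)
  obtain ⟨C, hC⟩ := (hp.hasFPowerSeriesAt.isBigO_sub_partialSum_pow (k + 1)).bound
  obtain ⟨ε₁, hε₁, hC⟩ := Metric.eventually_nhds_iff_ball.1 hC
  obtain ⟨ε₂, hε₂, hcont⟩ := Metric.eventually_nhds_iff_ball.1 han.eventually_analyticAt
  obtain ⟨M, hM0, hM⟩ := K.isCompact.isBounded.exists_pos_norm_le
  set c := ∫ y in (K : Set (Rd d)), p k (fun _ => y) with hc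
  have hcpos : 0 < c := by
    rw [hc]
    simp only [hpn, integral_const_mul]
    positivity
  -- The integrated remainder is at most `r^k (rD)`, so `r (D + 1) < c` keeps it below `r^k c`.
  set D := |C| * M ^ (k + 1) * volume.real (K : Set (Rd d)) with hD
  have hsmall : ∀ᶠ r : ℝ in 𝓝[>] 0, r < min (min ε₁ ε₂ / (M + 1)) (c / (D + 1)) := by
    refine nhdsWithin_le_nhds (Iio_mem_nhds ?_)
    positivity
  filter_upwards [hsmall, self_mem_nhdsWithin] with r hr hr0
  have hr0 : 0 < r := hr0
  have hr1 : r * (M + 1) < min ε₁ ε₂ := by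
    rw [← lt_div_iff₀ (by positivity)]
    exact hr.trans_le (min_le_left _ _)
  have hr2 : r * (D + 1) < c := by
    rw [← lt_div_iff₀ (by positivity)]
    exact hr.trans_le (min_le_right _ _)
  have hry : ∀ y ∈ (K : Set (Rd d)), ‖r • y‖ < min ε₁ ε₂ := by
    intro y hy
    rw [norm_smul, Real.norm_of_nonneg hr0.le]
    have := hM y hy
    nlinarith
  have hfi : IntegrableOn (fun y => f (x + r • y)) K volume := by
    refine ContinuousOn.integrableOn_compact K.isCompact fun y hy => ?_
    refine ContinuousAt.continuousWithinAt ?_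
    have : ContinuousAt f (x + r • y) := (hcont _ (by
      simpa using (hry y hy).trans_le (min_le_right _ _))).continuousAt
    exact ContinuousAt.comp (f := fun y => x + r • y) this (by fun_prop)
  have hpi : ∀ n, IntegrableOn (fun y => r ^ n * p n (fun _ => y)) K volume := fun n =>
    (((hpc n).const_smul (r ^ n)).continuousOn).integrableOn_compact K.isCompact
  have hps : ∀ y, p.partialSum (k + 1) (r • y) =
      ∑ n ∈ Finset.range (k + 1), r ^ n * p n (fun _ => y) := by
    intro y
    rw [FormalMultilinearSeries.partialSum]
    refine Finset.sum_congr rfl fun n _ => ?_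
    have := (p n).map_smul_univ (fun _ => r) (fun _ => y)
    simpa using this
  have hsum : ∫ y in (K : Set (Rd d)), p.partialSum (k + 1) (r • y) =
      volume.real (K : Set (Rd d)) * f x + r ^ k * c := by
    simp only [hps]
    rw [integral_finsetSum _ fun n _ => hpi n, Finset.sum_range_succ, integral_const_mul]
    congr 1
    obtain ⟨j, rfl⟩ : ∃ j, k = j + 1 := ⟨k - 1, by omega⟩
    rw [Finset.sum_range_succ', Finset.sum_eq_zero]
    · have : ∀ y : Rd d, p 0 (fun _ => y) = f x := fun y => hp.coeff_zero _
      simp [this]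
    · intro n hn
      rw [integral_const_mul]
      simp only [hpn, integral_const_mul]
      rw [h0 (n + 1) (by omega) (by simpa using Finset.mem_range.1 hn)]
      simp
  have hpsi : IntegrableOn (fun y => p.partialSum (k + 1) (r • y)) K volume := by
    simp only [hps]
    exact integrable_finsetSum _ fun n _ => hpi n
  have hrem : ‖∫ y in (K : Set (Rd d)), (f (x + r • y) - p.partialSum (k + 1) (r • y))‖ ≤
      |C| * (r * M) ^ (k + 1) * volume.real (K : Set (Rd d)) := by
    refine norm_setIntegral_le_of_norm_le_const K.isCompact.measure_lt_top fun y hy => ?_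
    have h1 := hC (r • y) (by simpa using (hry y hy).trans_le (min_le_left _ _))
    refine h1.trans ?_
    have h2 : ‖r • y‖ ≤ r * M := by
      rw [norm_smul, Real.norm_of_nonneg hr0.le]
      exact mul_le_mul_of_nonneg_left (hM y hy) hr0.le
    rw [Real.norm_of_nonneg (by positivity)]
    exact mul_le_mul (le_abs_self C) (pow_le_pow_left₀ (norm_nonneg _) h2 _) (by positivity)
      (abs_nonneg _)
  rw [integral_sub hfi hpsi, hsum] at hrem
  have h3 := (abs_le.1 hrem).1
  have h4 : |C| * (r * M) ^ (k + 1) * volume.real (K : Set (Rd d)) = r ^ k * (r * D) := by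
    rw [hD]; ring
  have h5 : 0 < r ^ k * (c - r * D) := mul_pos (by positivity) (by nlinarith)
  rw [h4] at h3
  linarith

lemma iteratedFDeriv_diag_neg {E : Type*} [NormedAddCommGroup E] [NormedSpace ℝ E]
    (f : E → ℝ) (x : E) {n : ℕ} (hn : Odd n) (y : E) :
    iteratedFDeriv ℝ n f x (fun _ => -y) = -iteratedFDeriv ℝ n f x (fun _ => y) := by
  have := (iteratedFDeriv ℝ n f x).map_smul_univ (fun _ => (-1 : ℝ)) (fun _ => y)
  simpa [hn.neg_one_pow] using this

/-- If the averaged second derivative is positive, then averages over small copies of `K`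
exceed the value at the center. -/
lemma ContDiffAt.eventually_lt_of_second {d : ℕ} {K : ConvexBody (Rd d)} (hK : IsSymmetricBody K)
    {f : Rd d → ℝ} {x : Rd d} (hf : ContDiffAt ℝ ω f x)
    (hpos : 0 < ∫ y in (K : Set (Rd d)), iteratedDeriv 2 (fun t : ℝ => f (x + t • y)) 0) :
    ∀ᶠ r : ℝ in 𝓝[>] 0, volume.real (K : Set (Rd d)) * f x <
      ∫ y in (K : Set (Rd d)), f (x + r • y) := by
  refine hf.eventually_lt_setIntegral K two_pos ?_ ?_
  · intro n h1 h2
    obtain rfl : n = 1 := by omega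
    exact setIntegral_eq_zero_of_odd hK fun y => iteratedFDeriv_diag_neg f x odd_one y
  · simpa only [iteratedFDeriv_diag_eq_iteratedDeriv hf] using hpos

lemma ContDiffAt.eventually_lt_of_fourth {d : ℕ} {K : ConvexBody (Rd d)} (hK : IsSymmetricBody K)
    {f : Rd d → ℝ} {x : Rd d} (hf : ContDiffAt ℝ ω f x)
    (hzero : ∫ y in (K : Set (Rd d)), iteratedDeriv 2 (fun t : ℝ => f (x + t • y)) 0 = 0)
    (hpos : 0 < ∫ y in (K : Set (Rd d)), iteratedDeriv 4 (fun t : ℝ => f (x + t • y)) 0) :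
    ∀ᶠ r : ℝ in 𝓝[>] 0, volume.real (K : Set (Rd d)) * f x <
      ∫ y in (K : Set (Rd d)), f (x + r • y) := by
  refine hf.eventually_lt_setIntegral K four_pos ?_ ?_
  · intro n h1 h2
    rcases Nat.even_or_odd n with h | h
    · obtain rfl : n = 2 := by
        obtain ⟨m, rfl⟩ := h
        omega
      simpa only [iteratedFDeriv_diag_eq_iteratedDeriv hf] using hzero
    · exact setIntegral_eq_zero_of_odd hK fun y => iteratedFDeriv_diag_neg f x h y
  · simpa only [iteratedFDeriv_diag_eq_iteratedDeriv hf] using hpos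

/-! ### Second moments and isotropic position. -/

lemma IsSymmetricBody.setIntegral_pos {d : ℕ} {K : ConvexBody (Rd d)} (hK : IsSymmetricBody K)
    {g : Rd d → ℝ} (hg : Continuous g) (hnn : ∀ y, 0 ≤ g y)
    (hpos : ∀ ε > 0, ∃ y ∈ Metric.ball (0 : Rd d) ε, g y ≠ 0) :
    0 < ∫ y in (K : Set (Rd d)), g y := by
  obtain ⟨δ, hδ, hball⟩ := hK.exists_ball_subset
  refine lt_of_le_of_ne (integral_nonneg hnn) fun h => ?_
  rw [eq_comm, setIntegral_eq_zero_iff_of_nonneg_ae (Eventually.of_forall hnn)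
    (hg.continuousOn.integrableOn_compact K.isCompact)] at h
  have h1 : Set.EqOn g 0 (Metric.ball 0 δ) :=
    Measure.eqOn_open_of_ae_eq (μ := volume) (ae_mono (Measure.restrict_mono hball le_rfl) h)
      Metric.isOpen_ball hg.continuousOn continuousOn_const
  obtain ⟨y, hy, hne⟩ := hpos δ hδ
  exact hne (h1 hy)

lemma IsSymmetricBody.integral_inner_sq_pos {d : ℕ} {K : ConvexBody (Rd d)}
    (hK : IsSymmetricBody K) {x : Rd d} (hx : x ≠ 0) :
    0 < ∫ y in (K : Set (Rd d)), ⟪x, y⟫ * ⟪x, y⟫ := by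
  refine hK.setIntegral_pos (by fun_prop) (fun y => mul_self_nonneg _) fun ε hε => ?_
  have hx' : 0 < ‖x‖ := norm_pos_iff.2 hx
  refine ⟨(ε / 2 / ‖x‖) • x, ?_, ?_⟩
  · rw [mem_ball_zero_iff, norm_smul, Real.norm_of_nonneg (by positivity),
      div_mul_cancel₀ _ hx'.ne']
    linarith
  · rw [real_inner_smul_right, real_inner_self_eq_norm_sq]
    positivity

/-- The second moments of a symmetric body are diagonal in a suitable orthonormal basis. -/
lemma IsSymmetricBody.exists_diagonal_moments {d : ℕ} {K : ConvexBody (Rd d)}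
    (hK : IsSymmetricBody K) :
    ∃ (b : OrthonormalBasis (Fin d) ℝ (Rd d)) (l : Fin d → ℝ), (∀ i, 0 < l i) ∧
      ∀ x z : Rd d, ∫ y in (K : Set (Rd d)), ⟪x, y⟫ * ⟪z, y⟫ =
        ∑ i, l i * (⟪b i, x⟫ * ⟪b i, z⟫) := by
  have hi : ∀ x : Rd d, Integrable (fun y : Rd d => ⟪x, y⟫ • y) (volume.restrict K) := fun x =>
    (Continuous.continuousOn (by fun_prop)).integrableOn_compact K.isCompact
  -- The second-moment operator is symmetric and positive; its spectral decomposition provides `b`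
  -- and `l`.
  let T : Rd d →ₗ[ℝ] Rd d :=
    { toFun := fun x => ∫ y in (K : Set (Rd d)), ⟪x, y⟫ • y
      map_add' := fun x z => by
        simp only [inner_add_left, add_smul]
        exact integral_add (hi x) (hi z)
      map_smul' := fun c x => by
        simp only [real_inner_smul_left, mul_smul, RingHom.id_apply]
        exact integral_smul c _ }
  have hT : ∀ x z : Rd d, ⟪T x, z⟫ = ∫ y in (K : Set (Rd d)), ⟪x, y⟫ * ⟪z, y⟫ := by
    intro x z
    have h1 := integral_inner (𝕜 := ℝ) (hi x) z
    rw [real_inner_comm]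
    change ⟪z, ∫ y in (K : Set (Rd d)), ⟪x, y⟫ • y⟫ = _
    rw [← h1]
    simp only [real_inner_smul_right]
  have hsymm : T.IsSymmetric := fun x z => by
    rw [hT, real_inner_comm, hT]
    simp only [mul_comm]
  have hn : Module.finrank ℝ (Rd d) = d := by simp
  set b := hsymm.eigenvectorBasis hn with hb
  set l := hsymm.eigenvalues hn with hl
  have hTb : ∀ i, T (b i) = l i • b i := fun i => hsymm.apply_eigenvectorBasis hn i
  refine ⟨b, l, fun i => ?_, fun x z => ?_⟩
  · have h1 := hT (b i) (b i)
    rw [hTb, real_inner_smul_left, real_inner_self_eq_norm_sq, b.norm_eq_one] at h1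
    have h2 := hK.integral_inner_sq_pos (x := b i) (b.orthonormal.ne_zero i)
    linarith
  · rw [← hT, ← b.sum_inner_mul_inner]
    refine Finset.sum_congr rfl fun i _ => ?_
    rw [hsymm x (b i), hTb, real_inner_smul_right, real_inner_comm x]
    ring

/-- The operator that is diagonal in the orthonormal basis `b` with entries `a`. -/
def diagOp {d : ℕ} (b : OrthonormalBasis (Fin d) ℝ (Rd d)) (a : Fin d → ℝ) : Rd d →L[ℝ] Rd d :=
  ∑ i, a i • (innerSL ℝ (b i)).smulRight (b i)

lemma diagOp_apply {d : ℕ} (b : OrthonormalBasis (Fin d) ℝ (Rd d)) (a : Fin d → ℝ) (x : Rd d) :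
    diagOp b a x = ∑ i, (a i * ⟪b i, x⟫) • b i := by
  simp [diagOp, smul_smul]

lemma inner_diagOp {d : ℕ} (b : OrthonormalBasis (Fin d) ℝ (Rd d)) (a : Fin d → ℝ) (x : Rd d)
    (i : Fin d) : ⟪b i, diagOp b a x⟫ = a i * ⟪b i, x⟫ := by
  rw [diagOp_apply, inner_sum, Finset.sum_eq_single i]
  · simp [real_inner_smul_right]
  · intro j _ hj
    rw [real_inner_smul_right, b.orthonormal.2 hj.symm, mul_zero]
  · simp

lemma inner_diagOp_left {d : ℕ} (b : OrthonormalBasis (Fin d) ℝ (Rd d)) (a : Fin d → ℝ)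
    (x z : Rd d) : ⟪x, diagOp b a z⟫ = ⟪diagOp b a x, z⟫ := by
  rw [← b.sum_inner_mul_inner x, ← b.sum_inner_mul_inner (diagOp b a x)]
  refine Finset.sum_congr rfl fun i _ => ?_
  rw [inner_diagOp, real_inner_comm, real_inner_comm (b i) (diagOp b a x), inner_diagOp]
  ring

/-- A linear map that brings a symmetric body into isotropic position. -/
lemma IsSymmetricBody.exists_isotropic {d : ℕ} {K : ConvexBody (Rd d)} (hK : IsSymmetricBody K) :
    ∃ B : Rd d →L[ℝ] Rd d, (∃ a > 0, ∀ x, a * ‖x‖ ≤ ‖B x‖) ∧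
      ∀ x z : Rd d, ∫ y in (K : Set (Rd d)), ⟪x, B y⟫ * ⟪z, B y⟫ = ⟪x, z⟫ := by
  obtain ⟨b, l, hl, hm⟩ := hK.exists_diagonal_moments
  -- Inverse square root of the moment operator. No determinant enters, because integration stays
  -- over `K` and only the integrand is transformed.
  set a : Fin d → ℝ := fun i => (Real.sqrt (l i))⁻¹ with ha
  have hiso : ∀ x z : Rd d,
      ∫ y in (K : Set (Rd d)), ⟪x, diagOp b a y⟫ * ⟪z, diagOp b a y⟫ = ⟪x, z⟫ := by
    intro x z
    simp only [inner_diagOp_left]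
    rw [hm, ← b.sum_inner_mul_inner]
    refine Finset.sum_congr rfl fun i _ => ?_
    rw [inner_diagOp, inner_diagOp, ha, real_inner_comm x]
    have h1 := Real.mul_self_sqrt (hl i).le
    have h2 : Real.sqrt (l i) ≠ 0 := (Real.sqrt_pos.2 (hl i)).ne'
    field_simp
    rw [sq, h1]
  refine ⟨diagOp b a, ?_, hiso⟩
  have hinj : Function.Injective (diagOp b a) := by
    rw [injective_iff_map_eq_zero]
    intro x hx
    refine (inner_self_eq_zero (𝕜 := ℝ)).1 ?_
    rw [← b.sum_inner_mul_inner]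
    refine Finset.sum_eq_zero fun i _ => ?_
    have := inner_diagOp b a x i
    rw [hx, inner_zero_right] at this
    have hai : a i ≠ 0 := inv_ne_zero (Real.sqrt_pos.2 (hl i)).ne'
    rcases mul_eq_zero.1 this.symm with h | h
    · exact absurd h hai
    · simp [h]
  obtain ⟨k, hk, hanti⟩ := (diagOp b a).toLinearMap.exists_antilipschitzWith
    (LinearMap.ker_eq_bot.2 hinj)
  refine ⟨(k : ℝ)⁻¹, by positivity, fun x => ?_⟩
  have h3 := hanti.le_mul_dist x 0
  simp only [dist_zero_right, map_zero, ContinuousLinearMap.coe_coe] at h3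
  rwa [inv_mul_le_iff₀ (by positivity)]

/-! ### Radial functions in isotropic coordinates. -/

lemma iteratedDeriv_two_eq {g g₁ : ℝ → ℝ} {t c : ℝ} (h : ∀ᶠ s in 𝓝 t, HasDerivAt g (g₁ s) s)
    (h₁ : HasDerivAt g₁ c t) : iteratedDeriv 2 g t = c := by
  rw [iteratedDeriv_succ, iteratedDeriv_one]
  have : deriv g =ᶠ[𝓝 t] g₁ := h.mono fun s hs => hs.deriv
  rw [this.deriv_eq, h₁.deriv]

lemma integral_inner_sq_of_isotropic {d : ℕ} {K : ConvexBody (Rd d)} {B : Rd d →L[ℝ] Rd d}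
    (hB : ∀ x z : Rd d, ∫ y in (K : Set (Rd d)), ⟪x, B y⟫ * ⟪z, B y⟫ = ⟪x, z⟫) (x : Rd d) :
    ∫ y in (K : Set (Rd d)), ⟪x, B y⟫ ^ 2 = ‖x‖ ^ 2 := by
  simp only [sq, hB x x, real_inner_self_eq_norm_mul_norm]

lemma integral_norm_sq_of_isotropic {d : ℕ} {K : ConvexBody (Rd d)} {B : Rd d →L[ℝ] Rd d}
    (hB : ∀ x z : Rd d, ∫ y in (K : Set (Rd d)), ⟪x, B y⟫ * ⟪z, B y⟫ = ⟪x, z⟫) :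
    ∫ y in (K : Set (Rd d)), ‖B y‖ ^ 2 = d := by
  have b := EuclideanSpace.basisFun (Fin d) ℝ
  have h1 : ∀ y, ‖B y‖ ^ 2 = ∑ i, ⟪b i, B y⟫ ^ 2 := by
    intro y
    rw [← real_inner_self_eq_norm_sq, ← b.sum_inner_mul_inner]
    exact Finset.sum_congr rfl fun i _ => by rw [real_inner_comm, sq]
  simp only [h1]
  rw [integral_finsetSum]
  · simp [integral_inner_sq_of_isotropic hB]
  · exact fun i _ => (Continuous.continuousOn (by fun_prop)).integrableOn_compact K.isCompact

lemma hasDerivAt_norm_sq_line {E : Type*} [NormedAddCommGroup E] [InnerProductSpace ℝ E] (z v : E)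
    (t : ℝ) : HasDerivAt (fun t : ℝ => ‖z + t • v‖ ^ 2) (2 * ⟪z, v⟫ + 2 * ‖v‖ ^ 2 * t) t := by
  have h : ∀ t : ℝ, ‖z + t • v‖ ^ 2 = ‖z‖ ^ 2 + 2 * ⟪z, v⟫ * t + ‖v‖ ^ 2 * t ^ 2 := by
    intro t
    rw [norm_add_sq_real, real_inner_smul_right, norm_smul, mul_pow, Real.norm_eq_abs, sq_abs]
    ring
  simp only [h]
  have := (((hasDerivAt_id t).const_mul (2 * ⟪z, v⟫)).const_add (‖z‖ ^ 2)).add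
    ((hasDerivAt_pow 2 t).const_mul (‖v‖ ^ 2))
  convert! this using 1
  simp
  ring

lemma iteratedDeriv_two_radial {E : Type*} [NormedAddCommGroup E] [InnerProductSpace ℝ E]
    {F F₁ : ℝ → ℝ} {F₂ : ℝ} {z : E} (hF : ∀ᶠ u in 𝓝 (‖z‖ ^ 2), HasDerivAt F (F₁ u) u)
    (hF₁ : HasDerivAt F₁ F₂ (‖z‖ ^ 2)) (v : E) :
    iteratedDeriv 2 (fun t : ℝ => F (‖z + t • v‖ ^ 2)) 0 =
      4 * F₂ * ⟪z, v⟫ ^ 2 + 2 * F₁ (‖z‖ ^ 2) * ‖v‖ ^ 2 := by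
  have hc : Tendsto (fun t : ℝ => ‖z + t • v‖ ^ 2) (𝓝 0) (𝓝 (‖z‖ ^ 2)) := by
    have : Continuous (fun t : ℝ => ‖z + t • v‖ ^ 2) := by fun_prop
    simpa using this.tendsto 0
  refine iteratedDeriv_two_eq
    (g₁ := fun t => F₁ (‖z + t • v‖ ^ 2) * (2 * ⟪z, v⟫ + 2 * ‖v‖ ^ 2 * t)) ?_ ?_
  · filter_upwards [hc.eventually hF] with t ht
    exact ht.comp t (hasDerivAt_norm_sq_line z v t)
  · have h1 : HasDerivAt (fun t : ℝ => F₁ (‖z + t • v‖ ^ 2)) (F₂ * (2 * ⟪z, v⟫ + 2 * ‖v‖ ^ 2 * 0)) 0 :=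
      HasDerivAt.comp (0 : ℝ) (h₂ := F₁) (by simpa using hF₁) (hasDerivAt_norm_sq_line z v 0)
    have h2 : HasDerivAt (fun t : ℝ => 2 * ⟪z, v⟫ + 2 * ‖v‖ ^ 2 * t) (2 * ‖v‖ ^ 2) 0 := by
      simpa using ((hasDerivAt_id (0 : ℝ)).const_mul (2 * ‖v‖ ^ 2)).const_add (2 * ⟪z, v⟫)
    convert! h1.mul h2 using 1
    simp
    ring

/-- A radial function with positive Laplacian is a strict sub-average at small scales, in
isotropic coordinates. -/
lemma eventually_lt_of_radial {d : ℕ} {K : ConvexBody (Rd d)} (hK : IsSymmetricBody K)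
    {B : Rd d →L[ℝ] Rd d}
    (hB : ∀ x z : Rd d, ∫ y in (K : Set (Rd d)), ⟪x, B y⟫ * ⟪z, B y⟫ = ⟪x, z⟫)
    {F F₁ : ℝ → ℝ} {F₂ : ℝ} {x : Rd d} {w : Rd d → ℝ}
    (hw : w =ᶠ[𝓝 x] fun z => F (‖B z‖ ^ 2)) (hFs : ContDiffAt ℝ ω F (‖B x‖ ^ 2))
    (hF : ∀ᶠ u in 𝓝 (‖B x‖ ^ 2), HasDerivAt F (F₁ u) u) (hF₁ : HasDerivAt F₁ F₂ (‖B x‖ ^ 2))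
    (hpos : 0 < 4 * F₂ * ‖B x‖ ^ 2 + 2 * F₁ (‖B x‖ ^ 2) * d) :
    ∃ r : ℝ, 0 < r ∧
      volume.real (K : Set (Rd d)) * w x < ∫ y in (K : Set (Rd d)), w (x + r • y) := by
  have hsm : ContDiffAt ℝ ω w x := by
    refine ContDiffAt.congr_of_eventuallyEq ?_ hw
    exact hFs.comp x (f := fun z => ‖B z‖ ^ 2) ((B.contDiff.norm_sq ℝ).contDiffAt)
  have h2 : ∀ y, iteratedDeriv 2 (fun t : ℝ => w (x + t • y)) 0 =
      4 * F₂ * ⟪B x, B y⟫ ^ 2 + 2 * F₁ (‖B x‖ ^ 2) * ‖B y‖ ^ 2 := by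
    intro y
    rw [← iteratedDeriv_two_radial hF hF₁ (B y)]
    refine Filter.EventuallyEq.iteratedDeriv_eq 2 ?_
    have hc : Tendsto (fun t : ℝ => x + t • y) (𝓝 0) (𝓝 x) := by
      have : Continuous (fun t : ℝ => x + t • y) := by fun_prop
      simpa using this.tendsto 0
    filter_upwards [hc.eventually hw] with t ht
    rw [ht, map_add, map_smul]
  -- By isotropy the averaged second derivative is exactly the Laplacian of `F(|·|²)` at `B x`.
  have h3 := hsm.eventually_lt_of_second hK (by
    simp only [h2]
    rw [integral_add, integral_const_mul, integral_const_mul, integral_inner_sq_of_isotropic hB,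
      integral_norm_sq_of_isotropic hB]
    · exact hpos
    · exact (Continuous.continuousOn (by fun_prop)).integrableOn_compact K.isCompact
    · exact (Continuous.continuousOn (by fun_prop)).integrableOn_compact K.isCompact)
  obtain ⟨r, hr, hr0⟩ := (h3.and self_mem_nhdsWithin).exists
  exact ⟨r, hr0, hr⟩

lemma tendsto_norm_cocompact_of_le {d : ℕ} {B : Rd d →L[ℝ] Rd d} {a : ℝ} (ha : 0 < a)
    (hB : ∀ x, a * ‖x‖ ≤ ‖B x‖) : Tendsto (fun x => ‖B x‖) (cocompact (Rd d)) atTop :=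
  tendsto_atTop_mono hB ((tendsto_norm_cocompact_atTop).const_mul_atTop ha)

lemma eventuallyEq_max_one {d : ℕ} {B : Rd d →L[ℝ] Rd d} (F : ℝ → ℝ) {x : Rd d}
    (hx : 1 < ‖B x‖) : (fun z => F (max (‖B z‖ ^ 2) 1)) =ᶠ[𝓝 x] fun z => F (‖B z‖ ^ 2) := by
  have hc : Continuous fun z => ‖B z‖ := by fun_prop
  filter_upwards [hc.continuousAt.eventually (lt_mem_nhds hx)] with z hz
  rw [max_eq_left]
  nlinarith

/-! ### Dimensions one and two. -/

/-- In dimension at most two, a continuous super-average that is bounded below is constant. -/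
lemma SuperAverage.eq_const_of_le_two {d : ℕ} (hd : d ≤ 2) {K : ConvexBody (Rd d)}
    (hK : IsSymmetricBody K) {u : Rd d → ℝ} (hu : SuperAverage K u) (huc : Continuous u) {m : ℝ}
    (hm : ∀ x, m ≤ u x) (x : Rd d) : u x = u 0 := by
  obtain ⟨B, ⟨a, ha, hBa⟩, hB⟩ := hK.exists_isotropic
  -- A convex decreasing function of the logarithm, which is harmonic for `d = 2`. The Laplacian
  -- comes out as a positive multiple of `1 + (2 - d) log s`, and this is where `d ≤ 2` enters.
  let F : ℝ → ℝ := fun s => -(Real.log s) ^ (1 / 2 : ℝ)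
  let w : Rd d → ℝ := fun z => F (max (‖B z‖ ^ 2) 1)
  have hwc : Continuous w := by
    refine (Continuous.rpow_const (Continuous.log (by fun_prop) fun z => ?_)
      fun z => Or.inr (by norm_num)).neg
    positivity
  have hw0 : ∀ z, w z ≤ 0 := fun z =>
    neg_nonpos.2 (Real.rpow_nonneg (Real.log_nonneg (le_max_right _ _)) _)
  have hwlim : Tendsto w (cocompact (Rd d)) atBot := by
    refine tendsto_neg_atTop_atBot.comp ((tendsto_rpow_atTop (by norm_num)).comp
      (Real.tendsto_log_atTop.comp (tendsto_atTop_mono (fun z => le_max_left _ _) ?_)))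
    exact (tendsto_pow_atTop two_ne_zero).comp (tendsto_norm_cocompact_of_le ha hBa)
  have hstrict : ∀ z, 1 < ‖B z‖ → ∃ r : ℝ, 0 < r ∧
      volume.real (K : Set (Rd d)) * w z < ∫ y in (K : Set (Rd d)), w (z + r • y) := by
    intro z hz
    set s := ‖B z‖ ^ 2 with hs
    have hs1 : 1 < s := by rw [hs]; nlinarith
    have hlog : 0 < Real.log s := Real.log_pos hs1
    have hder : ∀ (e : ℝ) {v : ℝ}, 1 < v → HasDerivAt (fun v => (Real.log v) ^ e)
        (v⁻¹ * e * (Real.log v) ^ (e - 1)) v := fun e v hv =>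
      (Real.hasDerivAt_log (by positivity)).rpow_const (Or.inl (Real.log_pos hv).ne')
    refine eventually_lt_of_radial hK hB (F := F)
      (F₁ := fun v => -(v⁻¹ * (1 / 2) * (Real.log v) ^ (1 / 2 - 1 : ℝ)))
      (F₂ := -((-(s ^ 2)⁻¹ * (1 / 2)) * (Real.log s) ^ (1 / 2 - 1 : ℝ) +
        s⁻¹ * (1 / 2) * (s⁻¹ * (1 / 2 - 1) * (Real.log s) ^ (1 / 2 - 1 - 1 : ℝ))))
      (eventuallyEq_max_one F hz) ?_ ?_ ?_ ?_
    · have h1 : ContDiffAt ℝ ω Real.log s := Real.contDiffAt_log.2 (by positivity)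
      exact (h1.rpow_const_of_ne hlog.ne').neg
    · filter_upwards [lt_mem_nhds hs1] with v hv
      exact (hder _ hv).neg
    · exact (((hasDerivAt_inv (by positivity)).mul_const (1 / 2)).mul (hder _ hs1)).neg
    · have e1 : (Real.log s) ^ (1 / 2 - 1 : ℝ) =
          Real.log s * (Real.log s) ^ (1 / 2 - 1 - 1 : ℝ) := by
        conv_rhs => rw [← Real.rpow_one_add' hlog.le (by norm_num)]
        congr 1
        ring
      have hp : 0 < (Real.log s) ^ (1 / 2 - 1 - 1 : ℝ) := by positivity
      rw [e1]
      set P := (Real.log s) ^ (1 / 2 - 1 - 1 : ℝ)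
      have hd' : (d : ℝ) ≤ 2 := by exact_mod_cast hd
      have : 4 * -(-(s ^ 2)⁻¹ * (1 / 2) * (Real.log s * P) +
          s⁻¹ * (1 / 2) * (s⁻¹ * (1 / 2 - 1) * P)) * s +
          2 * -(s⁻¹ * (1 / 2) * (Real.log s * P)) * d =
          s⁻¹ * P * (1 + (2 - d) * Real.log s) := by
        field_simp
        ring
      rw [this]
      have : 0 ≤ (2 - (d : ℝ)) * Real.log s := mul_nonneg (by linarith) hlog.le
      positivity
  obtain ⟨x₁, hx₁, hmin⟩ : ∃ x₁ ∈ {z | ‖B z‖ ≤ 1}, ∀ z ∈ {z | ‖B z‖ ≤ 1}, u x₁ ≤ u z := by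
    refine IsCompact.exists_isMinOn ?_ ⟨0, by simp⟩ huc.continuousOn
    refine Metric.isCompact_of_isClosed_isBounded
      (isClosed_le (by fun_prop) continuous_const) ?_
    refine (Metric.isBounded_closedBall (x := (0 : Rd d)) (r := 1 / a)).subset fun z hz => ?_
    rw [mem_closedBall_zero_iff, le_div_iff₀ ha, mul_comm]
    exact (hBa z).trans hz
  have hglob : ∀ z, u x₁ ≤ u z := by
    intro z
    -- However small `δ` is, `δ w` eventually drops below any lower bound of `u`, so comparison
    -- needs no decay of `u`; then `δ` tends to zero.
    have hδ : ∀ δ > 0, u x₁ + δ * w z ≤ u z := by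
      intro δ hδ
      refine hu.ge_of_strict_sub (w := fun z => u x₁ + δ * w z) (s := {z | ‖B z‖ ≤ 1}) huc
        (by fun_prop) ?_ ?_ ?_ z
      · intro z hz
        obtain ⟨r, hr, h⟩ := hstrict z (by simpa using hz)
        refine ⟨r, hr, ?_⟩
        have hi := hwc.integrableOn_comp_add_smul K z r
        rw [integral_add (integrableOn_const K.isCompact.measure_lt_top.ne).integrable
          (hi.const_mul δ), integral_const_mul, setIntegral_const, smul_eq_mul]
        nlinarith
      · intro z hz
        have := hmin z hz
        nlinarith [hw0 z]
      · intro ε hε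
        filter_upwards [hwlim.eventually (eventually_le_atBot ((m - u x₁) / δ))] with z hz
        rw [le_div_iff₀ hδ] at hz
        linarith [hm z]
    have hlim : Tendsto (fun δ : ℝ => u x₁ + δ * w z) (𝓝[>] 0) (𝓝 (u x₁ + 0 * w z)) :=
      (Continuous.tendsto (by fun_prop) 0).mono_left nhdsWithin_le_nhds
    rw [zero_mul, add_zero] at hlim
    exact le_of_tendsto hlim (eventually_mem_nhdsWithin.mono fun δ h => hδ δ h)
  rw [hu.eq_const_of_min hK huc hglob x, hu.eq_const_of_min hK huc hglob 0]

lemma IsMaximalFixedPoint.ae_const_of_le_two {d : ℕ} (hd : d ≤ 2) {K : ConvexBody (Rd d)}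
    (hK : IsSymmetricBody K) {f : Rd d → ℝ} (hf : MemLp f ⊤ volume)
    (hfix : IsMaximalFixedPoint K f) : ∃ c : ℝ, f =ᵐ[volume] fun _ => c := by
  set g := hf.1.mk f
  have hfg : f =ᵐ[volume] g := hf.1.ae_eq_mk
  have hgm : Measurable g := hf.1.stronglyMeasurable_mk.measurable
  have hg : MemLp g ⊤ volume := hf.ae_eq hfg
  have hloc : LocallyIntegrable g volume := hg.locallyIntegrable le_top
  have hsup : AESuperAverage K g := (hfix.aeSuperAverage hK).congr hfg
  obtain ⟨C, hC⟩ : ∃ C, ∀ᵐ x, -C ≤ g x := by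
    refine ⟨(eLpNormEssSup g volume).toReal, ?_⟩
    have h1 : eLpNormEssSup g volume < ⊤ := by
      have := hg.2
      rwa [eLpNorm_exponent_top] at this
    filter_upwards [ae_le_eLpNormEssSup (f := g) (μ := volume)] with x hx
    have h2 : ‖g x‖ ≤ (eLpNormEssSup g volume).toReal := by
      rw [← toReal_enorm]
      exact ENNReal.toReal_mono h1.ne hx
    exact (abs_le.1 h2).1
  have hconst : ∀ n x, mollify n g x = mollify n g 0 := fun n =>
    (superAverage_mollify n hgm hloc hsup).eq_const_of_le_two hd hK (continuous_mollify n hloc)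
      (m := -C) fun x => le_mollify n hloc (hC.mono fun y hy _ => hy)
  have hlim := ae_tendsto_mollify hloc
  obtain ⟨x₀, hx₀⟩ := hlim.exists
  refine ⟨g x₀, hfg.trans ?_⟩
  filter_upwards [hlim] with x hx
  simp only [hconst _ x] at hx
  simp only [hconst _ x₀] at hx₀
  exact tendsto_nhds_unique hx hx₀

/-! ### Nonexistence up to the exponent `d / (d - 2)`. -/

/-- The Laplacian of `|x|^(-α)` is `α (α - (d - 2)) |x|^(-α-2)`, positive exactly when `α` exceeds
`d - 2` (for positive `α`). -/
lemma strict_sub_rpow {d : ℕ} {K : ConvexBody (Rd d)} (hK : IsSymmetricBody K)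
    {B : Rd d →L[ℝ] Rd d}
    (hB : ∀ x z : Rd d, ∫ y in (K : Set (Rd d)), ⟪x, B y⟫ * ⟪z, B y⟫ = ⟪x, z⟫)
    {α : ℝ} (hα : 0 < α) (hαd : (d : ℝ) - 2 < α) {z : Rd d} (hz : 1 < ‖B z‖) :
    ∃ r : ℝ, 0 < r ∧ volume.real (K : Set (Rd d)) * (max (‖B z‖ ^ 2) 1) ^ (-α / 2) <
      ∫ y in (K : Set (Rd d)), (max (‖B (z + r • y)‖ ^ 2) 1) ^ (-α / 2) := by
  set s := ‖B z‖ ^ 2 with hs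
  have hs1 : 1 < s := by rw [hs]; nlinarith
  have hs0 : 0 < s := by linarith
  refine eventually_lt_of_radial hK hB (F := fun v => v ^ (-α / 2))
    (F₁ := fun v => -α / 2 * v ^ (-α / 2 - 1))
    (F₂ := -α / 2 * ((-α / 2 - 1) * s ^ (-α / 2 - 1 - 1)))
    (w := fun z => (max (‖B z‖ ^ 2) 1) ^ (-α / 2))
    (eventuallyEq_max_one (fun v => v ^ (-α / 2)) hz) ?_ ?_ ?_ ?_
  · exact Real.contDiffAt_rpow_const_of_ne hs0.ne'
  · filter_upwards [lt_mem_nhds hs1] with v hv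
    exact Real.hasDerivAt_rpow_const (Or.inl (by positivity))
  · exact (Real.hasDerivAt_rpow_const (Or.inl hs0.ne')).const_mul _
  · have e1 : s ^ (-α / 2 - 1) = s * s ^ (-α / 2 - 1 - 1) := by
      rw [Real.rpow_sub_one hs0.ne' (-α / 2 - 1)]
      field_simp
    rw [e1]
    have hp : 0 < s ^ (-α / 2 - 1 - 1) := by positivity
    have : 0 < α * (α - (d - 2)) * (s * s ^ (-α / 2 - 1 - 1)) :=
      mul_pos (mul_pos hα (by linarith)) (mul_pos hs0 hp)
    linarith

lemma IsMaximalFixedPoint.ae_zero_of_le {d : ℕ} (hd : 3 ≤ d) {K : ConvexBody (Rd d)}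
    (hK : IsSymmetricBody K) {p : ℝ} (hp : 1 ≤ p) (hpd : p ≤ (d : ℝ) / ((d : ℝ) - 2))
    {f : Rd d → ℝ} (hf : MemLp f (ENNReal.ofReal p) volume) (hfix : IsMaximalFixedPoint K f) :
    f =ᵐ[volume] 0 := by
  have hd3 : (3 : ℝ) ≤ d := by exact_mod_cast hd
  set g := hf.1.mk f
  have hfg : f =ᵐ[volume] g := hf.1.ae_eq_mk
  have hgm : Measurable g := hf.1.stronglyMeasurable_mk.measurable
  have hg : MemLp g (ENNReal.ofReal p) volume := hf.ae_eq hfg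
  have hloc : LocallyIntegrable g volume := hg.locallyIntegrable (by simpa using hp)
  have hsup : AESuperAverage K g := (hfix.aeSuperAverage hK).congr hfg
  have hnn := hsup.nonneg_of_memLp (by omega) hK hp hg
  refine hfg.trans ?_
  by_contra hne
  obtain ⟨B, ⟨a, ha, hBa⟩, hB⟩ := hK.exists_isotropic
  obtain ⟨c, hc, hcg⟩ := hsup.exists_pos_le_ball hK hloc hnn hne (1 / a + 1)
  -- All these barriers are at most 1, so the same `c` works for every `α`.
  have hlow : ∀ α : ℝ, (d : ℝ) - 2 < α → ∀ᵐ x, c * (max (‖B x‖ ^ 2) 1) ^ (-α / 2) ≤ g x := by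
    intro α hα
    have hα0 : 0 < α := by linarith
    refine hsup.ae_ge_of_strict_sub (w := fun x => (max (‖B x‖ ^ 2) 1) ^ (-α / 2)) hgm hloc hnn hc
      hcg ?_ ?_ ?_ ?_
    · exact Continuous.rpow_const (by fun_prop) fun x => Or.inl (by positivity)
    · exact fun x => Real.rpow_le_one_of_one_le_of_nonpos (le_max_right _ _) (by linarith)
    · have h1 := tendsto_rpow_neg_atTop (show 0 < α / 2 by positivity)
      rw [← neg_div] at h1
      refine h1.comp (tendsto_atTop_mono (fun z => le_max_left _ _) ?_)
      exact (tendsto_pow_atTop two_ne_zero).comp (tendsto_norm_cocompact_of_le ha hBa)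
    · intro x hx
      refine strict_sub_rpow hK hB hα0 hα ?_
      rw [div_lt_iff₀ ha, mul_comm] at hx
      exact hx.trans_le (hBa x)
  -- Because `c` is uniform, `α` may decrease to `d - 2` along a sequence; this is what includes the
  -- endpoint exponent.
  have hlow2 : ∀ᵐ x, c * (max (‖B x‖ ^ 2) 1) ^ (-((d : ℝ) - 2) / 2) ≤ g x := by
    have h1 : ∀ᵐ x, ∀ n : ℕ, c * (max (‖B x‖ ^ 2) 1) ^ (-((d : ℝ) - 2 + 1 / (n + 1)) / 2) ≤ g x :=
      ae_all_iff.2 fun n => hlow _ (by linarith [Nat.one_div_pos_of_nat (α := ℝ) (n := n)])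
    filter_upwards [h1] with x hx
    refine le_of_tendsto (x := atTop) ?_ (Eventually.of_forall hx)
    have hmax : 0 < max (‖B x‖ ^ 2) 1 := by positivity
    have h2 : Tendsto (fun n : ℕ => -((d : ℝ) - 2 + 1 / ((n : ℝ) + 1)) / 2) atTop
        (𝓝 (-((d : ℝ) - 2 + 0) / 2)) :=
      ((tendsto_one_div_add_atTop_nhds_zero_nat).const_add _).neg.div_const 2
    rw [add_zero] at h2
    exact ((Real.continuousAt_const_rpow hmax.ne').tendsto.comp h2).const_mul c
  refine not_memLp_of_ge_rpow_neg (by omega) hp (b := ‖B‖ + 1) (α := (d : ℝ) - 2)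
    (by positivity) hc ?_ ?_ hg
  · rwa [le_div_iff₀ (by linarith), mul_comm] at hpd
  · filter_upwards [hlow2] with x hx
    refine le_trans ?_ hx
    refine mul_le_mul_of_nonneg_left ?_ hc.le
    have h3 : (max ((‖B‖ + 1) * ‖x‖) 1) ^ (-((d : ℝ) - 2)) =
        ((max ((‖B‖ + 1) * ‖x‖) 1) ^ 2) ^ (-((d : ℝ) - 2) / 2) := by
      rw [← Real.rpow_natCast, ← Real.rpow_mul (by positivity)]
      congr 1
      push_cast
      ring
    rw [h3]
    refine Real.rpow_le_rpow_of_nonpos (by positivity) ?_ (by linarith)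
    refine max_le ?_ ?_
    · refine pow_le_pow_left₀ (norm_nonneg _) ?_ 2
      refine le_trans ((B.le_opNorm x).trans ?_) (le_max_left _ _)
      gcongr
      linarith
    · exact one_le_pow₀ (le_max_right _ _)

/-! ### The zonal quartic and the fourth-moment condition. -/

/-- The zonal harmonic polynomial of degree four on `ℝ^d`. -/
def zonalQuartic {d : ℕ} (x y : Rd d) : ℝ :=
  3 * ‖x‖ ^ 4 * ‖y‖ ^ 4 - 6 * (d + 2) * ‖x‖ ^ 2 * ⟪x, y⟫ ^ 2 * ‖y‖ ^ 2 +
    (d + 2) * (d + 4) * ⟪x, y⟫ ^ 4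

lemma continuous_zonalQuartic {d : ℕ} :
    Continuous fun z : Rd d × Rd d => zonalQuartic z.1 z.2 := by
  unfold zonalQuartic
  fun_prop

lemma iteratedDeriv_four_eq {g g₁ g₂ g₃ : ℝ → ℝ} {t c : ℝ}
    (h : ∀ᶠ s in 𝓝 t, HasDerivAt g (g₁ s) s) (h₁ : ∀ᶠ s in 𝓝 t, HasDerivAt g₁ (g₂ s) s)
    (h₂ : ∀ᶠ s in 𝓝 t, HasDerivAt g₂ (g₃ s) s) (h₃ : HasDerivAt g₃ c t) :
    iteratedDeriv 4 g t = c := by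
  rw [iteratedDeriv_succ', iteratedDeriv_succ']
  have e1 : deriv g =ᶠ[𝓝 t] g₁ := h.mono fun s hs => hs.deriv
  have e2 : deriv g₁ =ᶠ[𝓝 t] g₂ := h₁.mono fun s hs => hs.deriv
  rw [(e1.deriv.trans e2).iteratedDeriv_eq 2]
  exact iteratedDeriv_two_eq h₂ h₃

lemma contDiffAt_norm_sq_rpow {d : ℕ} {x : Rd d} (hx : x ≠ 0) (p : ℝ) :
    ContDiffAt ℝ ω (fun z : Rd d => (‖z‖ ^ 2) ^ p) x :=
  ((contDiff_norm_sq ℝ).contDiffAt).rpow_const_of_ne (by positivity)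

lemma iteratedDeriv_four_norm_rpow {d : ℕ} {x : Rd d} (hx : x ≠ 0) (y : Rd d) :
    iteratedDeriv 4 (fun t : ℝ => (‖x + t • y‖ ^ 2) ^ ((2 - d : ℝ) / 2)) 0 =
      d * (d - 2) * (‖x‖ ^ 2) ^ ((2 - d : ℝ) / 2 - 4) * zonalQuartic x y := by
  set p : ℝ := (2 - d : ℝ) / 2 with hp
  set Q : ℝ → ℝ := fun t => ‖x + t • y‖ ^ 2 with hQ
  set a := ⟪x, y⟫ with ha
  set b := ‖y‖ ^ 2 with hb
  have hQ0 : Q 0 = ‖x‖ ^ 2 := by simp [hQ]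
  have hs0 : 0 < ‖x‖ ^ 2 := by positivity
  have hQd : ∀ t, HasDerivAt Q (2 * a + 2 * b * t) t := hasDerivAt_norm_sq_line x y
  have hQpos : ∀ᶠ t in 𝓝 (0 : ℝ), 0 < Q t := by
    have : Continuous Q := by fun_prop
    exact this.continuousAt.eventually (lt_mem_nhds (by rw [hQ0]; exact hs0))
  have hL : ∀ t, HasDerivAt (fun t : ℝ => 2 * a + 2 * b * t) (2 * b) t := fun t => by
    simpa using ((hasDerivAt_id t).const_mul (2 * b)).const_add (2 * a)
  have hP : ∀ (e : ℝ) {t : ℝ}, 0 < Q t →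
      HasDerivAt (fun t => Q t ^ e) ((2 * a + 2 * b * t) * e * Q t ^ (e - 1)) t := fun e t ht =>
    (hQd t).rpow_const (Or.inl ht.ne')
  have h4 := iteratedDeriv_four_eq (g := fun t => Q t ^ p) (t := 0)
    (g₁ := fun t => (2 * a + 2 * b * t) * p * Q t ^ (p - 1))
    (g₂ := fun t => p * (p - 1) * ((2 * a + 2 * b * t) ^ 2 * Q t ^ (p - 1 - 1)) +
      2 * b * p * Q t ^ (p - 1))
    (g₃ := fun t => p * (p - 1) * (p - 2) * ((2 * a + 2 * b * t) ^ 3 * Q t ^ (p - 1 - 1 - 1)) +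
      6 * b * p * (p - 1) * ((2 * a + 2 * b * t) * Q t ^ (p - 1 - 1)))
    (c := p * (p - 1) * (p - 2) * (p - 3) * ((2 * a) ^ 4 * Q 0 ^ (p - 1 - 1 - 1 - 1)) +
      12 * b * p * (p - 1) * (p - 2) * ((2 * a) ^ 2 * Q 0 ^ (p - 1 - 1 - 1)) +
      12 * b ^ 2 * p * (p - 1) * Q 0 ^ (p - 1 - 1)) ?_ ?_ ?_ ?_
  · change iteratedDeriv 4 (fun t => Q t ^ p) 0 = _
    rw [h4, hQ0]
    set s := ‖x‖ ^ 2 with hs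
    have e1 : s ^ (p - 1 - 1) = s ^ 2 * s ^ (p - 4) := by
      rw [← Real.rpow_natCast, ← Real.rpow_add hs0]; congr 1; push_cast; ring
    have e2 : s ^ (p - 1 - 1 - 1) = s * s ^ (p - 4) := by
      -- The rule for adding exponents excludes total exponent zero, which here would require `d =
      -- -4`.
      rw [← Real.rpow_one_add' hs0.le (by rw [hp]; intro h; have : (d : ℝ) = -4 := by linarith
                                          linarith [Nat.cast_nonneg (α := ℝ) d])]
      congr 1; ring
    have e3 : s ^ (p - 1 - 1 - 1 - 1) = s ^ (p - 4) := by congr 1; ring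
    rw [e1, e2, e3, zonalQuartic, show ‖x‖ ^ 4 = s ^ 2 by rw [hs]; ring,
      show ‖y‖ ^ 4 = b ^ 2 by rw [hb]; ring, ← hs, ← hb, ← ha]
    generalize s ^ (p - 4) = S
    rw [hp]
    ring
  · filter_upwards [hQpos] with t ht
    exact hP p ht
  · filter_upwards [hQpos] with t ht
    convert! ((hL t).mul_const p).mul (hP (p - 1) ht) using 1
    ring
  · filter_upwards [hQpos] with t ht
    convert! ((((hL t).pow 2).mul (hP (p - 1 - 1) ht)).const_mul (p * (p - 1))).add
      ((hP (p - 1) ht).const_mul (2 * b * p)) using 1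
    simp only [Pi.pow_apply]
    push_cast
    ring
  · have ht : 0 < Q 0 := by rw [hQ0]; exact hs0
    convert! ((((hL 0).pow 3).mul (hP (p - 1 - 1 - 1) ht)).const_mul (p * (p - 1) * (p - 2))).add
      (((hL 0).mul (hP (p - 1 - 1) ht)).const_mul (6 * b * p * (p - 1))) using 1
    simp only [Pi.pow_apply]
    push_cast
    ring

lemma greenFn_eq {d : ℕ} (hd : 3 ≤ d) : greenFn d = fun x => (‖x‖ ^ 2) ^ ((2 - d : ℝ) / 2) *
    ((d : ℝ) * ((d : ℝ) - 2) * volume.real (Metric.ball (0 : Rd d) 1))⁻¹ := by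
  have hd3 : (3 : ℝ) ≤ d := by exact_mod_cast hd
  funext x
  rw [greenFn, div_eq_mul_inv]
  congr 1
  rw [← Real.rpow_natCast, ← Real.rpow_mul (norm_nonneg _), ← Real.rpow_intCast]
  congr 1
  push_cast
  ring

/-- Multilinearity, expanding `y` in the standard basis one slot at a time. -/
lemma map_diag_four {d : ℕ}
    (f : ContinuousMultilinearMap ℝ (fun _ : Fin 4 => Rd d) ℝ) (y : Rd d) :
    ∑ i, ∑ j, ∑ k, ∑ l, f ![EuclideanSpace.single i 1, EuclideanSpace.single j 1,
      EuclideanSpace.single k 1, EuclideanSpace.single l 1] * (y i * y j * y k * y l) =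
      f (fun _ => y) := by
  have hy : ∀ (m : Fin 4 → Rd d) (k : Fin 4), f (Function.update m k y) =
      ∑ i, y i * f (Function.update m k (EuclideanSpace.single i 1)) := by
    intro m k
    have h := congrArg (f.toMultilinearMap.toLinearMap m k)
      ((EuclideanSpace.basisFun (Fin d) ℝ).sum_repr y)
    rw [map_sum] at h
    simpa using h.symm
  have h0 : ∀ a b c : Rd d, f ![y, a, b, c] =
      ∑ i, y i * f ![EuclideanSpace.single i 1, a, b, c] := by
    intro a b c
    have e : ∀ z, Function.update ![y, a, b, c] 0 z = ![z, a, b, c] := fun z => by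
      funext j; fin_cases j <;> rfl
    simpa only [e] using hy ![y, a, b, c] 0
  have h1 : ∀ a b c : Rd d, f ![a, y, b, c] =
      ∑ i, y i * f ![a, EuclideanSpace.single i 1, b, c] := by
    intro a b c
    have e : ∀ z, Function.update ![a, y, b, c] 1 z = ![a, z, b, c] := fun z => by
      funext j; fin_cases j <;> rfl
    simpa only [e] using hy ![a, y, b, c] 1
  have h2 : ∀ a b c : Rd d, f ![a, b, y, c] =
      ∑ i, y i * f ![a, b, EuclideanSpace.single i 1, c] := by
    intro a b c
    have e : ∀ z, Function.update ![a, b, y, c] 2 z = ![a, b, z, c] := fun z => by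
      funext j; fin_cases j <;> rfl
    simpa only [e] using hy ![a, b, y, c] 2
  have h3 : ∀ a b c : Rd d, f ![a, b, c, y] =
      ∑ i, y i * f ![a, b, c, EuclideanSpace.single i 1] := by
    intro a b c
    have e : ∀ z, Function.update ![a, b, c, y] 3 z = ![a, b, c, z] := fun z => by
      funext j; fin_cases j <;> rfl
    simpa only [e] using hy ![a, b, c, y] 3
  have h4 : (fun _ => y : Fin 4 → Rd d) = ![y, y, y, y] := by
    funext j
    fin_cases j <;> rfl
  rw [h4]
  simp only [h0, h1, h2, h3, Finset.mul_sum]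
  refine Finset.sum_congr rfl fun i _ => Finset.sum_congr rfl fun j _ =>
    Finset.sum_congr rfl fun k _ => Finset.sum_congr rfl fun l _ => ?_
  ring

lemma sum_greenCoeff_eq {d : ℕ} (hd : 3 ≤ d) {x₀ : Rd d} (hx₀ : x₀ ≠ 0) (y : Rd d) :
    ∑ i, ∑ j, ∑ k, ∑ l, greenCoeff x₀ i j k l * (y i * y j * y k * y l) =
      (‖x₀‖ ^ 2) ^ ((2 - d : ℝ) / 2 - 4) * (volume.real (Metric.ball (0 : Rd d) 1))⁻¹ *
        zonalQuartic x₀ y := by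
  have hd3 : (3 : ℝ) ≤ d := by exact_mod_cast hd
  simp only [greenCoeff]
  rw [map_diag_four, iteratedFDeriv_diag_eq_iteratedDeriv, greenFn_eq hd]
  · simp only [mul_comm _ ((d : ℝ) * ((d : ℝ) - 2) * volume.real (Metric.ball (0 : Rd d) 1))⁻¹]
    rw [iteratedDeriv_const_mul_field, iteratedDeriv_four_norm_rpow hx₀]
    have : (d : ℝ) - 2 ≠ 0 := by linarith
    have : (d : ℝ) ≠ 0 := by linarith
    rw [mul_inv, mul_inv]
    field_simp
  · rw [greenFn_eq hd]
    exact (contDiffAt_norm_sq_rpow hx₀ _).mul contDiffAt_const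

/-- The derivative form is a nonzero multiple of the zonal quartic, the multiple depending only on
`x₀` and `d`. -/
lemma fourthMomentCondition_iff {d : ℕ} (hd : 3 ≤ d) {x₀ : Rd d} (hx₀ : x₀ ≠ 0)
    (K : ConvexBody (Rd d)) :
    FourthMomentCondition x₀ K ↔ ∫ y in (K : Set (Rd d)), zonalQuartic x₀ y ≠ 0 := by
  have hv : 0 < volume.real (Metric.ball (0 : Rd d) 1) :=
    ENNReal.toReal_pos (Metric.measure_ball_pos _ _ one_pos).ne' measure_ball_lt_top.ne
  have hs : 0 < ‖x₀‖ ^ 2 := by positivity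
  have hc : (‖x₀‖ ^ 2) ^ ((2 - d : ℝ) / 2 - 4) * (volume.real (Metric.ball (0 : Rd d) 1))⁻¹ ≠ 0 := by
    positivity
  rw [FourthMomentCondition]
  simp only [sum_greenCoeff_eq hd hx₀, integral_const_mul]
  rw [mul_ne_zero_iff]
  simp [hc]

lemma zonalQuartic_smul_left {d : ℕ} (c : ℝ) (x y : Rd d) :
    zonalQuartic (c • x) y = c ^ 4 * zonalQuartic x y := by
  simp only [zonalQuartic, norm_smul, real_inner_smul_left, mul_pow, Real.norm_eq_abs, sq_abs,
    Even.pow_abs (show Even 4 by decide)]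
  ring

lemma zonalQuartic_smul_right {d : ℕ} (c : ℝ) (x y : Rd d) :
    zonalQuartic x (c • y) = c ^ 4 * zonalQuartic x y := by
  simp only [zonalQuartic, norm_smul, real_inner_smul_right, mul_pow, Real.norm_eq_abs, sq_abs,
    Even.pow_abs (show Even 4 by decide)]
  ring

lemma zonalQuartic_map {d : ℕ} (R : Rd d ≃ₗᵢ[ℝ] Rd d) (x y : Rd d) :
    zonalQuartic (R x) (R y) = zonalQuartic x y := by
  simp [zonalQuartic]

lemma continuous_integral_zonalQuartic {d : ℕ} (K : ConvexBody (Rd d)) :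
    Continuous fun x => ∫ y in (K : Set (Rd d)), zonalQuartic x y :=
  continuous_parametric_integral_of_continuous continuous_zonalQuartic K.isCompact

lemma inner_single_one {d : ℕ} (x : Rd d) (i : Fin d) :
    ⟪x, EuclideanSpace.single i (1 : ℝ)⟫ = x i := by
  simp [EuclideanSpace.inner_single_right]

lemma inner_single_single {d : ℕ} (i j : Fin d) :
    ⟪(EuclideanSpace.single i (1 : ℝ) : Rd d), EuclideanSpace.single j (1 : ℝ)⟫ =
      if i = j then 1 else 0 := by
  rw [inner_single_one]
  simp [eq_comm]

lemma norm_single_one {d : ℕ} (i : Fin d) : ‖(EuclideanSpace.single i (1 : ℝ) : Rd d)‖ = 1 := by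
  simp

/-- The form of the Laplace equation for a quartic form that involves only finitely many values. -/
lemma sum_zonalQuartic {d : ℕ} (x : Rd d) :
    ∑ i, ∑ j, (zonalQuartic x (EuclideanSpace.single i 1 + EuclideanSpace.single j 1) +
      zonalQuartic x (EuclideanSpace.single i 1 - EuclideanSpace.single j 1)) =
      4 * d * ∑ i : Fin d, zonalQuartic x (EuclideanSpace.single i 1) := by
  have hn : ∑ i, x i ^ 2 = ‖x‖ ^ 2 := by
    rw [EuclideanSpace.norm_sq_eq]
    simp
  have h4 : ∀ v : Rd d, ‖v‖ ^ 4 = (‖v‖ ^ 2) ^ 2 := fun v => by ring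
  have h1 : ∀ i j : Fin d,
      zonalQuartic x (EuclideanSpace.single i 1 + EuclideanSpace.single j 1) +
        zonalQuartic x (EuclideanSpace.single i 1 - EuclideanSpace.single j 1) =
      3 * ‖x‖ ^ 4 * (8 + if i = j then 8 else 0) -
        6 * (d + 2) * ‖x‖ ^ 2 * (4 * x i ^ 2 + 4 * x j ^ 2 + if i = j then 8 * x i ^ 2 else 0) +
        (d + 2) * (d + 4) * (2 * x i ^ 4 + 2 * x j ^ 4 + 12 * (x i ^ 2 * x j ^ 2)) := by
    intro i j
    simp only [zonalQuartic, h4 (_ + _), h4 (_ - _), norm_add_sq_real, norm_sub_sq_real,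
      inner_add_right, inner_sub_right, inner_single_one]
    simp only [← inner_single_one (EuclideanSpace.single i (1 : ℝ) : Rd d), inner_single_single]
    simp only [norm_single_one]
    split_ifs with h
    · subst h
      ring
    · ring
  have h2 : ∀ i : Fin d, zonalQuartic x (EuclideanSpace.single i 1) =
      3 * ‖x‖ ^ 4 - 6 * (d + 2) * ‖x‖ ^ 2 * x i ^ 2 + (d + 2) * (d + 4) * x i ^ 4 := by
    intro i
    simp only [zonalQuartic, inner_single_one, norm_single_one]
    ring
  simp only [h1, h2, Finset.sum_add_distrib, Finset.sum_sub_distrib, ← Finset.mul_sum,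
    Finset.sum_const, Finset.card_univ, Fintype.card_fin, nsmul_eq_mul, Finset.sum_ite_eq,
    Finset.mem_univ, if_true, ← Finset.sum_mul, hn]
  ring

lemma integral_ball_zonalQuartic_map {d : ℕ} (R : Rd d ≃ₗᵢ[ℝ] Rd d) (y : Rd d) :
    ∫ x in Metric.closedBall (0 : Rd d) 1, zonalQuartic x (R y) =
      ∫ x in Metric.closedBall (0 : Rd d) 1, zonalQuartic x y := by
  have h := R.measurePreserving.setIntegral_preimage_emb
    R.toHomeomorph.measurableEmbedding (fun x => zonalQuartic x (R y))
    (Metric.closedBall (0 : Rd d) 1)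
  rw [← h]
  simp only [zonalQuartic_map]
  congr 2
  ext x
  simp

/-- The integral is homogeneous of degree four and invariant under isometries in `y`, hence a
multiple of `|y|^4`. It also satisfies the finite form of Laplace's equation in `sum_zonalQuartic`,
which no nonzero multiple of `|y|^4` does. -/
lemma integral_ball_zonalQuartic {d : ℕ} (y : Rd d) :
    ∫ x in Metric.closedBall (0 : Rd d) 1, zonalQuartic x y = 0 := by
  rcases Nat.eq_zero_or_pos d with rfl | hd
  · have : ∀ x : Rd 0, zonalQuartic x y = 0 := fun x => by
      simp [zonalQuartic, Subsingleton.elim y 0]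
    simp [this]
  set Φ : Rd d → ℝ := fun y => ∫ x in Metric.closedBall (0 : Rd d) 1, zonalQuartic x y with hΦ
  set e₀ : Rd d := EuclideanSpace.single ⟨0, hd⟩ 1 with he₀
  have he₀n : ‖e₀‖ = 1 := by simp [he₀]
  have hform : ∀ y, Φ y = Φ e₀ * (‖y‖ ^ 2) ^ 2 := by
    intro y
    -- The reflection exchanging two vectors of equal norm carries `y` to the ray of `e₀`.
    have hR : ((ℝ ∙ (y - ‖y‖ • e₀))ᗮ).reflection y = ‖y‖ • e₀ :=
      Submodule.reflection_sub (by rw [norm_smul, he₀n]; simp)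
    have h1 := integral_ball_zonalQuartic_map ((ℝ ∙ (y - ‖y‖ • e₀))ᗮ).reflection y
    rw [hR] at h1
    simp only [zonalQuartic_smul_right, integral_const_mul] at h1
    simp only [hΦ]
    rw [← h1]
    ring
  have hint : ∀ y : Rd d, IntegrableOn (fun x => zonalQuartic x y)
      (Metric.closedBall (0 : Rd d) 1) volume := fun y =>
    (Continuous.continuousOn (continuous_zonalQuartic.comp (by fun_prop :
      Continuous fun x : Rd d => (x, y)))).integrableOn_compact (isCompact_closedBall _ _)
  have hsum : ∑ i, ∑ j, (Φ (EuclideanSpace.single i 1 + EuclideanSpace.single j 1) +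
      Φ (EuclideanSpace.single i 1 - EuclideanSpace.single j 1)) =
      4 * d * ∑ i : Fin d, Φ (EuclideanSpace.single i 1) := by
    simp only [hΦ]
    rw [← integral_finsetSum _ fun i _ => hint _, ← integral_const_mul]
    simp only [← integral_add (hint _) (hint _)]
    rw [← setIntegral_congr_fun measurableSet_closedBall fun x _ => sum_zonalQuartic x]
    rw [integral_finsetSum]
    · refine Finset.sum_congr rfl fun i _ => ?_
      rw [integral_finsetSum]
      exact fun j _ => (hint _).add (hint _)
    · exact fun i _ => integrable_finsetSum _ fun j _ => (hint _).add (hint _)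
  have hpair : ∀ i j : Fin d, Φ (EuclideanSpace.single i 1 + EuclideanSpace.single j 1) +
      Φ (EuclideanSpace.single i 1 - EuclideanSpace.single j 1) =
      Φ e₀ * (8 + if i = j then 8 else 0) := by
    intro i j
    rw [hform (_ + _), hform (_ - _), norm_add_sq_real, norm_sub_sq_real, inner_single_single]
    simp only [norm_single_one]
    split_ifs <;> ring
  have hsingle : ∀ i : Fin d, Φ (EuclideanSpace.single i 1) = Φ e₀ := by
    intro i
    rw [hform]
    simp
  simp only [hpair, hsingle, mul_add, Finset.sum_add_distrib, ← Finset.mul_sum,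
    Finset.sum_const, Finset.card_univ, Fintype.card_fin, nsmul_eq_mul, Finset.sum_ite_eq,
    Finset.mem_univ, if_true] at hsum
  have hd' : (0 : ℝ) < d := by exact_mod_cast hd
  -- For `|y|^4` the two sides are `8d² + 8d` and `4d²`.
  have h0 : Φ e₀ * (4 * d * (d + 2)) = 0 := by linarith
  have hz : Φ e₀ = 0 := by
    rcases mul_eq_zero.1 h0 with h | h
    · exact h
    · exact absurd h (by positivity)
  change Φ y = 0
  rw [hform, hz, zero_mul]

/-- If the zonal fourth moment is nonzero somewhere then it is positive somewhere. -/
lemma exists_integral_zonalQuartic_pos {d : ℕ} (K : ConvexBody (Rd d)) {x₀ : Rd d}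
    (h : ∫ y in (K : Set (Rd d)), zonalQuartic x₀ y ≠ 0) :
    ∃ e : Rd d, ‖e‖ = 1 ∧ 0 < ∫ y in (K : Set (Rd d)), zonalQuartic e y := by
  by_contra! hneg
  set H : Rd d → ℝ := fun x => ∫ y in (K : Set (Rd d)), zonalQuartic x y with hH
  have hHc : Continuous H := continuous_integral_zonalQuartic K
  have hscale : ∀ (c : ℝ) x, H (c • x) = c ^ 4 * H x := fun c x => by
    simp only [hH, zonalQuartic_smul_left, integral_const_mul]
  have hle : ∀ x, H x ≤ 0 := by
    intro x
    rcases eq_or_ne x 0 with rfl | hx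
    · have := hscale 0 0
      simp at this
      exact this.le
    · have hx' : ‖x‖ ≠ 0 := norm_ne_zero_iff.2 hx
      have h1 := hscale ‖x‖ (‖x‖⁻¹ • x)
      rw [smul_inv_smul₀ hx'] at h1
      rw [h1]
      exact mul_nonpos_of_nonneg_of_nonpos (by positivity) (hneg _ (by
        rw [norm_smul, norm_inv, norm_norm, inv_mul_cancel₀ hx']))
  -- By Fubini the moment has mean zero over the ball; being nonpositive and continuous it then
  -- vanishes there, and by homogeneity everywhere.
  have hzero : ∫ x in Metric.closedBall (0 : Rd d) 1, H x = 0 := by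
    simp only [hH]
    rw [integral_integral_swap]
    · simp [integral_ball_zonalQuartic]
    · rw [Measure.prod_restrict]
      exact continuous_zonalQuartic.continuousOn.integrableOn_compact
        ((isCompact_closedBall _ _).prod K.isCompact)
  have hae : (fun x => -H x) =ᵐ[volume.restrict (Metric.closedBall (0 : Rd d) 1)] 0 := by
    refine (setIntegral_eq_zero_iff_of_nonneg_ae
      (Eventually.of_forall fun x => neg_nonneg.2 (hle x)) ?_).1 ?_
    · exact hHc.neg.continuousOn.integrableOn_compact (isCompact_closedBall _ _)
    · rw [integral_neg, hzero, neg_zero]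
  have hEq : Set.EqOn (fun x => -H x) 0 (Metric.ball 0 1) :=
    Measure.eqOn_open_of_ae_eq (μ := volume)
      (ae_mono (Measure.restrict_mono Metric.ball_subset_closedBall le_rfl) hae)
      Metric.isOpen_ball hHc.neg.continuousOn continuousOn_const
  have hc : (‖x₀‖ + 1)⁻¹ ≠ 0 := by positivity
  have h1 := hEq (x := (‖x₀‖ + 1)⁻¹ • x₀) (by
    rw [mem_ball_zero_iff, norm_smul, Real.norm_of_nonneg (by positivity),
      inv_mul_lt_iff₀ (by positivity)]
    linarith)
  simp only [hscale, Pi.zero_apply, neg_eq_zero, mul_eq_zero, pow_eq_zero_iff four_ne_zero] at h1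
  exact h (h1.resolve_left hc)

/-! ### The cone barrier and exponents beyond `d / (d - 2)`. -/

/-- The logarithm of the squared norm, truncated near the origin. -/
def logNormSq {d : ℕ} (x : Rd d) : ℝ := Real.log (max (‖x‖ ^ 2) (1 / 4))

/-- The function `|x| ^ (2 p) exp (N ⟨x, e⟩ / |x|)`, truncated near the origin. -/
def coneKernel {d : ℕ} (N : ℝ) (e : Rd d) (p : ℝ) (x : Rd d) : ℝ :=
  Real.exp (p * logNormSq x + N * ⟪x, e⟫ * Real.exp (-logNormSq x / 2))

lemma continuous_logNormSq {d : ℕ} : Continuous (logNormSq : Rd d → ℝ) :=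
  Continuous.log (by fun_prop) fun x => by positivity

lemma continuous_coneKernel {d : ℕ} (N : ℝ) (e : Rd d) :
    Continuous fun q : ℝ × Rd d => coneKernel N e q.1 q.2 := by
  have := continuous_logNormSq (d := d)
  unfold coneKernel
  fun_prop

lemma coneKernel_pos {d : ℕ} (N : ℝ) (e : Rd d) (p : ℝ) (x : Rd d) : 0 < coneKernel N e p x :=
  Real.exp_pos _

lemma logNormSq_of_le {d : ℕ} {x : Rd d} (hx : 1 / 2 ≤ ‖x‖) :
    logNormSq x = Real.log (‖x‖ ^ 2) := by
  rw [logNormSq, max_eq_left]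
  nlinarith

/-- The kernel is homogeneous of degree `2p` away from the truncation, which is inactive at `z` and
at its outward dilates. -/
lemma coneKernel_smul {d : ℕ} (N : ℝ) (e : Rd d) (p : ℝ) {c : ℝ} (hc : 1 ≤ c) {z : Rd d}
    (hz : 1 / 2 ≤ ‖z‖) :
    coneKernel N e p (c • z) = Real.exp (2 * p * Real.log c) * coneKernel N e p z := by
  have hc0 : 0 < c := by linarith
  have h1 : logNormSq (c • z) = 2 * Real.log c + logNormSq z := by
    rw [logNormSq_of_le hz, logNormSq_of_le, norm_smul, Real.norm_of_nonneg hc0.le, mul_pow,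
      Real.log_mul (by positivity) (by positivity), Real.log_pow]
    · push_cast; ring
    · rw [norm_smul, Real.norm_of_nonneg hc0.le]
      nlinarith
  have h2 : Real.exp (-(2 * Real.log c + logNormSq z) / 2) =
      c⁻¹ * Real.exp (-logNormSq z / 2) := by
    rw [show -(2 * Real.log c + logNormSq z) / 2 = -Real.log c + -logNormSq z / 2 by ring,
      Real.exp_add, Real.exp_neg, Real.exp_log hc0]
  rw [coneKernel, coneKernel, ← Real.exp_add, h1, h2, real_inner_smul_left]
  congr 1
  field_simp
  ring

lemma eventually_half_lt_norm {d : ℕ} {θ : Rd d} (hθ : ‖θ‖ = 1) : ∀ᶠ x in 𝓝 θ, 1 / 2 < ‖x‖ :=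
  continuous_norm.continuousAt.eventually (lt_mem_nhds (by simp only [hθ]; norm_num))

lemma contDiffAt_coneKernel {d : ℕ} (N : ℝ) (e : Rd d) (p : ℝ) {θ : Rd d} (hθ : ‖θ‖ = 1) :
    ContDiffAt ℝ ω (coneKernel N e p) θ := by
  have hL : ContDiffAt ℝ ω (logNormSq : Rd d → ℝ) θ := by
    refine ContDiffAt.congr_of_eventuallyEq (f := fun x : Rd d => Real.log (‖x‖ ^ 2)) ?_ ?_
    · exact (contDiff_norm_sq ℝ).contDiffAt.log (by rw [hθ]; norm_num)
    · filter_upwards [eventually_half_lt_norm hθ] with x hx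
      exact logNormSq_of_le hx.le
  exact (((contDiffAt_const.mul hL).add ((contDiffAt_const.mul
    (contDiffAt_id.inner ℝ contDiffAt_const)).mul (hL.neg.div_const 2).exp))).exp

lemma iteratedDeriv_two_coneKernel {d : ℕ} (N : ℝ) (e : Rd d) (p : ℝ) {θ : Rd d} (hθ : ‖θ‖ = 1)
    (y : Rd d) :
    iteratedDeriv 2 (fun t : ℝ => coneKernel N e p (θ + t • y)) 0 =
      Real.exp (N * ⟪θ, e⟫) * ((2 * p * ⟪θ, y⟫ + N * (⟪e, y⟫ - ⟪θ, e⟫ * ⟪θ, y⟫)) ^ 2 +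
        p * (2 * ‖y‖ ^ 2 - 4 * ⟪θ, y⟫ ^ 2) +
        N * (3 * ⟪θ, e⟫ * ⟪θ, y⟫ ^ 2 - 2 * (⟪e, y⟫ * ⟪θ, y⟫) - ⟪θ, e⟫ * ‖y‖ ^ 2)) := by
  set a := ⟪θ, y⟫
  set b := ‖y‖ ^ 2
  set k := ⟪e, y⟫ with hk
  set τ := ⟪θ, e⟫
  set s : ℝ → ℝ := fun t => ‖θ + t • y‖ ^ 2 with hs
  have hs0 : s 0 = 1 := by simp [hs, hθ]
  have hsd : ∀ t, HasDerivAt s (2 * a + 2 * b * t) t := hasDerivAt_norm_sq_line θ y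
  have hspos : ∀ᶠ t in 𝓝 (0 : ℝ), 1 / 4 < s t := by
    have : Continuous s := by fun_prop
    exact this.continuousAt.eventually (lt_mem_nhds (by rw [hs0]; norm_num))
  have hin : ∀ t : ℝ, ⟪θ + t • y, e⟫ = τ + t * k := fun t => by
    rw [inner_add_left, real_inner_smul_left, hk, real_inner_comm e y]
  have hind : ∀ t, HasDerivAt (fun t => τ + t * k) k t := fun t => by
    simpa using ((hasDerivAt_id t).mul_const k).const_add τ
  set l₁ : ℝ → ℝ := fun t => (2 * a + 2 * b * t) / s t with hl₁
  have hl : ∀ {t}, 1 / 4 < s t → HasDerivAt (fun t => Real.log (s t)) (l₁ t) t := fun {t} ht =>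
    (hsd t).log (by positivity)
  have hm : ∀ {t}, 1 / 4 < s t → HasDerivAt (fun t => Real.exp (-Real.log (s t) / 2))
      (Real.exp (-Real.log (s t) / 2) * (-l₁ t / 2)) t := fun {t} ht =>
    ((hl ht).neg.div_const 2).exp
  have hl₁d : HasDerivAt l₁ (2 * b - 4 * a ^ 2) 0 := by
    have h1 : HasDerivAt (fun t : ℝ => 2 * a + 2 * b * t) (2 * b) 0 := by
      simpa using ((hasDerivAt_id (0 : ℝ)).const_mul (2 * b)).const_add (2 * a)
    convert! h1.div (hsd 0) (by rw [hs0]; norm_num) using 1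
    rw [hs0]
    ring
  have hh : ∀ {t}, 1 / 4 < s t → HasDerivAt
      (fun t => p * Real.log (s t) + N * (τ + t * k) * Real.exp (-Real.log (s t) / 2))
      (p * l₁ t + (N * k * Real.exp (-Real.log (s t) / 2) +
        N * (τ + t * k) * (Real.exp (-Real.log (s t) / 2) * (-l₁ t / 2)))) t := fun {t} ht =>
    ((hl ht).const_mul p).add (((hind t).const_mul N).mul (hm ht))
  refine iteratedDeriv_two_eq (g₁ := fun t =>
    Real.exp (p * Real.log (s t) + N * (τ + t * k) * Real.exp (-Real.log (s t) / 2)) *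
      (p * l₁ t + (N * k * Real.exp (-Real.log (s t) / 2) +
        N * (τ + t * k) * (Real.exp (-Real.log (s t) / 2) * (-l₁ t / 2))))) ?_ ?_
  · filter_upwards [hspos.eventually_nhds] with t ht
    have h1 := (hh ht.self_of_nhds).exp
    refine h1.congr_of_eventuallyEq ?_
    filter_upwards [ht] with u hu
    rw [coneKernel, hin, logNormSq, max_eq_left hu.le]
  · have ht : 1 / 4 < s 0 := by rw [hs0]; norm_num
    have h2 := (hh ht).exp.mul ((hl₁d.const_mul p).add (((hm ht).const_mul (N * k)).add
      (((hind 0).const_mul N).mul ((hm ht).mul (hl₁d.neg.div_const 2)))))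
    convert! h2 using 1
    have hl0 : l₁ 0 = 2 * a := by simp [hl₁, hs0]
    simp only [Pi.mul_apply, Pi.add_apply, Pi.neg_apply, hs0, Real.log_one, hl0, zero_mul, add_zero,
      mul_zero, zero_add, neg_zero, zero_div,
      Real.exp_zero, mul_one, one_mul]
    ring

lemma IsNormalized.integral_inner {d : ℕ} {K : ConvexBody (Rd d)} (hK : IsNormalized K)
    (x z : Rd d) : ∫ y in (K : Set (Rd d)), ⟪x, y⟫ * ⟪z, y⟫ = ⟪x, z⟫ := by
  have h1 : ∀ x y : Rd d, ⟪x, y⟫ = ∑ i, x i * y i := fun x y => by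
    simp [PiLp.inner_apply, mul_comm]
  simp only [h1 _ _, Finset.sum_mul_sum]
  rw [integral_finsetSum]
  · refine Finset.sum_congr rfl fun i _ => ?_
    rw [integral_finsetSum]
    · have h2 : ∀ j, ∫ y in (K : Set (Rd d)), x i * y i * (z j * y j) =
          x i * z j * if i = j then 1 else 0 := by
        intro j
        rw [← hK i j, ← integral_const_mul]
        congr 1
        ext y
        ring
      simp [h2]
    · exact fun j _ => (Continuous.continuousOn (by fun_prop)).integrableOn_compact K.isCompact
  · exact fun j _ => (Continuous.continuousOn (by fun_prop)).integrableOn_compact K.isCompact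

lemma IsNormalized.integral_norm_sq {d : ℕ} {K : ConvexBody (Rd d)} (hK : IsNormalized K) :
    ∫ y in (K : Set (Rd d)), ‖y‖ ^ 2 = d :=
  integral_norm_sq_of_isotropic (B := ContinuousLinearMap.id ℝ (Rd d)) hK.integral_inner

/-- For a normalized body the averaged second derivative is the Laplacian: `2p (2p + d - 2)` from
the radial factor and `N² (1 - τ²) - (d-1) N τ` from the spherical Laplacian of `exp (N τ)`. -/
lemma integral_iteratedDeriv_two_coneKernel {d : ℕ} {K : ConvexBody (Rd d)} (hK : IsNormalized K)
    (N : ℝ) {e : Rd d} (he : ‖e‖ = 1) (p : ℝ) {θ : Rd d} (hθ : ‖θ‖ = 1) :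
    ∫ y in (K : Set (Rd d)), iteratedDeriv 2 (fun t : ℝ => coneKernel N e p (θ + t • y)) 0 =
      Real.exp (N * ⟪θ, e⟫) * (2 * p * (d - 2) + 4 * p ^ 2 +
        N ^ 2 * (1 - ⟪θ, e⟫ ^ 2) - (d - 1) * N * ⟪θ, e⟫) := by
  set τ := ⟪θ, e⟫ with hτ
  have hI : ∀ x z : Rd d, IntegrableOn (fun y : Rd d => ⟪x, y⟫ * ⟪z, y⟫) K volume := fun x z =>
    (Continuous.continuousOn (by fun_prop)).integrableOn_compact K.isCompact
  have hI2 : IntegrableOn (fun y : Rd d => ‖y‖ ^ 2) K volume :=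
    (Continuous.continuousOn (by fun_prop)).integrableOn_compact K.isCompact
  have h1 : ∀ y, iteratedDeriv 2 (fun t : ℝ => coneKernel N e p (θ + t • y)) 0 =
      Real.exp (N * τ) * (((2 * p - N * τ) ^ 2 - 4 * p + 3 * N * τ) * (⟪θ, y⟫ * ⟪θ, y⟫) +
        (2 * (2 * p - N * τ) * N - 2 * N) * (⟪θ, y⟫ * ⟪e, y⟫) + N ^ 2 * (⟪e, y⟫ * ⟪e, y⟫) +
        (2 * p - N * τ) * ‖y‖ ^ 2) := by
    intro y
    rw [iteratedDeriv_two_coneKernel N e p hθ]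
    ring
  simp only [h1]
  rw [integral_const_mul, integral_add, integral_add, integral_add, integral_const_mul,
    integral_const_mul, integral_const_mul, integral_const_mul, hK.integral_inner,
    hK.integral_inner, hK.integral_inner, hK.integral_norm_sq, real_inner_self_eq_norm_sq,
    real_inner_self_eq_norm_sq, hθ, he, ← hτ]
  · ring
  · exact (hI _ _).const_mul _
  · exact (hI _ _).const_mul _
  · exact ((hI _ _).const_mul _).add ((hI _ _).const_mul _)
  · exact (hI _ _).const_mul _
  · exact (((hI _ _).const_mul _).add ((hI _ _).const_mul _)).add ((hI _ _).const_mul _)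
  · exact hI2.const_mul _

lemma coneKernel_zero_eventuallyEq {d : ℕ} (e : Rd d) (p : ℝ) {θ : Rd d} (hθ : ‖θ‖ = 1) :
    coneKernel 0 e p =ᶠ[𝓝 θ] fun x => (‖x‖ ^ 2) ^ p := by
  filter_upwards [eventually_half_lt_norm hθ] with x hx
  have : 0 < ‖x‖ := by linarith
  rw [coneKernel, logNormSq_of_le hx.le, Real.rpow_def_of_pos (by positivity)]
  congr 1
  ring

/-- Where the zonal fourth moment is positive, averages of the Green's function over small copies
of the body exceed its value at the center. -/
lemma eventually_lt_coneKernel_zero {d : ℕ} (hd : 3 ≤ d) {K : ConvexBody (Rd d)}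
    (hK : IsSymmetricBody K) (hKn : IsNormalized K) {e : Rd d} (he : ‖e‖ = 1)
    (hpos : 0 < ∫ y in (K : Set (Rd d)), zonalQuartic e y) :
    ∀ᶠ r : ℝ in 𝓝[>] 0, volume.real (K : Set (Rd d)) * coneKernel 0 e ((2 - d : ℝ) / 2) e <
      ∫ y in (K : Set (Rd d)), coneKernel 0 e ((2 - d : ℝ) / 2) (e + r • y) := by
  have hd3 : (3 : ℝ) ≤ d := by exact_mod_cast hd
  have hne : e ≠ 0 := fun h => by simp [h] at he
  refine (contDiffAt_coneKernel 0 e _ he).eventually_lt_of_fourth hK ?_ ?_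
  -- The second-order term vanishes since `|x|^(2-d)` is harmonic.
  · rw [integral_iteratedDeriv_two_coneKernel hKn 0 he _ he]
    ring
  · have h4 : ∀ y, iteratedDeriv 4
        (fun t : ℝ => coneKernel 0 e ((2 - d : ℝ) / 2) (e + t • y)) 0 =
        d * (d - 2) * zonalQuartic e y := by
      intro y
      have hc : Tendsto (fun t : ℝ => e + t • y) (𝓝 0) (𝓝 e) := by
        have : Continuous (fun t : ℝ => e + t • y) := by fun_prop
        simpa using this.tendsto 0
      have h5 := iteratedDeriv_four_norm_rpow hne y
      rw [he, one_pow, Real.one_rpow, mul_one] at h5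
      rw [← h5]
      exact Filter.EventuallyEq.iteratedDeriv_eq 4
        (hc.eventually (coneKernel_zero_eventuallyEq e _ he))
    simp only [h4, integral_const_mul]
    have : 0 < (d : ℝ) - 2 := by linarith
    positivity

/-- A function that is close to the Green's function but decays more slowly; it is subharmonic
outside of a cone around `e`. -/
def coneBarrier {d : ℕ} (N : ℝ) (e : Rd d) (ε : ℝ) (x : Rd d) : ℝ :=
  coneKernel 0 e ((2 - d + ε) / 2) x +
    ε * (d * Real.exp N) * coneKernel N e ((2 - d + ε) / 2) x

lemma continuous_coneBarrier {d : ℕ} (N : ℝ) (e : Rd d) :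
    Continuous fun q : ℝ × Rd d => coneBarrier N e q.1 q.2 := by
  have h : ∀ N : ℝ, Continuous fun q : ℝ × Rd d => coneKernel N e ((2 - d + q.1) / 2) q.2 :=
    fun N => (continuous_coneKernel N e).comp (by fun_prop :
      Continuous fun q : ℝ × Rd d => ((2 - d + q.1) / 2, q.2))
  exact (h 0).add ((by fun_prop : Continuous fun q : ℝ × Rd d => q.1 * (d * Real.exp N)).mul (h N))

/-- Away from `e` the spherical Laplacian of `exp (N τ)` is at least `N`. The factor `ε d exp N`
makes the second summand contribute at least `ε d`, more than the deficit `ε (d - 2 - ε)` of the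
radial summand. -/
lemma eventually_lt_coneBarrier {d : ℕ} {K : ConvexBody (Rd d)}
    (hK : IsSymmetricBody K) (hKn : IsNormalized K) {e : Rd d} (he : ‖e‖ = 1) {N ε η : ℝ}
    (hN : 2 ≤ N) (hNη : (d : ℝ) ≤ N * η) (hd : 3 ≤ d) (hε : 0 < ε) (hεd : ε * (d - 2) ≤ 1)
    (hε1 : ε < 1) {θ : Rd d} (hθ : ‖θ‖ = 1) (hθe : ⟪θ, e⟫ ≤ 1 - η) :
    ∀ᶠ r : ℝ in 𝓝[>] 0, volume.real (K : Set (Rd d)) * coneBarrier N e ε θ <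
      ∫ y in (K : Set (Rd d)), coneBarrier N e ε (θ + r • y) := by
  have hd3 : (3 : ℝ) ≤ d := by exact_mod_cast hd
  set p : ℝ := (2 - d + ε) / 2 with hp
  set C : ℝ := ε * (d * Real.exp N) with hC
  have hs0 := contDiffAt_coneKernel 0 e p hθ
  have hs1 := contDiffAt_coneKernel N e p hθ
  have hsm : ContDiffAt ℝ ω (coneBarrier N e ε) θ := hs0.add (contDiffAt_const.mul hs1)
  refine hsm.eventually_lt_of_second hK ?_
  have hline : ∀ y : Rd d, ContDiffAt ℝ ω (fun t : ℝ => θ + t • y) 0 := fun y =>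
    contDiffAt_const.add (contDiffAt_id.smul contDiffAt_const)
  have h2 : ∀ y, iteratedDeriv 2 (fun t : ℝ => coneBarrier N e ε (θ + t • y)) 0 =
      iteratedDeriv 2 (fun t : ℝ => coneKernel 0 e p (θ + t • y)) 0 +
        C * iteratedDeriv 2 (fun t : ℝ => coneKernel N e p (θ + t • y)) 0 := by
    intro y
    have c0 : ContDiffAt ℝ 2 (fun t : ℝ => coneKernel 0 e p (θ + t • y)) 0 :=
      (ContDiffAt.comp (0 : ℝ) (by simpa using hs0) (hline y)).of_le (by simp)
    have c1 : ContDiffAt ℝ 2 (fun t : ℝ => coneKernel N e p (θ + t • y)) 0 :=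
      (ContDiffAt.comp (0 : ℝ) (by simpa using hs1) (hline y)).of_le (by simp)
    rw [← iteratedDeriv_const_mul_field, ← iteratedDeriv_add c0 (contDiffAt_const.mul c1)]
    rfl
  have hcont : ∀ N : ℝ, IntegrableOn
      (fun y => iteratedDeriv 2 (fun t : ℝ => coneKernel N e p (θ + t • y)) 0) K volume := by
    intro N
    simp only [iteratedDeriv_two_coneKernel N e p hθ]
    exact (Continuous.continuousOn (by fun_prop)).integrableOn_compact K.isCompact
  simp only [h2]
  rw [integral_add (hcont 0) ((hcont N).const_mul C), integral_const_mul,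
    integral_iteratedDeriv_two_coneKernel hKn 0 he p hθ,
    integral_iteratedDeriv_two_coneKernel hKn N he p hθ]
  set τ := ⟪θ, e⟫
  have hτ : |τ| ≤ 1 := by
    have := abs_real_inner_le_norm θ e
    rwa [hθ, he, mul_one] at this
  obtain ⟨hτ1, hτ2⟩ := abs_le.1 hτ
  have hpp : 2 * p * (d - 2) + 4 * p ^ 2 = -((d - 2 - ε) * ε) := by rw [hp]; ring
  have hαε : (d - 2 - ε) * ε ≤ 1 := by nlinarith
  have hbr : 1 ≤ -((d - 2 - ε) * ε) + N ^ 2 * (1 - τ ^ 2) - (d - 1) * N * τ := by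
    have : N ≤ N ^ 2 * (1 - τ ^ 2) - (d - 1) * N * τ := by
      -- For `τ ≥ 0`, the gap `1 - τ ≥ η` and `N η ≥ d` beat the negative term; for `τ < 0` that
      -- term has the good sign, and `N ≥ 2` suffices.
      rcases le_or_gt 0 τ with h | h
      · have e1 : N * η ≤ N * (1 - τ) := mul_le_mul_of_nonneg_left (by linarith) (by linarith)
        have e2 : N * (1 - τ) ≤ N * (1 - τ ^ 2) := by
          refine mul_le_mul_of_nonneg_left ?_ (by linarith)
          nlinarith
        have e3 : N * d ≤ N * (N * (1 - τ ^ 2)) :=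
          mul_le_mul_of_nonneg_left (by linarith) (by linarith)
        have e4 : (d - 1) * N * τ ≤ (d - 1) * N * 1 :=
          mul_le_mul_of_nonneg_left hτ2 (mul_nonneg (by linarith) (by linarith))
        nlinarith
      · have e1 : N * (1 + τ) ≤ N ^ 2 * (1 - τ ^ 2) := by
          have : N * (1 + τ) * 1 ≤ N * (1 + τ) * (N * (1 - τ)) :=
            mul_le_mul_of_nonneg_left (by nlinarith) (mul_nonneg (by linarith) (by linarith))
          nlinarith
        have e2 : N * -τ * 1 ≤ N * -τ * (d - 1) :=
          mul_le_mul_of_nonneg_left (by linarith) (mul_nonneg (by linarith) (by linarith))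
        nlinarith
    linarith
  have hexp : d ≤ d * Real.exp N * Real.exp (N * τ) := by
    rw [mul_assoc, ← Real.exp_add]
    refine le_mul_of_one_le_right (by linarith) (Real.one_le_exp ?_)
    nlinarith
  rw [hpp]
  simp only [zero_mul, Real.exp_zero, one_mul, mul_zero, sub_zero, ne_eq, OfNat.ofNat_ne_zero,
    not_false_eq_true, zero_pow, add_zero]
  have h5 : ε * d ≤ C * Real.exp (N * τ) := by
    rw [hC, mul_assoc]
    exact mul_le_mul_of_nonneg_left hexp hε.le
  have h6 : ε * d ≤ C * (Real.exp (N * τ) *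
      (-((d - 2 - ε) * ε) + N ^ 2 * (1 - τ ^ 2) - (d - 1) * N * τ)) := by
    rw [← mul_assoc]
    refine h5.trans (le_mul_of_one_le_right ?_ hbr)
    have : 0 < ε * d := by positivity
    linarith
  nlinarith

/-- The order of choices is the point: a scale `r₀` with a gain at `e`, a cone where the gain
persists for the Green's function, then `N` for the complement of the cone, and last `ε`, small
enough by compactness to keep the gain in the cone. -/
lemma exists_coneBarrier {d : ℕ} (hd : 3 ≤ d) {K : ConvexBody (Rd d)}
    (hK : IsSymmetricBody K) (hKn : IsNormalized K) {e : Rd d} (he : ‖e‖ = 1)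
    (hpos : 0 < ∫ y in (K : Set (Rd d)), zonalQuartic e y) :
    ∃ N ε : ℝ, 0 < N ∧ 0 < ε ∧ ε < 1 ∧ ∀ x : Rd d, 1 < ‖x‖ → ∃ r : ℝ, 0 < r ∧
      volume.real (K : Set (Rd d)) * coneBarrier N e ε x <
        ∫ y in (K : Set (Rd d)), coneBarrier N e ε (x + r • y) := by
  have hd3 : (3 : ℝ) ≤ d := by exact_mod_cast hd
  obtain ⟨M, hM0, hM⟩ := K.isCompact.isBounded.exists_pos_norm_le
  have hsmall : ∀ᶠ r : ℝ in 𝓝[>] 0, r < 1 / 2 / M :=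
    nhdsWithin_le_nhds (Iio_mem_nhds (by positivity))
  obtain ⟨r₀, ⟨hgain, hr₀M⟩, hr₀ : 0 < r₀⟩ :=
    (((eventually_lt_coneKernel_zero hd hK hKn he hpos).and hsmall).and self_mem_nhdsWithin).exists
  set p₀ : ℝ := (2 - d : ℝ) / 2 with hp₀
  have hbar0 : ∀ N z, coneBarrier N e 0 z = coneKernel 0 e p₀ z := fun N z => by
    simp [coneBarrier, hp₀]
  let Γ : ℝ → ℝ × Rd d → ℝ := fun N q => (∫ y in (K : Set (Rd d)),
    coneBarrier N e q.1 (q.2 + r₀ • y)) - volume.real (K : Set (Rd d)) * coneBarrier N e q.1 q.2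
  have hΓc : ∀ N, Continuous (Γ N) := by
    intro N
    refine Continuous.sub ?_ (continuous_const.mul (continuous_coneBarrier N e))
    refine continuous_parametric_integral_of_continuous
      (f := fun (q : ℝ × Rd d) (y : Rd d) => coneBarrier N e q.1 (q.2 + r₀ • y)) ?_ K.isCompact
    exact (continuous_coneBarrier N e).comp (by fun_prop :
      Continuous fun q : (ℝ × Rd d) × Rd d => (q.1.1, q.1.2 + r₀ • q.2))
  -- At `ε = 0` the barrier does not depend on `N`, so the cone can be fixed before `N` without
  -- circularity.
  have hΓ0 : ∀ N θ, Γ N (0, θ) = Γ 0 (0, θ) := fun N θ => by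
    simp only [Γ, hbar0]
  have hΓe : 0 < Γ 0 (0, e) := by
    simp only [Γ, hbar0]
    linarith
  obtain ⟨δ, hδ, hball⟩ := Metric.eventually_nhds_iff_ball.1
    (((hΓc 0).comp (by fun_prop : Continuous fun θ : Rd d => ((0 : ℝ), θ))).continuousAt.eventually
      (lt_mem_nhds hΓe))
  -- On the unit sphere `‖θ - e‖² = 2 - 2⟪θ,e⟫`, so this cap lies in the ball of radius `δ`.
  set η : ℝ := δ ^ 2 / 4 with hη
  have hη0 : 0 < η := by positivity
  set N : ℝ := max 2 (d / η) with hN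
  have hN2 : 2 ≤ N := le_max_left _ _
  have hNη : (d : ℝ) ≤ N * η := by
    rw [← div_le_iff₀ hη0]
    exact le_max_right _ _
  set S : Set (Rd d) := {θ | ‖θ‖ = 1 ∧ 1 - η ≤ ⟪θ, e⟫} with hS
  have hScomp : IsCompact S := by
    refine Metric.isCompact_of_isClosed_isBounded ?_ ?_
    · exact (isClosed_eq continuous_norm continuous_const).inter
        (isClosed_le continuous_const
          (by fun_prop : Continuous fun θ : Rd d => ⟪θ, e⟫))
    · exact (Metric.isBounded_closedBall (x := (0 : Rd d)) (r := 1)).subset fun θ hθ => by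
        simpa using hθ.1.le
  have hSpos : ∀ θ ∈ S, 0 < Γ N (0, θ) := by
    intro θ hθ
    rw [hΓ0]
    refine hball θ ?_
    rw [Metric.mem_ball, dist_eq_norm]
    have h1 : ‖θ - e‖ ^ 2 ≤ 2 * η := by
      rw [norm_sub_sq_real, hθ.1, he]
      linarith [hθ.2]
    refine lt_of_pow_lt_pow_left₀ 2 hδ.le (h1.trans_lt ?_)
    rw [hη]
    linarith [sq_pos_of_pos hδ]
  have htube : ∀ᶠ ε in 𝓝 (0 : ℝ), ∀ θ ∈ S, 0 < Γ N (ε, θ) :=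
    hScomp.eventually_forall_of_forall_eventually fun θ hθ =>
      (hΓc N).continuousAt.eventually (lt_mem_nhds (hSpos θ hθ))
  have hε' : ∀ᶠ ε : ℝ in 𝓝[>] 0, ε < 1 / d :=
    nhdsWithin_le_nhds (Iio_mem_nhds (by positivity))
  obtain ⟨ε, ⟨hεS, hεd⟩, hε0 : 0 < ε⟩ :=
    (((htube.filter_mono nhdsWithin_le_nhds).and hε').and self_mem_nhdsWithin).exists
  rw [lt_div_iff₀ (by positivity)] at hεd
  have hε1 : ε < 1 := by nlinarith
  refine ⟨N, ε, by linarith, hε0, hε1, ?_⟩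
  -- The bound on `r` keeps `θ + r • y` at norm at least `1 / 2`, outside the truncation, so that
  -- the inequality can be rescaled to every `x` of norm greater than 1.
  have hunit : ∀ θ : Rd d, ‖θ‖ = 1 → ∃ r : ℝ, 0 < r ∧ r < 1 / 2 / M ∧
      volume.real (K : Set (Rd d)) * coneBarrier N e ε θ <
        ∫ y in (K : Set (Rd d)), coneBarrier N e ε (θ + r • y) := by
    intro θ hθ
    by_cases h : 1 - η ≤ ⟪θ, e⟫
    · refine ⟨r₀, hr₀, hr₀M, ?_⟩
      have := hεS θ ⟨hθ, h⟩
      simp only [Γ] at this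
      linarith
    · obtain ⟨r, ⟨h1, h2⟩, h3⟩ := (((eventually_lt_coneBarrier hK hKn he hN2 hNη hd hε0
        (by nlinarith) hε1 hθ (not_le.1 h).le).and hsmall).and self_mem_nhdsWithin).exists
      exact ⟨r, h3, h2, h1⟩
  intro x hx
  have hx0 : 0 < ‖x‖ := by linarith
  obtain ⟨r, hr, hrM, hlt⟩ := hunit (‖x‖⁻¹ • x) (by
    rw [norm_smul, norm_inv, norm_norm, inv_mul_cancel₀ hx0.ne'])
  refine ⟨‖x‖ * r, by positivity, ?_⟩
  have hhom : ∀ z : Rd d, 1 / 2 ≤ ‖z‖ → coneBarrier N e ε (‖x‖ • z) =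
      Real.exp (2 * ((2 - d + ε) / 2) * Real.log ‖x‖) * coneBarrier N e ε z := by
    intro z hz
    rw [coneBarrier, coneKernel_smul 0 e _ hx.le hz, coneKernel_smul N e _ hx.le hz, coneBarrier]
    ring
  have hnorm : ‖‖x‖⁻¹ • x‖ = 1 := by
    rw [norm_smul, norm_inv, norm_norm, inv_mul_cancel₀ hx0.ne']
  have e1 : coneBarrier N e ε x = Real.exp (2 * ((2 - d + ε) / 2) * Real.log ‖x‖) *
      coneBarrier N e ε (‖x‖⁻¹ • x) := by
    rw [← hhom _ (by rw [hnorm]; norm_num), smul_inv_smul₀ hx0.ne']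
  have e2 : ∫ y in (K : Set (Rd d)), coneBarrier N e ε (x + (‖x‖ * r) • y) =
      Real.exp (2 * ((2 - d + ε) / 2) * Real.log ‖x‖) *
        ∫ y in (K : Set (Rd d)), coneBarrier N e ε (‖x‖⁻¹ • x + r • y) := by
    rw [← integral_const_mul]
    refine setIntegral_congr_fun K.measurableSet fun y hy => ?_
    have hz : 1 / 2 ≤ ‖‖x‖⁻¹ • x + r • y‖ := by
      have h1 : ‖r • y‖ ≤ 1 / 2 := by
        rw [norm_smul, Real.norm_of_nonneg hr.le]
        rw [lt_div_iff₀ hM0] at hrM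
        exact (mul_le_mul_of_nonneg_left (hM y hy) hr.le).trans hrM.le
      have h2 := norm_sub_le (‖x‖⁻¹ • x + r • y) (r • y)
      rw [add_sub_cancel_right, hnorm] at h2
      linarith
    rw [← hhom _ hz, smul_add, smul_inv_smul₀ hx0.ne', smul_smul]
  rw [e1, e2, mul_left_comm]
  exact mul_lt_mul_of_pos_left hlt (Real.exp_pos _)

lemma coneBarrier_le {d : ℕ} {N ε : ℝ} (hN : 0 < N) (hε : 0 < ε) {e : Rd d} (he : ‖e‖ = 1)
    (x : Rd d) : coneBarrier N e ε x ≤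
      (1 + ε * (d * Real.exp N) * Real.exp N) * Real.exp ((2 - d + ε) / 2 * logNormSq x) := by
  have h1 : ⟪x, e⟫ * Real.exp (-logNormSq x / 2) ≤ 1 := by
    rw [neg_div, Real.exp_neg, ← div_eq_mul_inv, div_le_one (Real.exp_pos _)]
    have h2 : ⟪x, e⟫ ≤ ‖x‖ := by
      have := real_inner_le_norm x e
      rwa [he, mul_one] at this
    refine h2.trans (le_of_sq_le_sq ?_ (Real.exp_pos _).le)
    rw [← Real.exp_nat_mul]
    push_cast
    rw [mul_div_cancel₀ _ (two_ne_zero), logNormSq, Real.exp_log (by positivity)]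
    exact le_max_left _ _
  have h3 : coneKernel N e ((2 - d + ε) / 2) x ≤
      Real.exp N * Real.exp ((2 - d + ε) / 2 * logNormSq x) := by
    rw [coneKernel, Real.exp_add, mul_comm]
    refine mul_le_mul_of_nonneg_right (Real.exp_le_exp.2 ?_) (Real.exp_pos _).le
    rw [mul_assoc]
    exact mul_le_of_le_one_right hN.le h1
  have h4 : coneKernel 0 e ((2 - d + ε) / 2) x = Real.exp ((2 - d + ε) / 2 * logNormSq x) := by
    simp [coneKernel]
  have h5 := mul_le_mul_of_nonneg_left h3 (show 0 ≤ ε * (d * Real.exp N) by positivity)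
  rw [coneBarrier, h4]
  linarith

lemma exists_exponent_of_fourthMoment {d : ℕ} (hd : 3 ≤ d) {K : ConvexBody (Rd d)}
    (hK : IsSymmetricBody K) (hKn : IsNormalized K) {x₀ : Rd d}
    (h : ∫ y in (K : Set (Rd d)), zonalQuartic x₀ y ≠ 0) :
    ∃ q : ℝ, (d : ℝ) / ((d : ℝ) - 2) < q ∧ ∀ p : ℝ, 1 ≤ p → p ≤ q →
      ∀ f : Rd d → ℝ, MemLp f (ENNReal.ofReal p) volume →
        IsMaximalFixedPoint K f → f =ᵐ[volume] 0 := by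
  have hd3 : (3 : ℝ) ≤ d := by exact_mod_cast hd
  obtain ⟨e, he, hpos⟩ := exists_integral_zonalQuartic_pos K h
  obtain ⟨N, ε, hN, hε, hε1, hbar⟩ := exists_coneBarrier hd hK hKn he hpos
  have hα : 0 < (d : ℝ) - 2 - ε := by linarith
  -- The critical exponent for a lower bound decaying like `|x|^(-(d - 2 - ε))`.
  refine ⟨d / (d - 2 - ε), ?_, ?_⟩
  · exact div_lt_div_of_pos_left (by linarith) hα (by linarith)
  intro p hp hpq f hf hfix
  set g := hf.1.mk f
  have hfg : f =ᵐ[volume] g := hf.1.ae_eq_mk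
  have hgm : Measurable g := hf.1.stronglyMeasurable_mk.measurable
  have hg : MemLp g (ENNReal.ofReal p) volume := hf.ae_eq hfg
  have hloc : LocallyIntegrable g volume := hg.locallyIntegrable (by simpa using hp)
  have hsup : AESuperAverage K g := (hfix.aeSuperAverage hK).congr hfg
  have hnn := hsup.nonneg_of_memLp (by omega) hK hp hg
  refine hfg.trans ?_
  by_contra hne
  obtain ⟨c, hc, hcg⟩ := hsup.exists_pos_le_ball hK hloc hnn hne (1 + 1)
  set A : ℝ := (1 + ε * (d * Real.exp N) * Real.exp N) with hA
  have hA0 : 0 < A := by positivity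
  -- The exponent of the norm is negative, so the upper envelope of the barrier is largest where the
  -- truncated squared norm equals `1 / 4`; dividing by `D` makes the barrier at most 1.
  set D : ℝ := A * Real.exp ((2 - d + ε) / 2 * Real.log (1 / 4)) with hD
  have hD0 : 0 < D := by positivity
  have hwpos : ∀ x, 0 ≤ coneBarrier N e ε x := fun x =>
    add_nonneg (coneKernel_pos _ _ _ _).le (mul_nonneg (by positivity) (coneKernel_pos _ _ _ _).le)
  have hlow := hsup.ae_ge_of_strict_sub (w := fun x => D⁻¹ * coneBarrier N e ε x) hgm hloc hnn hc
    hcg ?_ ?_ ?_ ?_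
  · refine not_memLp_of_ge_rpow_neg (by omega) hp (b := 1) (α := (d : ℝ) - 2 - ε) (c := c * D⁻¹)
      one_pos (by positivity) ?_ ?_ hg
    · rwa [le_div_iff₀ hα, mul_comm] at hpq
    · filter_upwards [hlow] with x hx
      refine le_trans ?_ hx
      rw [mul_assoc, one_mul]
      refine mul_le_mul_of_nonneg_left (mul_le_mul_of_nonneg_left ?_ (by positivity)) hc.le
      have h1 : coneKernel 0 e ((2 - d + ε) / 2) x ≤ coneBarrier N e ε x :=
        le_add_of_nonneg_right (mul_nonneg (by positivity) (coneKernel_pos _ _ _ _).le)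
      refine le_trans ?_ h1
      have hm : 0 < max ‖x‖ 1 := by positivity
      rw [coneKernel, Real.rpow_def_of_pos hm]
      refine Real.exp_le_exp.2 ?_
      have h2 : logNormSq x ≤ 2 * Real.log (max ‖x‖ 1) := by
        rw [logNormSq, show 2 * Real.log (max ‖x‖ 1) = Real.log ((max ‖x‖ 1) ^ 2) by
          rw [Real.log_pow]; norm_num]
        refine Real.log_le_log (by positivity) (max_le ?_ ?_)
        · exact pow_le_pow_left₀ (norm_nonneg _) (le_max_left _ _) 2
        · exact le_trans (by norm_num) (one_le_pow₀ (le_max_right _ _))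
      nlinarith
  · exact continuous_const.mul ((continuous_coneBarrier N e).comp
      (by fun_prop : Continuous fun x : Rd d => (ε, x)))
  · intro x
    rw [inv_mul_le_iff₀ hD0, mul_one]
    refine (coneBarrier_le hN hε he x).trans ?_
    refine mul_le_mul_of_nonneg_left (Real.exp_le_exp.2 ?_) hA0.le
    refine mul_le_mul_of_nonpos_left ?_ (by linarith)
    exact Real.log_le_log (by norm_num) (le_max_right _ _)
  · have hlim : Tendsto (fun x : Rd d => D⁻¹ * (A * Real.exp ((2 - d + ε) / 2 * logNormSq x)))
        (cocompact (Rd d)) (𝓝 (D⁻¹ * (A * 0))) := by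
      refine ((Real.tendsto_exp_atBot.comp ?_).const_mul A).const_mul D⁻¹
      refine Tendsto.const_mul_atTop_of_neg (by linarith) ?_
      refine Real.tendsto_log_atTop.comp (tendsto_atTop_mono (fun z => le_max_left _ _) ?_)
      exact (tendsto_pow_atTop two_ne_zero).comp tendsto_norm_cocompact_atTop
    rw [mul_zero, mul_zero] at hlim
    refine squeeze_zero (fun x => mul_nonneg (by positivity) (hwpos x)) (fun x => ?_) hlim
    exact mul_le_mul_of_nonneg_left (coneBarrier_le hN hε he x) (by positivity)
  · intro x hx
    obtain ⟨r, hr, hlt⟩ := hbar x hx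
    refine ⟨r, hr, ?_⟩
    rw [integral_const_mul, mul_left_comm]
    exact mul_lt_mul_of_pos_left hlt (by positivity)

/-! ### Hausdorff continuity of integrals and openness. -/

lemma ConvexBody.exists_dist_lt {d : ℕ} {K L : ConvexBody (Rd d)} {r : ℝ} (h : dist K L < r)
    {x : Rd d} (hx : x ∈ (K : Set (Rd d))) : ∃ y ∈ (L : Set (Rd d)), dist x y < r :=
  Metric.exists_dist_lt_of_hausdorffDist_lt hx (by rwa [ConvexBody.hausdorffDist_coe])
    ConvexBody.hausdorffEDist_ne_top

/-- If `x` were outside `L`, moving it by `s < η` directly away from its projection on `L` would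
give a point of `K` at distance more than `s` from `L`. -/
lemma ConvexBody.mem_of_ball_subset {d : ℕ} {K L : ConvexBody (Rd d)} {x : Rd d} {η : ℝ}
    (hball : Metric.ball x η ⊆ (K : Set (Rd d))) (h : dist K L < η) :
    x ∈ (L : Set (Rd d)) := by
  by_contra hx
  obtain ⟨p, hp, hpmin⟩ := exists_norm_eq_iInf_of_complete_convex L.nonempty
    L.isCompact.isComplete L.convex x
  have hinner := (norm_eq_iInf_iff_real_inner_le_zero L.convex hp).1 hpmin
  have hxp : x - p ≠ 0 := fun h0 => hx (by rwa [sub_eq_zero.1 h0])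
  have hxp' : 0 < ‖x - p‖ := norm_pos_iff.2 hxp
  obtain ⟨s, hs1, hs2⟩ := exists_between h
  have hs0 : 0 < s := dist_nonneg.trans_lt hs1
  set u : Rd d := ‖x - p‖⁻¹ • (x - p) with hu
  have hun : ‖u‖ = 1 := by rw [hu, norm_smul, norm_inv, norm_norm, inv_mul_cancel₀ hxp'.ne']
  have hz : x + s • u ∈ (K : Set (Rd d)) := hball (by
    rw [Metric.mem_ball, dist_eq_norm, add_sub_cancel_left, norm_smul, hun, mul_one,
      Real.norm_of_nonneg hs0.le]
    exact hs2)
  obtain ⟨w, hw, hdist⟩ := ConvexBody.exists_dist_lt hs1 hz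
  have h1 : ⟪x + s • u - w, u⟫ ≤ ‖x + s • u - w‖ := by
    have := real_inner_le_norm (x + s • u - w) u
    rwa [hun, mul_one] at this
  have h2 : ⟪x + s • u - w, u⟫ = ‖x - p‖ + s - ‖x - p‖⁻¹ * ⟪x - p, w - p⟫ := by
    have : x + s • u - w = (x - p) + s • u - (w - p) := by abel
    rw [this, inner_sub_left, inner_add_left, real_inner_smul_left, real_inner_self_eq_norm_sq,
      hun, hu, real_inner_smul_right, real_inner_smul_right, real_inner_self_eq_norm_sq,
      real_inner_comm]
    field_simp
  have h3 : ‖x - p‖⁻¹ * ⟪x - p, w - p⟫ ≤ 0 :=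
    mul_nonpos_of_nonneg_of_nonpos (by positivity) (hinner w hw)
  rw [dist_eq_norm] at hdist
  linarith

/-- Dominated convergence: indicators of nearby bodies are eventually constant at each point off the
frontier of `K`, which is null by convexity. -/
lemma ConvexBody.continuousAt_setIntegral {d : ℕ} (K : ConvexBody (Rd d)) {g : Rd d → ℝ}
    (hg : Continuous g) :
    ContinuousAt (fun L : ConvexBody (Rd d) => ∫ y in (L : Set (Rd d)), g y) K := by
  have hind : ∀ L : ConvexBody (Rd d), ∫ y in (L : Set (Rd d)), g y =
      ∫ y, (L : Set (Rd d)).indicator g y := fun L => (integral_indicator L.measurableSet).symm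
  simp only [ContinuousAt, hind]
  have hcomp : IsCompact (Metric.cthickening 1 (K : Set (Rd d))) := K.isCompact.cthickening
  refine tendsto_integral_filter_of_dominated_convergence
    (fun y => (Metric.cthickening 1 (K : Set (Rd d))).indicator (fun y => ‖g y‖) y) ?_ ?_ ?_ ?_
  · exact Eventually.of_forall fun L => hg.aestronglyMeasurable.indicator L.measurableSet
  · filter_upwards [Metric.ball_mem_nhds K one_pos] with L hL
    refine Eventually.of_forall fun y => ?_
    rw [norm_indicator_eq_indicator_norm]
    refine Set.indicator_le_indicator_of_subset (fun z hz => ?_) (fun z => norm_nonneg _) y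
    obtain ⟨w, hw, hdist⟩ := ConvexBody.exists_dist_lt hL hz
    exact Metric.mem_cthickening_of_dist_le z w 1 _ hw hdist.le
  · rw [integrable_indicator_iff hcomp.measurableSet]
    exact hg.norm.continuousOn.integrableOn_compact hcomp
  · have hfr : ∀ᵐ y : Rd d, y ∉ frontier (K : Set (Rd d)) :=
      measure_eq_zero_iff_ae_notMem.1 (K.convex.addHaar_frontier volume)
    filter_upwards [hfr] with y hy
    refine tendsto_const_nhds.congr' ?_
    by_cases hyK : y ∈ (K : Set (Rd d))
    · have hyi : y ∈ interior (K : Set (Rd d)) := by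
        by_contra h
        exact hy ⟨subset_closure hyK, h⟩
      obtain ⟨η, hη, hball⟩ := Metric.isOpen_iff.1 isOpen_interior y hyi
      filter_upwards [Metric.ball_mem_nhds K hη] with L hL
      have hyL := ConvexBody.mem_of_ball_subset (hball.trans interior_subset)
        (by rwa [Metric.mem_ball, dist_comm] at hL : dist K L < η)
      rw [Set.indicator_of_mem hyK, Set.indicator_of_mem hyL]
    · obtain ⟨η, hη, hball⟩ := Metric.isOpen_iff.1 K.isClosed.isOpen_compl y hyK
      filter_upwards [Metric.ball_mem_nhds K hη] with L hL
      have hyL : y ∉ (L : Set (Rd d)) := fun hyL => by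
        obtain ⟨w, hw, hdist⟩ := ConvexBody.exists_dist_lt hL hyL
        exact hball (by rwa [Metric.mem_ball, dist_comm]) hw
      rw [Set.indicator_of_notMem hyK, Set.indicator_of_notMem hyL]

lemma isOpen_fourthMomentCondition {d : ℕ} (hd : 3 ≤ d) {x₀ : Rd d} (hx₀ : x₀ ≠ 0) :
    IsOpen {K : NormalizedBody d | FourthMomentCondition x₀ K.1} := by
  have hq : Continuous fun y : Rd d => zonalQuartic x₀ y := by
    unfold zonalQuartic
    fun_prop
  have hc : Continuous fun K : NormalizedBody d =>
      ∫ y in (K.1 : Set (Rd d)), zonalQuartic x₀ y :=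
    continuous_iff_continuousAt.2 fun K =>
      (K.1.continuousAt_setIntegral hq).tendsto.comp (continuous_subtype_val.tendsto K)
  have hset : {K : NormalizedBody d | FourthMomentCondition x₀ K.1} =
      (fun K : NormalizedBody d => ∫ y in (K.1 : Set (Rd d)), zonalQuartic x₀ y) ⁻¹' {0}ᶜ := by
    ext K
    exact fourthMomentCondition_iff hd hx₀ K.1
  rw [hset]
  exact isOpen_compl_singleton.preimage hc

/-! ### Linear images and normalization. -/

/-- The image of a convex body under a linear map. -/
def ConvexBody.mapCLM {d : ℕ} (A : Rd d →L[ℝ] Rd d) (K : ConvexBody (Rd d)) :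
    ConvexBody (Rd d) where
  carrier := A '' K
  convex' := K.convex.linear_image A.toLinearMap
  isCompact' := K.isCompact.image A.continuous
  nonempty' := K.nonempty.image A

lemma ConvexBody.coe_mapCLM {d : ℕ} (A : Rd d →L[ℝ] Rd d) (K : ConvexBody (Rd d)) :
    (K.mapCLM A : Set (Rd d)) = A '' K := rfl

lemma IsSymmetricBody.mapCLM {d : ℕ} {K : ConvexBody (Rd d)} (hK : IsSymmetricBody K)
    {A B : Rd d →L[ℝ] Rd d} (hAB : ∀ x, A (B x) = x) (hBA : ∀ x, B (A x) = x) :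
    IsSymmetricBody (K.mapCLM A) := by
  refine ⟨?_, ?_⟩
  · rintro _ ⟨y, hy, rfl⟩
    exact ⟨-y, hK.1 y hy, map_neg A y⟩
  · have himg : A '' (K : Set (Rd d)) = B ⁻¹' (K : Set (Rd d)) :=
      congrFun (Set.image_eq_preimage_of_inverse hBA hAB) _
    obtain ⟨y, hy⟩ := hK.2
    refine ⟨A y, ?_⟩
    rw [ConvexBody.coe_mapCLM, himg]
    refine preimage_interior_subset_interior_preimage B.continuous ?_
    rwa [Set.mem_preimage, hBA]

lemma ConvexBody.setIntegral_mapCLM {d : ℕ} (K : ConvexBody (Rd d)) {A : Rd d →L[ℝ] Rd d}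
    (hA : Function.Injective A) (g : Rd d → ℝ) :
    ∫ y in (K.mapCLM A : Set (Rd d)), g y = |A.det| * ∫ y in (K : Set (Rd d)), g (A y) := by
  rw [ConvexBody.coe_mapCLM, integral_image_eq_integral_abs_det_fderiv_smul volume K.measurableSet
    (fun x _ => A.hasFDerivAt.hasFDerivWithinAt) hA.injOn, ← integral_const_mul]
  rfl

lemma ConvexBody.dist_mapCLM_le {d : ℕ} (K : ConvexBody (Rd d)) {A : Rd d →L[ℝ] Rd d} {r : ℝ}
    (hr : 0 ≤ r) (h : ∀ y ∈ (K : Set (Rd d)), ‖A y - y‖ ≤ r) : dist (K.mapCLM A) K ≤ r := by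
  rw [← ConvexBody.hausdorffDist_coe]
  refine Metric.hausdorffDist_le_of_mem_dist hr ?_ fun y hy => ⟨A y, ⟨y, hy, rfl⟩, ?_⟩
  · rintro _ ⟨y, hy, rfl⟩
    exact ⟨y, hy, by simpa [dist_eq_norm] using h y hy⟩
  · rw [dist_comm, dist_eq_norm]
    exact h y hy

lemma isNormalized_of_integral_inner {d : ℕ} {K : ConvexBody (Rd d)}
    (h : ∀ x z : Rd d, ∫ y in (K : Set (Rd d)), ⟪x, y⟫ * ⟪z, y⟫ = ⟪x, z⟫) : IsNormalized K := by
  intro i j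
  have := h (EuclideanSpace.single i 1) (EuclideanSpace.single j 1)
  rw [inner_single_single] at this
  rw [← this]
  refine integral_congr_ae (Eventually.of_forall fun y => ?_)
  simp only
  rw [real_inner_comm y, real_inner_comm y, inner_single_one, inner_single_one]

lemma det_diagOp {d : ℕ} (b : OrthonormalBasis (Fin d) ℝ (Rd d)) (a : Fin d → ℝ) :
    (diagOp b a).det = ∏ i, a i := by
  rw [ContinuousLinearMap.det, ← LinearMap.det_toMatrix b.toBasis]
  have : LinearMap.toMatrix b.toBasis b.toBasis (diagOp b a : Rd d →ₗ[ℝ] Rd d) =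
      Matrix.diagonal a := by
    ext i j
    rw [LinearMap.toMatrix_apply, OrthonormalBasis.coe_toBasis, b.coe_toBasis_repr_apply,
      b.repr_apply_apply, ContinuousLinearMap.coe_coe, inner_diagOp, Matrix.diagonal_apply]
    rw [orthonormal_iff_ite.1 b.orthonormal i j]
    split <;> simp
  rw [this, Matrix.det_diagonal]

lemma diagOp_diagOp_of_mul_eq_one {d : ℕ} (b : OrthonormalBasis (Fin d) ℝ (Rd d))
    {a c : Fin d → ℝ} (h : ∀ i, a i * c i = 1) (x : Rd d) : diagOp b a (diagOp b c x) = x := by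
  rw [diagOp_apply]
  simp only [inner_diagOp, ← mul_assoc, h, one_mul]
  exact b.sum_repr' x

lemma norm_diagOp_sub_le {d : ℕ} (b : OrthonormalBasis (Fin d) ℝ (Rd d)) {a : Fin d → ℝ} {η : ℝ}
    (hη : 0 ≤ η) (h : ∀ i, |a i - 1| ≤ η) (x : Rd d) : ‖diagOp b a x - x‖ ≤ η * ‖x‖ := by
  refine le_of_sq_le_sq ?_ (by positivity)
  rw [mul_pow, ← b.sum_sq_norm_inner_right, ← b.sum_sq_norm_inner_right x, Finset.mul_sum]
  refine Finset.sum_le_sum fun i _ => ?_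
  rw [inner_sub_right, inner_diagOp, ← sub_one_mul, norm_mul, mul_pow]
  exact mul_le_mul_of_nonneg_right (pow_le_pow_left₀ (norm_nonneg _) (h i) 2) (by positivity)

/-- The quotient of the fourth and the second moments of a body. -/
def momentRatio {d : ℕ} (K : ConvexBody (Rd d)) (x : Rd d) : ℝ :=
  (∫ y in (K : Set (Rd d)), ⟪x, y⟫ ^ 4) / ∫ y in (K : Set (Rd d)), ⟪x, y⟫ ^ 2

/-- A symmetric body whose second moments are close to normalized can be normalized by a linear
map close to the identity. -/
lemma IsSymmetricBody.exists_normalized {d : ℕ} {K : ConvexBody (Rd d)} (hK : IsSymmetricBody K)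
    {ζ : ℝ} (hζ : 0 < ζ) (hζ1 : ζ ≤ 1)
    (hlow : ∀ x : Rd d, ζ ^ 2 * ‖x‖ ^ 2 ≤ ∫ y in (K : Set (Rd d)), ⟪x, y⟫ ^ 2)
    (hup : ∀ x : Rd d, ∫ y in (K : Set (Rd d)), ⟪x, y⟫ ^ 2 ≤ ‖x‖ ^ 2) :
    ∃ A B : Rd d →L[ℝ] Rd d, (∀ x, A (B x) = x) ∧ (∀ x, B (A x) = x) ∧
      (∀ x z, ⟪x, A z⟫ = ⟪A x, z⟫) ∧ IsNormalized (K.mapCLM A) ∧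
      ∀ x, ‖A x - x‖ ≤ (ζ⁻¹ - 1) * ‖x‖ := by
  obtain ⟨b, l, hl, hm⟩ := hK.exists_diagonal_moments
  have hlb : ∀ i, ∫ y in (K : Set (Rd d)), ⟪b i, y⟫ ^ 2 = l i := by
    intro i
    simp only [sq]
    rw [hm, Finset.sum_eq_single i]
    · simp
    · intro j _ hj
      simp [b.orthonormal.2 hj]
    · simp
  have hl1 : ∀ i, l i ≤ 1 := fun i => by
    have := hup (b i)
    rwa [hlb, b.norm_eq_one, one_pow] at this
  have hl0 : ∀ i, ζ ^ 2 ≤ l i := fun i => by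
    have := hlow (b i)
    rwa [hlb, b.norm_eq_one, one_pow, mul_one] at this
  set r : Fin d → ℝ := fun i => Real.sqrt (l i) with hr
  have hr0 : ∀ i, 0 < r i := fun i => Real.sqrt_pos.2 (hl i)
  have hrsq : ∀ i, r i ^ 2 = l i := fun i => Real.sq_sqrt (hl i).le
  have hr1 : ∀ i, r i ≤ 1 := fun i => Real.sqrt_le_one.2 (hl1 i)
  have hrζ : ∀ i, ζ ≤ r i := fun i => Real.le_sqrt_of_sq_le (hl0 i)
  set P : ℝ := ∏ i, r i with hP
  have hP0 : 0 < P := Finset.prod_pos fun i _ => hr0 i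
  have hP1 : P ≤ 1 := Finset.prod_le_one (fun i _ => (hr0 i).le) fun i _ => hr1 i
  have hPζ : ζ ^ d ≤ P := by
    have := Finset.prod_le_prod (s := Finset.univ) (f := fun _ : Fin d => ζ) (g := r)
      (fun i _ => hζ.le) (fun i _ => hrζ i)
    simpa using this
  -- Unlike in `IsSymmetricBody.exists_isotropic`, the domain is mapped too, so the Jacobian `κ^d /
  -- P` multiplies the moments `κ²`. Normalization therefore requires `κ^(d+2) = P`.
  set κ : ℝ := P ^ ((d + 2 : ℕ) : ℝ)⁻¹ with hκ
  have hκ0 : 0 < κ := by positivity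
  have hκP : κ ^ (d + 2) = P := Real.rpow_inv_natCast_pow hP0.le (by omega)
  have hκ1 : κ ≤ 1 := by
    by_contra h
    have := one_lt_pow₀ (not_le.1 h) (show d + 2 ≠ 0 by omega)
    linarith
  have hκζ : ζ ≤ κ := by
    refine le_of_pow_le_pow_left₀ (show d + 2 ≠ 0 by omega) hκ0.le ?_
    rw [hκP]
    exact (pow_le_pow_of_le_one hζ.le hζ1 (by omega)).trans hPζ
  set a : Fin d → ℝ := fun i => κ * (r i)⁻¹ with ha
  set c : Fin d → ℝ := fun i => κ⁻¹ * r i with hc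
  have hac : ∀ i, a i * c i = 1 := fun i => by
    have := (hr0 i).ne'
    simp only [ha, hc]
    field_simp
  have hca : ∀ i, c i * a i = 1 := fun i => by rw [mul_comm, hac]
  have hdet : |(diagOp b a).det| * κ ^ 2 = 1 := by
    rw [det_diagOp]
    simp only [ha, Finset.prod_mul_distrib, Finset.prod_inv_distrib, Finset.prod_const,
      Finset.card_univ, Fintype.card_fin]
    rw [abs_of_pos (by positivity), ← hP, mul_right_comm, ← pow_add, hκP]
    exact mul_inv_cancel₀ hP0.ne'
  have hAB := diagOp_diagOp_of_mul_eq_one b hac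
  have hBA := diagOp_diagOp_of_mul_eq_one b hca
  refine ⟨diagOp b a, diagOp b c, hAB, hBA, inner_diagOp_left b a, ?_, ?_⟩
  · refine isNormalized_of_integral_inner fun x z => ?_
    rw [ConvexBody.setIntegral_mapCLM K (Function.LeftInverse.injective hBA)]
    simp only [inner_diagOp_left]
    rw [hm]
    have : ∀ i, l i * (⟪b i, diagOp b a x⟫ * ⟪b i, diagOp b a z⟫) =
        κ ^ 2 * (⟪x, b i⟫ * ⟪b i, z⟫) := by
      intro i
      rw [inner_diagOp, inner_diagOp, ← hrsq, real_inner_comm x]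
      have := (hr0 i).ne'
      simp only [ha]
      field_simp
    simp only [this]
    rw [← Finset.mul_sum, b.sum_inner_mul_inner, ← mul_assoc, hdet, one_mul]
  · have hζi : 1 ≤ ζ⁻¹ := (one_le_inv₀ hζ).2 hζ1
    refine norm_diagOp_sub_le b (by linarith) fun i => ?_
    have h1 : ζ ≤ a i := by
      simp only [ha]
      calc ζ ≤ κ * 1 := by linarith
        _ ≤ κ * (r i)⁻¹ := mul_le_mul_of_nonneg_left ((one_le_inv₀ (hr0 i)).2 (hr1 i)) hκ0.le
    have h2 : a i ≤ ζ⁻¹ := by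
      simp only [ha]
      calc κ * (r i)⁻¹ ≤ 1 * (r i)⁻¹ :=
            mul_le_mul_of_nonneg_right hκ1 (inv_pos.2 (hr0 i)).le
        _ ≤ ζ⁻¹ := by
          rw [one_mul]
          exact (inv_le_inv₀ (hr0 i) hζ).2 (hrζ i)
    have h3 : 1 - ζ ≤ ζ⁻¹ - 1 := by
      have : ζ * ζ⁻¹ = 1 := mul_inv_cancel₀ hζ.ne'
      nlinarith
    rw [abs_le]
    constructor <;> linarith

/-! ### Making the moment nonzero at the given point. -/

/-- Along a line this is a polynomial of degree at most four, so its fifth difference vanishes. -/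
lemma sum_choose_zonalQuartic {d : ℕ} (x z y : Rd d) :
    ∑ k ∈ Finset.range 6,
      (-1) ^ k * (Nat.choose 5 k : ℝ) * zonalQuartic (x + (k : ℝ) • z) y = 0 := by
  have hn : ∀ k : ℝ, ‖x + k • z‖ ^ 2 = ‖x‖ ^ 2 + 2 * (k * ⟪x, z⟫) + k ^ 2 * ‖z‖ ^ 2 := by
    intro k
    rw [norm_add_sq_real, real_inner_smul_right, norm_smul, mul_pow, Real.norm_eq_abs, sq_abs]
  have h4 : ∀ v : Rd d, ‖v‖ ^ 4 = (‖v‖ ^ 2) ^ 2 := fun v => by ring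
  simp only [zonalQuartic, h4 (x + _), hn, inner_add_left, real_inner_smul_left]
  simp only [Finset.sum_range_succ, Finset.sum_range_zero, Nat.choose, Nat.cast_ofNat]
  push_cast
  ring

/-- A zonal moment that does not vanish identically vanishes on no open set. -/
lemma frequently_integral_zonalQuartic_ne_zero {d : ℕ} (K : ConvexBody (Rd d)) {x : Rd d}
    (hx : ∫ y in (K : Set (Rd d)), zonalQuartic x y ≠ 0) (x₀ : Rd d) :
    ∃ᶠ z in 𝓝 x₀, ∫ y in (K : Set (Rd d)), zonalQuartic z y ≠ 0 := by
  set H : Rd d → ℝ := fun x => ∫ y in (K : Set (Rd d)), zonalQuartic x y with hH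
  have hi : ∀ x : Rd d, IntegrableOn (fun y => zonalQuartic x y) K volume := fun x =>
    Continuous.continuousOn (by unfold zonalQuartic; fun_prop) |>.integrableOn_compact K.isCompact
  have hdiff : ∀ x z : Rd d, ∑ k ∈ Finset.range 6,
      (-1) ^ k * (Nat.choose 5 k : ℝ) * H (x + (k : ℝ) • z) = 0 := by
    intro x z
    simp only [hH, ← integral_const_mul]
    rw [← integral_finsetSum _ fun k _ => (hi _).const_mul _]
    simp only [sum_choose_zonalQuartic, integral_zero]
  intro hev
  simp only [not_not] at hev
  obtain ⟨δ, hδ, hball⟩ := Metric.eventually_nhds_iff_ball.1 hev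
  -- The first five of the equally spaced points from `x₀` to `x` then lie in the ball where the
  -- moment vanishes; the fifth-difference recursion carries the zeros on to `x`.
  obtain ⟨n, hn⟩ := exists_nat_gt (4 * ‖x - x₀‖ / δ)
  have hn0 : (0 : ℝ) < n := lt_of_le_of_lt (by positivity) hn
  set w : Rd d := (n : ℝ)⁻¹ • (x - x₀) with hw
  have hall : ∀ m : ℕ, H (x₀ + (m : ℝ) • w) = 0 := by
    intro m
    induction m using Nat.strong_induction_on with
    | _ m ih =>
      rcases lt_or_ge m 5 with hm | hm
      · refine hball _ ?_
        have hm4 : (m : ℝ) ≤ 4 := by exact_mod_cast (by omega : m ≤ 4)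
        rw [Metric.mem_ball, dist_eq_norm, add_sub_cancel_left, hw, norm_smul, norm_smul, norm_inv,
          RCLike.norm_natCast, RCLike.norm_natCast]
        rw [div_lt_iff₀ hδ] at hn
        calc (m : ℝ) * ((n : ℝ)⁻¹ * ‖x - x₀‖) ≤ 4 * ((n : ℝ)⁻¹ * ‖x - x₀‖) :=
              mul_le_mul_of_nonneg_right hm4 (by positivity)
          _ = (n : ℝ)⁻¹ * (4 * ‖x - x₀‖) := by ring
          _ < (n : ℝ)⁻¹ * (n * δ) := mul_lt_mul_of_pos_left hn (by positivity)
          _ = δ := by field_simp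
      · obtain ⟨j, rfl⟩ := Nat.exists_eq_add_of_le' hm
        have h := hdiff (x₀ + (j : ℝ) • w) w
        have hterm : ∀ k : ℕ, x₀ + (j : ℝ) • w + (k : ℝ) • w = x₀ + ((j + k : ℕ) : ℝ) • w := by
          intro k
          push_cast
          rw [add_smul, add_assoc]
        simp only [hterm] at h
        rw [Finset.sum_range_succ, Finset.sum_eq_zero] at h
        · simpa using h
        · intro k hk
          rw [ih (j + k) (by have := Finset.mem_range.1 hk; omega), mul_zero]
  refine hx ?_
  have := hall n
  rwa [hw, smul_inv_smul₀ hn0.ne', add_sub_cancel] at this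

lemma setIntegral_mapCLM_isometry {d : ℕ} (K : ConvexBody (Rd d)) (R : Rd d ≃ₗᵢ[ℝ] Rd d)
    (g : Rd d → ℝ) :
    ∫ y in (K.mapCLM (R.toContinuousLinearEquiv : Rd d →L[ℝ] Rd d) : Set (Rd d)), g y =
      ∫ y in (K : Set (Rd d)), g (R y) :=
  R.measurePreserving.setIntegral_image_emb R.toHomeomorph.measurableEmbedding g K

lemma IsSymmetricBody.mapCLM_isometry {d : ℕ} {K : ConvexBody (Rd d)} (hK : IsSymmetricBody K)
    (R : Rd d ≃ₗᵢ[ℝ] Rd d) :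
    IsSymmetricBody (K.mapCLM (R.toContinuousLinearEquiv : Rd d →L[ℝ] Rd d)) :=
  hK.mapCLM (B := (R.symm.toContinuousLinearEquiv : Rd d →L[ℝ] Rd d))
    (fun x => R.apply_symm_apply x) (fun x => R.symm_apply_apply x)

lemma IsNormalized.mapCLM_isometry {d : ℕ} {K : ConvexBody (Rd d)} (hK : IsNormalized K)
    (R : Rd d ≃ₗᵢ[ℝ] Rd d) :
    IsNormalized (K.mapCLM (R.toContinuousLinearEquiv : Rd d →L[ℝ] Rd d)) := by
  refine isNormalized_of_integral_inner fun x z => ?_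
  rw [setIntegral_mapCLM_isometry K R]
  have h : ∀ x y : Rd d, ⟪x, R y⟫ = ⟪R.symm x, y⟫ := fun x y => by
    rw [← R.inner_map_map (R.symm x) y, R.apply_symm_apply]
  simp only [h]
  rw [hK.integral_inner, R.symm.inner_map_map]

lemma eventually_norm_reflection_sub_lt {d : ℕ} {s : Set (Rd d)} (hs : IsCompact s) {x₀ : Rd d}
    (hx₀ : x₀ ≠ 0) {ε : ℝ} (hε : 0 < ε) :
    ∀ᶠ u in 𝓝 x₀, ∀ y ∈ s,
      ‖Submodule.reflection (ℝ ∙ u) y - Submodule.reflection (ℝ ∙ x₀) y‖ < ε := by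
  refine hs.eventually_forall_of_forall_eventually fun y _ => ?_
  simp only [Submodule.reflection_singleton_apply, RCLike.ofReal_real_eq_id, id]
  have hc : ContinuousAt (fun z : Rd d × Rd d =>
      ‖(2 • (⟪z.1, z.2⟫ / ‖z.1‖ ^ 2) • z.1 - z.2) - (2 • (⟪x₀, z.2⟫ / ‖x₀‖ ^ 2) • x₀ - z.2)‖)
      (x₀, y) := by
    have h1 : ContinuousAt (fun z : Rd d × Rd d => ⟪z.1, z.2⟫ / ‖z.1‖ ^ 2) (x₀, y) :=
      ContinuousAt.div (by fun_prop) (by fun_prop) (by simpa using hx₀)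
    have h2 : Continuous fun z : Rd d × Rd d => 2 • (⟪x₀, z.2⟫ / ‖x₀‖ ^ 2) • x₀ - z.2 := by
      fun_prop
    exact ((((h1.smul continuousAt_fst).const_smul 2).sub continuousAt_snd).sub
      h2.continuousAt).norm
  refine hc.eventually (gt_mem_nhds ?_)
  simpa using hε

/-- Near every normalized body whose zonal moment does not vanish identically there is a rotated
copy whose zonal moment does not vanish at a given point. -/
lemma exists_dist_lt_fourthMomentCondition {d : ℕ} (hd : 3 ≤ d) {x₀ : Rd d} (hx₀ : x₀ ≠ 0)
    (K : NormalizedBody d) {x : Rd d} (hx : ∫ y in (K.1 : Set (Rd d)), zonalQuartic x y ≠ 0)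
    {ε : ℝ} (hε : 0 < ε) :
    ∃ L : NormalizedBody d, dist L K < ε ∧ FourthMomentCondition x₀ L.1 := by
  have hx₀' : 0 < ‖x₀‖ := norm_pos_iff.2 hx₀
  have hrefl := eventually_norm_reflection_sub_lt K.1.isCompact hx₀ (show 0 < ε / 4 by positivity)
  have hscale : ContinuousAt (fun z : Rd d => (‖x₀‖ / ‖z‖) • z) x₀ :=
    (continuousAt_const.div continuous_norm.continuousAt hx₀'.ne').smul continuousAt_id
  have hscale0 : (‖x₀‖ / ‖x₀‖) • x₀ = x₀ := by rw [div_self hx₀'.ne', one_smul]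
  have hmid : ContinuousAt (fun z : Rd d => (2⁻¹ : ℝ) • (x₀ + (‖x₀‖ / ‖z‖) • z)) x₀ :=
    ((continuousAt_const (y := x₀)).add hscale).const_smul (2⁻¹ : ℝ)
  have hmid0 : (2⁻¹ : ℝ) • (x₀ + (‖x₀‖ / ‖x₀‖) • x₀) = x₀ := by
    rw [hscale0, ← two_smul ℝ x₀, smul_smul]
    norm_num
  have hne : ∀ᶠ u in 𝓝 x₀, u ≠ 0 := isOpen_compl_singleton.mem_nhds hx₀
  have hscale' := hscale.tendsto
  have hmid' := hmid.tendsto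
  rw [hscale0] at hscale'
  rw [hmid0] at hmid'
  obtain ⟨z, hHz, hz0, hb, ha, ha0⟩ :=
    ((frequently_integral_zonalQuartic_ne_zero K.1 hx x₀).and_eventually
      (hne.and ((hscale'.eventually hrefl).and ((hmid'.eventually hrefl).and
        (hmid'.eventually hne))))).exists
  have hz' : 0 < ‖z‖ := norm_pos_iff.2 hz0
  set b : Rd d := (‖x₀‖ / ‖z‖) • z with hbdef
  set a : Rd d := (2⁻¹ : ℝ) • (x₀ + b) with hadef
  have hbn : ‖b‖ = ‖x₀‖ := by
    rw [hbdef, norm_smul, norm_div, norm_norm, norm_norm, div_mul_cancel₀ _ hz'.ne']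
  -- The reflection in the line of `b` fixes `b`; the one in the line of the midpoint `a` exchanges
  -- `b` and `x₀`, which have equal norms. Both lines are close to that of `x₀`, so the composition
  -- is close to the identity on `K`.
  set R : Rd d ≃ₗᵢ[ℝ] Rd d :=
    (Submodule.reflection (ℝ ∙ b)).trans (Submodule.reflection (ℝ ∙ a)) with hR
  have hRb : R b = x₀ := by
    have h1 : Submodule.reflection (ℝ ∙ b) b = b :=
      Submodule.reflection_mem_subspace_eq_self (Submodule.mem_span_singleton_self b)
    have h2 : ⟪a, b⟫ = ‖a‖ ^ 2 := by
      rw [hadef, norm_smul, real_inner_smul_left, mul_pow, norm_add_sq_real, inner_add_left,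
        real_inner_self_eq_norm_sq, hbn]
      norm_num
      ring
    rw [hR, LinearIsometryEquiv.trans_apply, h1, Submodule.reflection_singleton_apply, h2]
    simp only [RCLike.ofReal_real_eq_id, id]
    rw [div_self (pow_ne_zero 2 (norm_ne_zero_iff.2 ha0)), one_smul, hadef,
      ← Nat.cast_smul_eq_nsmul ℝ, smul_smul]
    norm_num
  refine ⟨⟨K.1.mapCLM (R.toContinuousLinearEquiv : Rd d →L[ℝ] Rd d),
    K.2.1.mapCLM_isometry R, K.2.2.mapCLM_isometry R⟩, ?_, ?_⟩
  · refine lt_of_le_of_lt (ConvexBody.dist_mapCLM_le K.1 (r := ε / 2) (by positivity) ?_)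
      (by linarith)
    intro y hy
    have h1 : R y - y = Submodule.reflection (ℝ ∙ a)
        (Submodule.reflection (ℝ ∙ b) y - Submodule.reflection (ℝ ∙ a) y) := by
      rw [map_sub, Submodule.reflection_reflection]
      rfl
    change ‖R y - y‖ ≤ ε / 2
    rw [h1, LinearIsometryEquiv.norm_map]
    have h2 := norm_sub_le_norm_sub_add_norm_sub (Submodule.reflection (ℝ ∙ b) y)
      (Submodule.reflection (ℝ ∙ x₀) y) (Submodule.reflection (ℝ ∙ a) y)
    have h3 := hb y hy
    have h4 := ha y hy
    rw [norm_sub_rev] at h4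
    linarith
  · rw [fourthMomentCondition_iff hd hx₀, setIntegral_mapCLM_isometry]
    rw [← hRb]
    simp only [zonalQuartic_map]
    rw [hbdef]
    simp only [zonalQuartic_smul_left, integral_const_mul]
    exact mul_ne_zero (by positivity) hHz

/-! ### Cutting small symmetric caps. -/

/-- Cutting a symmetric body by a symmetric slab. -/
lemma IsSymmetricBody.exists_inter_slab {d : ℕ} {K : ConvexBody (Rd d)} (hK : IsSymmetricBody K)
    {v : Rd d} {s σ : ℝ} (hσ : ∀ y ∈ (K : Set (Rd d)), ⟪y, v⟫ ≤ σ) (hs : 0 < s) (hsσ : s < σ) :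
    ∃ L : ConvexBody (Rd d), (L : Set (Rd d)) = (K : Set (Rd d)) ∩ {y | |⟪y, v⟫| ≤ s} ∧
      IsSymmetricBody L ∧
      ∀ M, (∀ y ∈ (K : Set (Rd d)), ‖y‖ ≤ M) → dist L K ≤ (1 - s / σ) * M := by
  have hσ0 : 0 < σ := hs.trans hsσ
  have hq0 : 0 < s / σ := by positivity
  have hq1 : s / σ < 1 := (div_lt_one hσ0).2 hsσ
  obtain ⟨δ, hδ, hball⟩ := hK.exists_ball_subset
  have h0 : (0 : Rd d) ∈ (K : Set (Rd d)) := hball (Metric.mem_ball_self hδ)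
  have hclosed : IsClosed {y : Rd d | |⟪y, v⟫| ≤ s} :=
    isClosed_le (by fun_prop) continuous_const
  have hconv : Convex ℝ {y : Rd d | |⟪y, v⟫| ≤ s} := by
    have : {y : Rd d | |⟪y, v⟫| ≤ s} = (innerSL ℝ v).toLinearMap ⁻¹' Set.Icc (-s) s := by
      ext y
      simp [abs_le, real_inner_comm]
    rw [this]
    exact (convex_Icc _ _).linear_preimage _
  let L : ConvexBody (Rd d) :=
    { carrier := (K : Set (Rd d)) ∩ {y | |⟪y, v⟫| ≤ s}
      convex' := K.convex.inter hconv
      isCompact' := K.isCompact.inter_right hclosed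
      nonempty' := ⟨0, h0, by simpa using hs.le⟩ }
  have hL : (L : Set (Rd d)) = (K : Set (Rd d)) ∩ {y | |⟪y, v⟫| ≤ s} := rfl
  -- The shrunken copy of `K` inside `L` yields both the nonempty interior and the distance
  -- estimate.
  have hsub : ∀ y ∈ (K : Set (Rd d)), (s / σ) • y ∈ (L : Set (Rd d)) := by
    intro y hy
    rw [hL]
    refine ⟨K.convex.smul_mem_of_zero_mem h0 hy ⟨hq0.le, hq1.le⟩, ?_⟩
    have h1 : |⟪y, v⟫| ≤ σ := by
      rw [abs_le]
      have := hσ (-y) (hK.1 y hy)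
      rw [inner_neg_left] at this
      exact ⟨by linarith, hσ y hy⟩
    rw [Set.mem_ofPred_eq, real_inner_smul_left, abs_mul, abs_of_pos hq0]
    calc s / σ * |⟪y, v⟫| ≤ s / σ * σ := mul_le_mul_of_nonneg_left h1 hq0.le
      _ = s := div_mul_cancel₀ _ hσ0.ne'
  refine ⟨L, hL, ⟨?_, ?_⟩, ?_⟩
  · rintro y ⟨hy, hys⟩
    exact ⟨hK.1 y hy, by rwa [Set.mem_ofPred_eq, inner_neg_left, abs_neg]⟩
  · obtain ⟨y, hy⟩ := hK.2
    refine ⟨(s / σ) • y, interior_mono (s := (s / σ) • (K : Set (Rd d))) ?_ ?_⟩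
    · rintro _ ⟨z, hz, rfl⟩
      exact hsub z hz
    · rw [interior_smul₀ hq0.ne']
      exact Set.smul_mem_smul_set hy
  · intro M hM
    have hM0 : 0 ≤ M := (norm_nonneg _).trans (hM 0 h0)
    rw [← ConvexBody.hausdorffDist_coe]
    refine Metric.hausdorffDist_le_of_mem_dist (mul_nonneg (by linarith) hM0)
      (fun y hy => ⟨y, hy.1, ?_⟩) fun y hy => ⟨_, hsub y hy, ?_⟩
    · rw [dist_self]
      exact mul_nonneg (by linarith) hM0
    · have : y - (s / σ) • y = (1 - s / σ) • y := by rw [sub_smul, one_smul]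
      rw [dist_eq_norm, this, norm_smul, Real.norm_of_nonneg (by linarith)]
      exact mul_le_mul_of_nonneg_left (hM y hy) (by linarith)

/-- The point `y` lies in the ball about `c` through `p`, so its height below the tangent plane at
`p` controls its distance to `p`. This makes thin caps at `p` small in diameter. -/
lemma norm_sub_sq_le_of_farthest {d : ℕ} {c p y : Rd d} (h : ‖y - c‖ ≤ ‖p - c‖) :
    ‖y - p‖ ^ 2 ≤ 2 * (⟪p, p - c⟫ - ⟪y, p - c⟫) := by
  have h1 : y - c = (y - p) + (p - c) := by abel
  have h2 : ‖y - c‖ ^ 2 ≤ ‖p - c‖ ^ 2 := pow_le_pow_left₀ (norm_nonneg _) h 2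
  rw [h1, norm_add_sq_real, inner_sub_left] at h2
  linarith

/-- A farthest point cannot be the midpoint of `y` and `-y` with `y ≠ 0`: adding the two cap
inequalities gives `‖y‖² ≤ 0`. -/
lemma IsSymmetricBody.ne_zero_of_farthest {d : ℕ} (hd : 0 < d) {K : ConvexBody (Rd d)}
    (hK : IsSymmetricBody K) {c p : Rd d}
    (hp : ∀ y ∈ (K : Set (Rd d)), ‖y - c‖ ≤ ‖p - c‖) : p ≠ 0 := by
  rintro rfl
  obtain ⟨δ, hδ, hball⟩ := hK.exists_ball_subset
  have hy : (δ / 2) • EuclideanSpace.single (⟨0, hd⟩ : Fin d) (1 : ℝ) ∈ (K : Set (Rd d)) := by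
    refine hball ?_
    rw [mem_ball_zero_iff, norm_smul, norm_single_one, Real.norm_of_nonneg (by positivity)]
    linarith
  have h1 := norm_sub_sq_le_of_farthest (hp _ hy)
  have h2 := norm_sub_sq_le_of_farthest (hp _ (hK.1 _ hy))
  rw [sub_zero, norm_neg, inner_neg_left] at h2
  rw [sub_zero] at h1
  have h3 : 0 < ‖(δ / 2) • (EuclideanSpace.single (⟨0, hd⟩ : Fin d) (1 : ℝ) : Rd d)‖ := by
    rw [norm_smul, norm_single_one, Real.norm_of_nonneg (by positivity)]
    positivity
  have h4 := pow_pos h3 2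
  rw [inner_zero_left] at h1 h2
  linarith

/-- At a point of a symmetric body that is farthest from some center, symmetric pairs of
arbitrarily small caps can be cut off. -/
lemma IsSymmetricBody.exists_seq_caps {d : ℕ} (hd : 0 < d) {K : ConvexBody (Rd d)}
    (hK : IsSymmetricBody K) {c p : Rd d} (hpK : p ∈ (K : Set (Rd d)))
    (hp : ∀ y ∈ (K : Set (Rd d)), ‖y - c‖ ≤ ‖p - c‖) :
    ∃ L : ℕ → ConvexBody (Rd d), (∀ n, IsSymmetricBody (L n)) ∧ Tendsto L atTop (𝓝 K) ∧
      (∀ n, (L n : Set (Rd d)) ⊆ K) ∧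
      (∀ n, 0 < volume.real ((K : Set (Rd d)) \ L n)) ∧
      ∀ g : Rd d → ℝ, Continuous g → (∀ y, g (-y) = g y) →
        Tendsto (fun n => (∫ y in (K : Set (Rd d)) \ L n, g y) /
          volume.real ((K : Set (Rd d)) \ L n)) atTop (𝓝 (g p)) := by
  have hfar : ∀ y ∈ (K : Set (Rd d)), ‖y - p‖ ^ 2 ≤ 2 * (⟪p, p - c⟫ - ⟪y, p - c⟫) :=
    fun y hy => norm_sub_sq_le_of_farthest (hp y hy)
  have hp0 : p ≠ 0 := hK.ne_zero_of_farthest hd hp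
  set v : Rd d := p - c with hv
  set σ : ℝ := ⟪p, v⟫ with hσdef
  have hσ : ∀ y ∈ (K : Set (Rd d)), ⟪y, v⟫ ≤ σ := fun y hy => by
    have := (sq_nonneg _).trans (hfar y hy)
    linarith
  have hσ0 : 0 < σ := by
    have h1 := hfar (-p) (hK.1 p hpK)
    rw [inner_neg_left] at h1
    have h2 : -p - p = (-2 : ℝ) • p := by rw [neg_smul, two_smul]; abel
    rw [h2, norm_smul, mul_pow] at h1
    have h3 : 0 < ‖p‖ ^ 2 := by positivity
    norm_num at h1
    linarith
  -- The shift by 2 keeps the first slab nondegenerate.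
  set s : ℕ → ℝ := fun n => σ * (1 - 1 / ((n : ℝ) + 2)) with hs
  have hfrac : ∀ n : ℕ, 0 < 1 / ((n : ℝ) + 2) ∧ 1 / ((n : ℝ) + 2) < 1 := fun n => by
    have : (0 : ℝ) ≤ n := n.cast_nonneg
    exact ⟨by positivity, by rw [div_lt_one (by positivity)]; linarith⟩
  have hs0 : ∀ n, 0 < s n := fun n => mul_pos hσ0 (by linarith [(hfrac n).2])
  have hs1 : ∀ n, s n < σ := fun n => by
    have := mul_pos hσ0 (hfrac n).1
    simp only [hs]
    linarith
  have hlim : Tendsto (fun n : ℕ => 1 / ((n : ℝ) + 2)) atTop (𝓝 0) := by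
    have h := tendsto_one_div_add_atTop_nhds_zero_nat (𝕜 := ℝ)
    have h' := h.comp (tendsto_add_atTop_nat 1)
    refine h'.congr fun n => ?_
    simp only [Function.comp]
    push_cast
    ring
  choose L hLeq hLsym hLdist using fun n => hK.exists_inter_slab hσ (hs0 n) (hs1 n)
  have hsub : ∀ n, (L n : Set (Rd d)) ⊆ K := fun n => by
    rw [hLeq]
    exact Set.inter_subset_left
  have hdiff : ∀ n, ∀ y ∈ (K : Set (Rd d)) \ L n, y ∈ (K : Set (Rd d)) ∧ s n < |⟪y, v⟫| := by
    rintro n y ⟨hy, hyL⟩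
    refine ⟨hy, not_le.1 fun h => hyL ?_⟩
    rw [hLeq]
    exact ⟨hy, h⟩
  have hfin : ∀ n, volume ((K : Set (Rd d)) \ L n) ≠ ⊤ := fun n =>
    ((measure_mono Set.sdiff_subset).trans_lt K.isCompact.measure_lt_top).ne
  have hpos : ∀ n, 0 < volume.real ((K : Set (Rd d)) \ L n) := by
    intro n
    have hcl : p ∈ closure (interior (K : Set (Rd d))) :=
      (K.convex.closure_interior_eq_closure_of_nonempty_interior hK.2).symm ▸ subset_closure hpK
    have hopen : IsOpen {y : Rd d | s n < ⟪y, v⟫} := isOpen_lt continuous_const (by fun_prop)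
    obtain ⟨z, hz1, hz2⟩ := mem_closure_iff.1 hcl _ hopen (hs1 n)
    have hm : 0 < volume ({y : Rd d | s n < ⟪y, v⟫} ∩ interior (K : Set (Rd d))) :=
      (hopen.inter isOpen_interior).measure_pos volume ⟨z, hz1, hz2⟩
    refine ENNReal.toReal_pos (hm.trans_le (measure_mono ?_)).ne' (hfin n)
    rintro y ⟨hy1, hy2⟩
    refine ⟨interior_subset hy2, fun hyL => ?_⟩
    rw [hLeq] at hyL
    exact (lt_of_lt_of_le hy1 ((le_abs_self ⟪y, v⟫).trans hyL.2)).false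
  refine ⟨L, hLsym, ?_, hsub, hpos, ?_⟩
  · obtain ⟨M, hM⟩ := K.isCompact.isBounded.exists_norm_le
    rw [tendsto_iff_dist_tendsto_zero]
    have h1 := hlim.mul_const M
    rw [zero_mul] at h1
    refine squeeze_zero (fun n => dist_nonneg) (fun n => ?_) h1
    refine (hLdist n M hM).trans_eq ?_
    simp only [hs]
    rw [mul_div_cancel_left₀ _ hσ0.ne']
    ring
  · intro g hg heven
    rw [Metric.tendsto_atTop']
    intro ε hε
    obtain ⟨δ, hδ, hgδ⟩ := Metric.continuousAt_iff.1 (hg.continuousAt (x := p)) (ε / 2)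
      (half_pos hε)
    have hsmall : ∀ᶠ n : ℕ in atTop, 2 * σ * (1 / ((n : ℝ) + 2)) < δ ^ 2 := by
      have := hlim.const_mul (2 * σ)
      rw [mul_zero] at this
      exact this.eventually (gt_mem_nhds (pow_pos hδ 2))
    obtain ⟨N, hN⟩ := eventually_atTop.1 hsmall
    refine ⟨N, fun n hn => ?_⟩
    have hclose : ∀ y ∈ (K : Set (Rd d)) \ L n, ‖g y - g p‖ ≤ ε / 2 := by
      intro y hy
      obtain ⟨hyK, hys⟩ := hdiff n y hy
      have hmain : ∀ z ∈ (K : Set (Rd d)), s n < ⟪z, v⟫ → ‖g z - g p‖ ≤ ε / 2 := by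
        intro z hz hzs
        rw [← dist_eq_norm]
        refine (hgδ ?_).le
        rw [dist_eq_norm]
        refine lt_of_pow_lt_pow_left₀ 2 hδ.le ((hfar z hz).trans_lt ?_)
        refine lt_of_le_of_lt ?_ (hN n hn.le)
        simp only [hs] at hzs
        linarith
      -- Evenness of `g` transfers the estimate from the cap at `p` to the one at `-p`.
      rcases lt_abs.1 hys with h | h
      · exact hmain y hyK h
      · rw [← heven]
        exact hmain (-y) (hK.1 y hyK) (by rwa [inner_neg_left])
    have hi : IntegrableOn g ((K : Set (Rd d)) \ L n) volume :=
      (hg.continuousOn.integrableOn_compact K.isCompact).mono_set Set.sdiff_subset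
    have hbound := norm_setIntegral_le_of_norm_le_const (lt_top_iff_ne_top.2 (hfin n)) hclose
    rw [integral_sub hi (integrableOn_const (hfin n)), setIntegral_const, smul_eq_mul] at hbound
    rw [dist_eq_norm, div_sub' (hpos n).ne', norm_div, Real.norm_of_nonneg (hpos n).le,
      div_lt_iff₀ (hpos n)]
    have := mul_lt_mul_of_pos_right (half_lt_self hε) (hpos n)
    linarith

/-! ### Variation of the moment ratio and density. -/

/-- The parallelogram law for a function on a vector space. -/
def ParallelogramLaw {d : ℕ} (P : Rd d → ℝ) : Prop :=
  ∀ x z, P (x + z) + P (x - z) = 2 * P x + 2 * P z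

lemma IsNormalized.integral_inner_sq {d : ℕ} {K : ConvexBody (Rd d)} (hK : IsNormalized K)
    (x : Rd d) : ∫ y in (K : Set (Rd d)), ⟪x, y⟫ ^ 2 = ‖x‖ ^ 2 := by
  have := hK.integral_inner x x
  simp only [← sq, real_inner_self_eq_norm_sq] at this
  exact this

lemma momentRatio_zero {d : ℕ} (K : ConvexBody (Rd d)) : momentRatio K 0 = 0 := by
  simp [momentRatio]

lemma momentRatio_smul {d : ℕ} (K : ConvexBody (Rd d)) (c : ℝ) (x : Rd d) :
    momentRatio K (c • x) = c ^ 2 * momentRatio K x := by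
  rcases eq_or_ne c 0 with rfl | hc
  · simp [momentRatio_zero]
  · simp only [momentRatio, real_inner_smul_left, mul_pow, integral_const_mul]
    rw [show c ^ 4 = c ^ 2 * c ^ 2 by ring, mul_assoc, mul_div_mul_left _ _ (pow_ne_zero 2 hc),
      mul_div_assoc]

/-- The Jacobian cancels in the quotient, so whether the ratio is a quadratic form is insensitive to
normalization by a self-adjoint map. -/
lemma momentRatio_mapCLM {d : ℕ} (K : ConvexBody (Rd d)) {A B : Rd d →L[ℝ] Rd d}
    (hAB : ∀ x, A (B x) = x) (hBA : ∀ x, B (A x) = x) (hA : ∀ x z, ⟪x, A z⟫ = ⟪A x, z⟫)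
    (x : Rd d) : momentRatio (K.mapCLM A) x = momentRatio K (A x) := by
  have hdet : |A.det| ≠ 0 := by
    have h : A.toLinearMap * B.toLinearMap = 1 := LinearMap.ext hAB
    have h1 := congrArg LinearMap.det h
    rw [map_mul, map_one] at h1
    exact abs_ne_zero.2 (left_ne_zero_of_mul_eq_one h1)
  have hinj : Function.Injective A := Function.LeftInverse.injective hBA
  rw [momentRatio, momentRatio, K.setIntegral_mapCLM hinj, K.setIntegral_mapCLM hinj,
    mul_div_mul_left _ _ hdet]
  simp only [hA]

/-- If the zonal moment vanishes identically, then the moment ratio is a quadratic form. -/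
lemma IsNormalized.parallelogramLaw_momentRatio {d : ℕ} {K : ConvexBody (Rd d)}
    (hK : IsNormalized K) (hH : ∀ x, ∫ y in (K : Set (Rd d)), zonalQuartic x y = 0) :
    ParallelogramLaw (momentRatio K) := by
  set U : Rd d → ℝ := fun x => ∫ y in (K : Set (Rd d)), ⟪x, y⟫ ^ 2 * ‖y‖ ^ 2 with hU
  set W : ℝ := ∫ y in (K : Set (Rd d)), ‖y‖ ^ 4 with hW
  have hi : ∀ {g : Rd d → ℝ}, Continuous g → IntegrableOn g K volume := fun hg =>
    hg.continuousOn.integrableOn_compact K.isCompact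
  have hUp : ParallelogramLaw U := by
    intro x z
    simp only [hU]
    rw [← integral_add (hi (by fun_prop)) (hi (by fun_prop)), ← integral_const_mul,
      ← integral_const_mul, ← integral_add (hi (by fun_prop)) (hi (by fun_prop))]
    refine integral_congr_ae (Eventually.of_forall fun y => ?_)
    simp only [inner_add_left, inner_sub_left]
    ring
  have hd0 : (0 : ℝ) < (d + 2) * (d + 4) := by positivity
  -- Normalization makes the second moment `|x|²`; dividing the vanishing zonal moment by it leaves
  -- only quadratic terms.
  have hQ : ∀ x, momentRatio K x =
      (6 * (d + 2) * U x - 3 * W * ‖x‖ ^ 2) / ((d + 2) * (d + 4)) := by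
    intro x
    rcases eq_or_ne x 0 with rfl | hx
    · simp [momentRatio_zero, hU]
    have hx' : ‖x‖ ^ 2 ≠ 0 := pow_ne_zero 2 (norm_ne_zero_iff.2 hx)
    have h := hH x
    have hexp : ∫ y in (K : Set (Rd d)), zonalQuartic x y = 3 * ‖x‖ ^ 4 * W -
        6 * (d + 2) * ‖x‖ ^ 2 * U x +
          (d + 2) * (d + 4) * ∫ y in (K : Set (Rd d)), ⟪x, y⟫ ^ 4 := by
      simp only [hU, hW, ← integral_const_mul]
      rw [← integral_sub (hi (by fun_prop)) (hi (by fun_prop)),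
        ← integral_add (hi (by fun_prop)) (hi (by fun_prop))]
      refine integral_congr_ae (Eventually.of_forall fun y => ?_)
      simp only [zonalQuartic]
      ring
    rw [momentRatio, hK.integral_inner_sq, div_eq_div_iff hx' hd0.ne']
    linear_combination h - hexp
  intro x z
  simp only [hQ]
  rw [← add_div, ← mul_div_assoc, ← mul_div_assoc, ← add_div]
  congr 1
  have h1 := hUp x z
  have h2 := parallelogram_law_with_norm ℝ x z
  linear_combination 6 * (d + 2 : ℝ) * h1 - 3 * W * h2

lemma eventually_parallelogramLaw_momentRatio {d : ℕ} {K : NormalizedBody d}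
    (hH : ∀ᶠ L : NormalizedBody d in 𝓝 K, ∀ x, ∫ y in (L.1 : Set (Rd d)), zonalQuartic x y = 0)
    {L : ℕ → ConvexBody (Rd d)} (hL : ∀ n, IsSymmetricBody (L n)) (hlim : Tendsto L atTop (𝓝 K.1))
    (hsub : ∀ n, (L n : Set (Rd d)) ⊆ K.1) :
    ∀ᶠ n in atTop, ParallelogramLaw (momentRatio (L n)) := by
  obtain ⟨ε, hε, hball⟩ := Metric.eventually_nhds_iff_ball.1 hH
  obtain ⟨M, hM0, hM⟩ := K.1.isCompact.isBounded.exists_pos_norm_le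
  have hi : ∀ {g : Rd d → ℝ}, Continuous g → IntegrableOn g K.1 volume := fun hg =>
    hg.continuousOn.integrableOn_compact K.1.isCompact
  -- By Cauchy–Schwarz, `Z n` bounds the loss of second moment in every unit direction, so the
  -- moments of `L n` lie between `(1 - Z n)|x|²` and `|x|²`.
  set Z : ℕ → ℝ := fun n => (∫ y in (K.1 : Set (Rd d)), ‖y‖ ^ 2) -
    ∫ y in (L n : Set (Rd d)), ‖y‖ ^ 2 with hZ
  have hdiff : ∀ n {g : Rd d → ℝ}, Continuous g →
      ∫ y in (K.1 : Set (Rd d)) \ L n, g y =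
        (∫ y in (K.1 : Set (Rd d)), g y) - ∫ y in (L n : Set (Rd d)), g y := fun n g hg =>
    setIntegral_sdiff (L n).measurableSet (hi hg) (hsub n)
  have hZ0 : ∀ n, 0 ≤ Z n := fun n => by
    simp only [hZ]
    rw [← hdiff n (g := fun y => ‖y‖ ^ 2) (by fun_prop)]
    exact integral_nonneg fun y => by positivity
  have hZlim : Tendsto Z atTop (𝓝 0) := by
    have h1 := (K.1.continuousAt_setIntegral (g := fun y => ‖y‖ ^ 2) (by fun_prop)).tendsto.comp hlim
    have h2 := h1.const_sub (∫ y in (K.1 : Set (Rd d)), ‖y‖ ^ 2)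
    rwa [sub_self] at h2
  have hsqrt : Tendsto (fun n => Real.sqrt (1 - Z n)) atTop (𝓝 1) := by
    have h1 := (hZlim.const_sub 1).sqrt
    rwa [sub_zero, Real.sqrt_one] at h1
  have hinv : Tendsto (fun n => ((Real.sqrt (1 - Z n))⁻¹ - 1) * M) atTop (𝓝 0) := by
    have h1 := ((hsqrt.inv₀ one_ne_zero).sub_const 1).mul_const M
    rwa [inv_one, sub_self, zero_mul] at h1
  filter_upwards [hZlim.eventually (gt_mem_nhds one_pos),
    hinv.eventually (gt_mem_nhds (half_pos hε)),
    hlim.eventually (Metric.ball_mem_nhds K.1 (half_pos hε))] with n hn1 hn2 hn3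
  have hz0 : 0 < Real.sqrt (1 - Z n) := Real.sqrt_pos.2 (by linarith)
  have hz1 : Real.sqrt (1 - Z n) ≤ 1 := Real.sqrt_le_one.2 (by linarith [hZ0 n])
  obtain ⟨A, B, hAB, hBA, hsymm, hnorm, hAdist⟩ := (hL n).exists_normalized hz0 hz1
    (fun x => by
      rw [Real.sq_sqrt (by linarith)]
      have h1 := hdiff n (g := fun y => ⟪x, y⟫ ^ 2) (by fun_prop)
      have h2 : ∫ y in (K.1 : Set (Rd d)) \ L n, ⟪x, y⟫ ^ 2 ≤ ‖x‖ ^ 2 * Z n := by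
        simp only [hZ]
        rw [← hdiff n (g := fun y => ‖y‖ ^ 2) (by fun_prop), ← integral_const_mul]
        refine integral_mono ((hi (by fun_prop)).mono_set Set.sdiff_subset)
          ((hi (by fun_prop)).mono_set Set.sdiff_subset) fun y => ?_
        simp only
        rw [← mul_pow, ← sq_abs]
        exact pow_le_pow_left₀ (abs_nonneg _) (abs_real_inner_le_norm x y) 2
      rw [K.2.2.integral_inner_sq] at h1
      linarith)
    (fun x => by
      rw [← K.2.2.integral_inner_sq x]
      exact setIntegral_mono_set (hi (by fun_prop)) (Eventually.of_forall fun y => sq_nonneg _)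
        (hsub n).eventuallyLE)
  have hdist : dist ((L n).mapCLM A) K.1 < ε := by
    have h1 : dist ((L n).mapCLM A) (L n) ≤ ((Real.sqrt (1 - Z n))⁻¹ - 1) * M := by
      have h3 : 0 ≤ (Real.sqrt (1 - Z n))⁻¹ - 1 := sub_nonneg.2 ((one_le_inv₀ hz0).2 hz1)
      exact (L n).dist_mapCLM_le (mul_nonneg h3 hM0.le) fun y hy =>
        (hAdist y).trans (mul_le_mul_of_nonneg_left (hM y (hsub n hy)) h3)
    have h2 := dist_triangle ((L n).mapCLM A) (L n) K.1
    have h3 : dist (L n) K.1 < ε / 2 := hn3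
    linarith
  have hP := hnorm.parallelogramLaw_momentRatio
    (hball ⟨(L n).mapCLM A, (hL n).mapCLM hAB hBA, hnorm⟩ hdist)
  intro x z
  have h := hP (B x) (B z)
  simpa only [momentRatio_mapCLM (L n) hAB hBA hsymm, map_add, map_sub, hAB] using h

/-- The first variation of the moment ratio under cutting off caps at a farthest point. -/
lemma parallelogramLaw_variation {d : ℕ} (hd : 0 < d) {K : NormalizedBody d}
    (hH : ∀ᶠ L : NormalizedBody d in 𝓝 K, ∀ x, ∫ y in (L.1 : Set (Rd d)), zonalQuartic x y = 0)
    {c p : Rd d} (hpK : p ∈ (K.1 : Set (Rd d)))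
    (hp : ∀ y ∈ (K.1 : Set (Rd d)), ‖y - c‖ ≤ ‖p - c‖) :
    ParallelogramLaw fun x => ⟪x, p⟫ ^ 2 * (momentRatio K.1 x - ⟪x, p⟫ ^ 2) / ‖x‖ ^ 2 := by
  obtain ⟨L, hL, hlim, hsub, hpos, havg⟩ := K.2.1.exists_seq_caps hd hpK hp
  have hi : ∀ {g : Rd d → ℝ}, Continuous g → IntegrableOn g K.1 volume := fun hg =>
    hg.continuousOn.integrableOn_compact K.1.isCompact
  have hdiff : ∀ n {g : Rd d → ℝ}, Continuous g →
      ∫ y in (K.1 : Set (Rd d)) \ L n, g y =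
        (∫ y in (K.1 : Set (Rd d)), g y) - ∫ y in (L n : Set (Rd d)), g y := fun n g hg =>
    setIntegral_sdiff (L n).measurableSet (hi hg) (hsub n)
  have hev := eventually_parallelogramLaw_momentRatio hH hL hlim hsub
  have hPK := K.2.2.parallelogramLaw_momentRatio hH.self_of_nhds
  have hvar : ∀ x : Rd d, Tendsto (fun n => (momentRatio (L n) x - momentRatio K.1 x) /
      volume.real ((K.1 : Set (Rd d)) \ L n)) atTop
      (𝓝 (⟪x, p⟫ ^ 2 * (momentRatio K.1 x - ⟪x, p⟫ ^ 2) / ‖x‖ ^ 2)) := by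
    intro x
    rcases eq_or_ne x 0 with rfl | hx
    · simp [momentRatio_zero]
    have hx' : ‖x‖ ^ 2 ≠ 0 := pow_ne_zero 2 (norm_ne_zero_iff.2 hx)
    have h2 := havg (fun y => ⟪x, y⟫ ^ 2) (by fun_prop) (fun y => by simp)
    have h4 := havg (fun y => ⟪x, y⟫ ^ 4) (by fun_prop)
      (fun y => by rw [inner_neg_right]; ring)
    have hm : Tendsto (fun n => ∫ y in (L n : Set (Rd d)), ⟪x, y⟫ ^ 2) atTop (𝓝 (‖x‖ ^ 2)) := by
      rw [← K.2.2.integral_inner_sq x]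
      exact (K.1.continuousAt_setIntegral (g := fun y => ⟪x, y⟫ ^ 2) (by fun_prop)).tendsto.comp hlim
    -- With cap moments `s₂`, `s₄` of orders two and four and `m` the second moment of `L n`, the
    -- change of the ratio is exactly `(momentRatio K x * s₂ - s₄) / m`.
    have h := ((h2.const_mul (momentRatio K.1 x)).sub h4).div hm hx'
    have hfin : ⟪x, p⟫ ^ 2 * (momentRatio K.1 x - ⟪x, p⟫ ^ 2) / ‖x‖ ^ 2 =
        (momentRatio K.1 x * ⟪x, p⟫ ^ 2 - ⟪x, p⟫ ^ 4) / ‖x‖ ^ 2 := by ring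
    rw [hfin]
    refine h.congr fun n => ?_
    have hmn : ∫ y in (L n : Set (Rd d)), ⟪x, y⟫ ^ 2 ≠ 0 := by
      have := ((hL n).integral_inner_sq_pos hx).ne'
      simpa only [sq] using this
    have hμ := (hpos n).ne'
    have hT : ∫ y in (K.1 : Set (Rd d)), ⟪x, y⟫ ^ 4 = momentRatio K.1 x * ‖x‖ ^ 2 := by
      rw [momentRatio, K.2.2.integral_inner_sq, div_mul_cancel₀ _ hx']
    simp only [Pi.div_apply]
    rw [hdiff n (g := fun y => ⟪x, y⟫ ^ 2) (by fun_prop),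
      hdiff n (g := fun y => ⟪x, y⟫ ^ 4) (by fun_prop), K.2.2.integral_inner_sq, hT,
      momentRatio.eq_1 (L n)]
    field_simp
    ring
  intro x z
  have h := ((hvar (x + z)).add (hvar (x - z))).sub
    (((hvar x).const_mul 2).add ((hvar z).const_mul 2))
  refine sub_eq_zero.1 (tendsto_nhds_unique h (tendsto_const_nhds.congr' ?_))
  filter_upwards [hev] with n hn
  have h1 := hn x z
  have h2 := hPK x z
  rw [← mul_div_assoc, ← mul_div_assoc, ← add_div, ← add_div, ← sub_div, eq_comm, div_eq_zero_iff]
  left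
  linear_combination h1 - h2

/-- Heuristically, `|x|²` divides the quartic `⟪x,p⟫² (P - ⟪x,p⟫²)` but has no factor in common with
`⟪x,p⟫²`, so `P - ⟪x,p⟫²` is a multiple of it. The proof needs only the parallelogram law at `p ± w`
and `2p ± w` with `w` orthogonal to `p`. -/
lemma eq_of_parallelogramLaw_variation {d : ℕ} {P : Rd d → ℝ} (hP : ParallelogramLaw P)
    (hhom : ∀ (c : ℝ) x, P (c • x) = c ^ 2 * P x) {p : Rd d} (hp : p ≠ 0)
    (hg : ParallelogramLaw fun x => ⟪x, p⟫ ^ 2 * (P x - ⟪x, p⟫ ^ 2) / ‖x‖ ^ 2) :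
    ∃ κ : ℝ, ∀ x, P x = κ * ‖x‖ ^ 2 + ⟪x, p⟫ ^ 2 := by
  have hρ : 0 < ‖p‖ ^ 2 := by positivity
  have hpp : ⟪p, p⟫ = ‖p‖ ^ 2 := real_inner_self_eq_norm_sq p
  have horth : ∀ w : Rd d, ⟪w, p⟫ = 0 → w ≠ 0 →
      ‖p‖ ^ 2 * P w = ‖w‖ ^ 2 * (P p - ‖p‖ ^ 4) ∧ P (p + w) = P p + P w := by
    intro w hw hw0
    have hω : 0 < ‖w‖ ^ 2 := by positivity
    have hw' : ⟪p, w⟫ = 0 := by rwa [real_inner_comm]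
    have n1 : ‖p + w‖ ^ 2 = ‖p‖ ^ 2 + ‖w‖ ^ 2 := by rw [norm_add_sq_real, hw']; ring
    have n2 : ‖p - w‖ ^ 2 = ‖p‖ ^ 2 + ‖w‖ ^ 2 := by rw [norm_sub_sq_real, hw']; ring
    have n3 : ‖p + w + p‖ ^ 2 = 4 * ‖p‖ ^ 2 + ‖w‖ ^ 2 := by
      rw [norm_add_sq_real, n1, inner_add_left, hpp, hw]; ring
    have n4 : ‖p - w + p‖ ^ 2 = 4 * ‖p‖ ^ 2 + ‖w‖ ^ 2 := by
      rw [norm_add_sq_real, n2, inner_sub_left, hpp, hw]; ring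
    have hneg : P (-w) = P w := by
      have := hhom (-1) w
      rw [neg_one_smul] at this
      linarith
    have g1 := hg p w
    have g2 := hg (p + w) p
    have g3 := hg (p - w) p
    have p1 := hP p w
    have p2 := hP (p + w) p
    have p3 := hP (p - w) p
    have e1 : p + w - p = w := by abel
    have e2 : p - w - p = -w := by abel
    rw [e1] at g2 p2
    rw [e2] at g3 p3
    simp only [n1, n2, n3, n4, norm_neg, inner_add_left, inner_sub_left, inner_neg_left, hw, hpp,
      hneg] at g1 g2 g3 p3
    set r := ‖p‖ ^ 2 with hr
    set t := ‖w‖ ^ 2 with ht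
    have hr4 : ‖p‖ ^ 4 = r ^ 2 := by rw [hr]; ring
    have hrt : r + t ≠ 0 := by positivity
    have h4rt : 4 * r + t ≠ 0 := by positivity
    -- No cross term between `p` and `w`: subtracting the relations at `2p + w` and `2p - w`
    -- isolates the difference.
    have hδ : P (p + w) = P (p - w) := by
      have h1 : 6 * t ^ 2 * r ^ 2 * (P (p + w) - P (p - w)) = 0 := by
        field_simp at g2 g3
        have g2' : P (p + w + p) = 2 * P (p + w) + 2 * P p - P w := by linarith
        have g3' : P (p - w + p) = 2 * P (p - w) + 2 * P p - P w := by linarith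
        rw [g2'] at g2
        rw [g3'] at g3
        linear_combination g2 - g3
      have h2 : 6 * t ^ 2 * r ^ 2 ≠ 0 := by positivity
      linarith [(mul_eq_zero.1 h1).resolve_left h2]
    refine ⟨?_, by linarith⟩
    rw [hr4]
    field_simp at g1
    have h2 : 2 * t * r ≠ 0 := by positivity
    refine mul_left_cancel₀ h2 ?_
    linear_combination g1 - t * r ^ 2 * p1
  refine ⟨(P p - ‖p‖ ^ 4) / ‖p‖ ^ 2, fun x => ?_⟩
  set α : ℝ := ⟪x, p⟫ / ‖p‖ ^ 2 with hα
  set w : Rd d := x - α • p with hw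
  have hxw : x = α • p + w := by rw [hw]; abel
  have hαp : ⟪x, p⟫ = α * ‖p‖ ^ 2 := by rw [hα, div_mul_cancel₀ _ hρ.ne']
  have hwp : ⟪w, p⟫ = 0 := by
    rw [hw, inner_sub_left, real_inner_smul_left, hpp, hαp, sub_self]
  have hxn : ‖x‖ ^ 2 = α ^ 2 * ‖p‖ ^ 2 + ‖w‖ ^ 2 := by
    rw [hxw, norm_add_sq_real, real_inner_smul_left, real_inner_comm, hwp, norm_smul, mul_pow,
      Real.norm_eq_abs, sq_abs]
    ring
  have hPx : P x = α ^ 2 * P p + P w := by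
    rcases eq_or_ne α 0 with h0 | h0
    · rw [hxw, h0, zero_smul, zero_add]
      ring
    rcases eq_or_ne w 0 with hw0 | hw0
    · rw [hxw, hw0, add_zero, hhom, ← zero_smul ℝ w, hhom]
      ring
    · have h1 := (horth (α⁻¹ • w) (by rw [real_inner_smul_left, hwp, mul_zero])
        (smul_ne_zero (inv_ne_zero h0) hw0)).2
      have h2 : x = α • (p + α⁻¹ • w) := by rw [smul_add, smul_inv_smul₀ h0, ← hxw]
      rw [h2, hhom, h1, hhom]
      field_simp
  have hPw : ‖p‖ ^ 2 * P w = ‖w‖ ^ 2 * (P p - ‖p‖ ^ 4) := by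
    rcases eq_or_ne w 0 with hw0 | hw0
    · rw [hw0, ← zero_smul ℝ p, hhom, norm_smul]
      simp
    · exact (horth w hwp hw0).1
  rw [hPx, hxn, hαp]
  field_simp
  linear_combination hPw

lemma exists_orthogonal_pair {d : ℕ} (hd : 3 ≤ d) (p q : Rd d) :
    ∃ w : Rd d, ‖w‖ = 1 ∧ ⟪w, p⟫ = 0 ∧ ⟪w, q⟫ = 0 := by
  classical
  set S : Submodule ℝ (Rd d) := Submodule.span ℝ (({p, q} : Finset (Rd d)) : Set (Rd d)) with hS
  have hne : Sᗮ ≠ ⊥ := by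
    intro h
    rw [Submodule.orthogonal_eq_bot_iff] at h
    have h1 := finrank_span_finset_le_card (R := ℝ) ({p, q} : Finset (Rd d))
    rw [Set.finrank, ← hS, h, finrank_top, finrank_euclideanSpace_fin] at h1
    have := Finset.card_le_two (a := p) (b := q)
    omega
  obtain ⟨w, hw, hw0⟩ := Submodule.exists_mem_ne_zero_of_ne_bot hne
  have hin : ∀ z ∈ ({p, q} : Finset (Rd d)), ⟪‖w‖⁻¹ • w, z⟫ = 0 := fun z hz => by
    rw [real_inner_smul_left, Submodule.inner_left_of_mem_orthogonal
      (Submodule.subset_span (Finset.mem_coe.2 hz)) hw, mul_zero]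
  refine ⟨‖w‖⁻¹ • w, ?_, hin p (by simp), hin q (by simp)⟩
  rw [norm_smul, norm_inv, norm_norm, inv_mul_cancel₀ (norm_ne_zero_iff.2 hw0)]

/-- The normalized bodies with a zonal moment that does not vanish identically are dense. -/
lemma frequently_exists_integral_zonalQuartic_ne_zero {d : ℕ} (hd : 3 ≤ d) (K : NormalizedBody d) :
    ∃ᶠ L : NormalizedBody d in 𝓝 K, ∃ x, ∫ y in (L.1 : Set (Rd d)), zonalQuartic x y ≠ 0 := by
  intro hH
  simp only [not_exists, not_not] at hH
  have hd0 : 0 < d := by omega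
  have hfar : ∀ c : Rd d, ∃ p ∈ (K.1 : Set (Rd d)),
      ∀ y ∈ (K.1 : Set (Rd d)), ‖y - c‖ ≤ ‖p - c‖ := fun c =>
    K.1.isCompact.exists_isMaxOn K.1.nonempty
      (by fun_prop : ContinuousOn (fun y : Rd d => ‖y - c‖) K.1)
  have hform : ∀ c p : Rd d, p ∈ (K.1 : Set (Rd d)) →
      (∀ y ∈ (K.1 : Set (Rd d)), ‖y - c‖ ≤ ‖p - c‖) →
      ∃ κ : ℝ, ∀ x, momentRatio K.1 x = κ * ‖x‖ ^ 2 + ⟪x, p⟫ ^ 2 := fun c p hpK hp =>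
    eq_of_parallelogramLaw_variation (K.2.2.parallelogramLaw_momentRatio hH.self_of_nhds)
      (momentRatio_smul K.1) (K.2.1.ne_zero_of_farthest hd0 hp)
      (parallelogramLaw_variation hd0 hH hpK hp)
  obtain ⟨δ, hδ, hball⟩ := K.2.1.exists_ball_subset
  obtain ⟨p, hpK, hp⟩ := hfar 0
  obtain ⟨u, hu, hup, -⟩ := exists_orthogonal_pair hd p p
  -- A center this far along `-u` makes the point `(δ / 2) • u` of `K` too distant for a farthest
  -- point `q` orthogonal to `u` with `‖q‖ ≤ ‖p‖`.
  set t : ℝ := 2 * ‖p‖ ^ 2 / δ with ht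
  have ht0 : 0 ≤ t := by positivity
  obtain ⟨q, hqK, hq⟩ := hfar (-(t • u))
  obtain ⟨w, hw, hwp, hwq⟩ := exists_orthogonal_pair hd p q
  obtain ⟨κ, hκ⟩ := hform 0 p hpK hp
  obtain ⟨κ', hκ'⟩ := hform _ q hqK hq
  -- Evaluating both forms at a common orthogonal direction `w` gives this, and it is where `d ≥ 3`
  -- is needed; at `u` the forms then force `⟪u,q⟫ = 0`.
  have hκκ : κ = κ' := by
    have h1 := hκ w
    rw [hκ' w, hw, hwp, hwq] at h1
    linarith
  have huq : ⟪u, q⟫ = 0 := by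
    have h1 := hκ u
    rw [hκ' u, hu, hup, hκκ] at h1
    exact pow_eq_zero_iff two_ne_zero |>.1 (by linarith)
  have hu2 : (δ / 2) • u ∈ (K.1 : Set (Rd d)) := hball (by
    rw [mem_ball_zero_iff, norm_smul, hu, Real.norm_of_nonneg (by positivity)]
    linarith)
  have h1 := hq _ hu2
  rw [sub_neg_eq_add, sub_neg_eq_add, ← add_smul, norm_smul, hu, mul_one,
    Real.norm_of_nonneg (by positivity)] at h1
  have h2 := pow_le_pow_left₀ (by positivity) h1 2
  rw [norm_add_sq_real, real_inner_smul_right, real_inner_comm, huq, norm_smul, hu,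
    Real.norm_of_nonneg ht0] at h2
  have h3 : ‖q‖ ^ 2 ≤ ‖p‖ ^ 2 :=
    pow_le_pow_left₀ (norm_nonneg _) (by simpa using hp q hqK) 2
  have h4 : t * δ = 2 * ‖p‖ ^ 2 := by rw [ht, div_mul_cancel₀ _ hδ.ne']
  nlinarith

lemma dense_fourthMomentCondition {d : ℕ} (hd : 3 ≤ d) {x₀ : Rd d} (hx₀ : x₀ ≠ 0) :
    Dense {K : NormalizedBody d | FourthMomentCondition x₀ K.1} := by
  intro K
  rw [Metric.mem_closure_iff]
  intro ε hε
  obtain ⟨L, ⟨x, hx⟩, hL⟩ := ((frequently_exists_integral_zonalQuartic_ne_zero hd K).and_eventually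
    (Metric.ball_mem_nhds K (half_pos hε))).exists
  obtain ⟨L', hL', hcond⟩ := exists_dist_lt_fourthMomentCondition hd hx₀ L hx (half_pos hε)
  refine ⟨L', hcond, ?_⟩
  have h1 := dist_triangle L' L K
  have h2 : dist L K < ε / 2 := hL
  rw [dist_comm]
  linarith

end

theorem theorem2 (d : ℕ) :
    -- dimensions one and two
    ((d = 1 ∨ d = 2) →
      ∀ K : ConvexBody (Rd d), IsSymmetricBody K →
        ∀ f : Rd d → ℝ, MemLp f ⊤ volume →
          (IsMaximalFixedPoint K f ↔ ∃ c : ℝ, f =ᵐ[volume] fun _ => c)) ∧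
    -- dimensions three and higher
    (3 ≤ d →
      -- no nonzero fixed points up to the exponent `d / (d - 2)`
      (∀ K : ConvexBody (Rd d), IsSymmetricBody K →
        ∀ p : ℝ, 1 ≤ p → p ≤ (d : ℝ) / ((d : ℝ) - 2) →
          ∀ f : Rd d → ℝ, MemLp f (ENNReal.ofReal p) volume →
            IsMaximalFixedPoint K f → f =ᵐ[volume] 0) ∧
      -- the coefficients may be taken at any point other than the pole
      ∀ x₀ : Rd d, x₀ ≠ 0 →
        -- improvement under the fourth-moment condition
        (∀ K : ConvexBody (Rd d), IsSymmetricBody K → IsNormalized K →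
          FourthMomentCondition x₀ K →
            ∃ q : ℝ, (d : ℝ) / ((d : ℝ) - 2) < q ∧
              ∀ p : ℝ, 1 ≤ p → p ≤ q →
                ∀ f : Rd d → ℝ, MemLp f (ENNReal.ofReal p) volume →
                  IsMaximalFixedPoint K f → f =ᵐ[volume] 0) ∧
        -- the fourth-moment condition is generic
        (IsOpen {K : NormalizedBody d | FourthMomentCondition x₀ K.1} ∧
          Dense {K : NormalizedBody d | FourthMomentCondition x₀ K.1})) := by
  refine ⟨fun hd K hK f hf => ⟨fun h => ?_, fun ⟨c, hc⟩ => isMaximalFixedPoint_of_ae_const hK hc⟩,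
    fun hd => ⟨fun K hK p hp hpd f hf hfix => hfix.ae_zero_of_le hd hK hp hpd hf, fun x₀ hx₀ =>
      ⟨fun K hK hKn hM => exists_exponent_of_fourthMoment hd hK hKn
        ((fourthMomentCondition_iff hd hx₀ K).1 hM), ?_, ?_⟩⟩⟩
  · exact h.ae_const_of_le_two (by omega) hK hf
  · exact isOpen_fourthMomentCondition hd hx₀
  · exact dense_fourthMomentCondition hd hx₀
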